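/- **Setting.** Use the CompCert memory model and values for 64-bit x86: blocks, byte-level cells, maximal and current permissions, and pointers $(b,o)$ with 64-bit offsets. For a memory injection $j$, write $j\vdash v_1\hookrightarrow v_2$ for injection of values and $j\vdash m_1\hookrightarrow_m m_2$ for injection of memories. A cell of the target is *out of reach* of $(j,m_1)$ if no cell of $m_1$ with nonempty maximal permission is mapped to it by $j$. A world $(j,m_1,m_2)$ evolves to $(j',m_1',m_2')$, written $\leadsto_{\mathrm{injp}}$, if: $j\subseteq j'$; cells of allocated blocks that are unmapped in $m_1$ or out of reach in $m_2$ keep their permissions and readable values; for $i=1,2$, from $m_i$ to $m_i'$, allocated blocks stay allocated, maximal permissions of allocated blocks do not grow, and a non-writable cell that is readable afterwards was readable before with the same value; and mappings new in $j'$ relate only newly allocated blocks. An *open labelled transition system* $L$ has a set $D$ of accepted initial queries, initial transitions $I$, internal transitions $\to$ labelled by event traces, outgoing queries $X$, transitions $Y$ on their replies, and final replies $F$. All of these depend on the symbol table in which the module is activated. A *simulation convention* $\mathbb R$ consists of worlds $w$, relations $\mathbb R^q(w)$ and $\mathbb R^r(w)$ on queries and on replies, and a relation on the symbol tables of the two sides;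 conventions compose relationally. $L_1\leqslant_{\mathbb R}L_2$ means that $L_1$ and $L_2$ declare the same symbols and that, for any two symbol tables of which the first provides these symbols, there is a family of relations $R(w)$ between states such that, for each world $w$ relating the tables: related queries are both in $D$ or both not; an initial transition of $L_1$ on a related query is matched by one of $L_2$ into $R(w)$; an internal step of $L_1$ is matched by finitely many (possibly zero) steps of $L_2$ with the same trace; an outgoing query of $L_1$ is matched by a query of $L_2$ related at some world $w_A$ that relates the symbol tables, and after any replies related by $\mathbb R^r(w_A)$ the continuation of $L_1$ is matched by one of $L_2$ in $R(w)$; and a final reply of $L_1$ is matched by one of $L_2$ related by $\mathbb R^r(w)$. Let $\mathbb C=\mathrm{ro}\cdot\mathrm{wt}\cdot\mathrm{CAinjp}\cdot\mathrm{asm}_{\mathrm{injp}}$, relating C calls (function, signature, arguments, memory) and C replies (result, memory) to assembly configurations (registers, memory), where * $\mathrm{ro}$: same query on both sides, global constants are not writable and hold their initial values; on replies, the memory has evolved monotonically as above. * $\mathrm{wt}$: same query and same reply on both sides, arguments and result have the types given by the signature. * $\mathrm{CAinjp}$, with worlds $((j,m_1,m_2),sg,rs)$: $j\vdash m_1\hookrightarrow_m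 m_2$; the function pointer is defined and injected into $rs(\mathrm{PC})$; the arguments are injected into the values at the locations given by the x86-64 System V convention; the stack slots for outgoing arguments are out of reach and freeable; $rs(\mathrm{RSP})$ points to an allocated block and $rs(\mathrm{RA})$ is a defined 64-bit value or pointer. A reply $(r,m_1')$ is related to $(rs',m_2')$ if there is $j'$ with $(j,m_1,m_2)\leadsto_{\mathrm{injp}}(j',m_1',m_2')$, $j'\vdash m_1'\hookrightarrow_m m_2'$, $r$ injected by $j'$ into the result register, the slots for outgoing arguments out of reach of $(j,m_1)$, $rs'(\mathrm{RSP})=rs(\mathrm{RSP})$, $rs'(\mathrm{PC})=rs(\mathrm{RA})$, and all callee-save registers unchanged. * $\mathrm{asm}_{\mathrm{injp}}$, with worlds $(j,m_1,m_2)$: all registers and the memory are related by $j$, and PC is defined; on replies, the same holds for some $j'$ in a world reached by $\leadsto_{\mathrm{injp}}$ (without the condition on PC). $\mathrm{ro}$ and $\mathrm{wt}$ require equal symbol tables; $\mathrm{CAinjp}$ and $\mathrm{asm}_{\mathrm{injp}}$ require $j$ to match the symbol tables of the two sides without shifting or merging global blocks. **The modules.** $M_A$ is an assembly module that declares an external function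 $f$, has a writable global array $s$ of two 32-bit integers, initially $0$, and defines $g$, of the same signature $\mathrm{int}\to\mathrm{int}$ as $f$, by the following code (source operands first, 24-byte stack frame): ``` g: Pallocframe 24 16 0 // save RSP at offset 0, RA at offset 16 Pmov RBX 8(RSP) Pmov RDI RBX Ptestl RBX RBX Pjne l0 Pxorl_r RAX Pjmp l1 l0: Pmov s[0] RAX Pcmpl RAX RBX Pje l2 Pleal -1(RBX) RDI Pcall f Pleal (RAX,RBX) RAX Pmov RBX s[0] Pmov RAX s[1] Pjmp l1 l2: Pmov s[1] RAX l1: Pmov 8(RSP) RBX Pfreeframe 24 16 0 Pret ``` Its open semantics $[\![M_A]\!]$ executes these instructions on registers and memory; it accepts queries whose PC is the address of $g$, calls out when PC is the address of $f$, and replies when it returns with the stack pointer in a block that already existed at the incoming query. $L_A$ is the following C-level specification; it accepts all queries to $g$. Its states are $\mathrm{Callg}\,i\,m$, $\mathrm{Callf}\,v_f\,i\,m$, $\mathrm{Returnf}\,i\,r\,m$, $\mathrm{Returng}\,r\,m$, with $i,r$ 32-bit integers. A call $g(i)$ in memory $m$ starts $\mathrm{Callg}\,i\,m$. The internal steps,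 with empty trace, are: $\mathrm{Callg}\,i\,m\to\mathrm{Returng}\,0\,m$ if $i=0$; $\mathrm{Callg}\,i\,m\to\mathrm{Returng}\,r\,m$ if $i\ne0$, $i=s[0]$ and $r=s[1]$ in $m$; $\mathrm{Callg}\,i\,m\to\mathrm{Callf}\,v_f\,i\,m$ if $i\neq0$, $s[0]$ holds in $m$ an integer other than $i$, and $v_f$ is the address of $f$; $\mathrm{Returnf}\,i\,r\,m\to\mathrm{Returng}\,(i+r)\,m'$ with $m'=m[s[0]\leftarrow i,\ s[1]\leftarrow i+r]$. In $\mathrm{Callf}\,v_f\,i\,m$ it calls $v_f(i-1)$ in memory $m$, and a reply with integer $r$ and memory $m'$ leads to $\mathrm{Returnf}\,i\,r\,m'$. In $\mathrm{Returng}\,r\,m$ it replies with $r$ and $m$. **Theorem.** $L_A\leqslant_{\mathbb C}[\![M_A]\!]$. Moreover $L_A\leqslant_{\mathrm{CAinjp}}[\![M_A]\!]$ holds with (for any two symbol tables as above) a simulation relation $R$ that protects the stack frame, in the following sense. Let $w=((j,m_1,m_2),sg,rs)$ be a world relating the symbol tables, and let $\mathrm{Callf}\,v_f\,i\,m_1'$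 be related by $R(w)$ to a target state with registers $rs'$ and memory $m_2'$. Then there are a block $b_s$ and an injection $j'$ such that: 1. $b_s$ is not allocated in $m_2$; $rs'(\mathrm{RSP})=(b_s,0)$; $(j,m_1,m_2)\leadsto_{\mathrm{injp}}(j',m_1',m_2')$; $j'\vdash m_1'\hookrightarrow_m m_2'$; $j'$ maps no block into $b_s$, so that all cells of $b_s$ are out of reach of $(j',m_1')$; and $m_2'$ holds $rs(\mathrm{RSP})$, $rs(\mathrm{RBX})$, $rs(\mathrm{RA})$ at $(b_s,0)$, $(b_s,8)$, $(b_s,16)$; 2. the target performs the outgoing query $(rs',m_2')$, and this is related to the call $v_f(i-1)$ in $m_1'$ by $\mathrm{CAinjp}$ at the world $w_A=((j',m_1',m_2'),\mathrm{int}\to\mathrm{int},rs')$, which relates the symbol tables; 3. for all replies related at $w_A$, an integer $r$ with memory $m_1''$ on the source side and $(rs'',m_2'')$ on the target side, no permission or readable value of the frame $\{(b_s,o)\mid 0\le o<24\}$ has changed from $m_2'$ to $m_2''$, the target continues from this reply into a state related by $R(w)$ to $\mathrm{Returnf}\,i\,r\,m_1''$, and for this state's registers and memory, $m_1''$ and some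 injection $j''$, the properties in 1 hold again with the same $b_s$. -/

import Mathlib

namespace MutSum

/-! ## Values (64-bit target) -/

/-! Names of global symbols, identifiers of memory blocks, and labels are natural numbers. -/

abbrev Word32 := BitVec 32
abbrev Word64 := BitVec 64
/-- Offsets of pointer values: 64-bit machine words. -/
abbrev Ptrofs := BitVec 64
abbrev Byte := BitVec 8

/-- Run-time values. Floating-point numbers are given by their IEEE bit patterns. -/
inductive Val where
  | undef
  | int (n : Word32)
  | long (n : Word64)
  | float (bits : BitVec 64)
  | single (bits : BitVec 32)
  | ptr (b : ℕ) (o : Ptrofs)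
  deriving DecidableEq

inductive Typ where
  | int | float | long | single | any32 | any64
  deriving DecidableEq

def Val.HasType : Val → Typ → Prop
  | .undef, _ => True
  | .int _, .int => True
  | .int _, .any32 => True
  | .long _, .long => True
  | .float _, .float => True
  | .single _, .single => True
  | .single _, .any32 => True
  | .ptr _ _, .long => True
  | _, .any64 => True
  | _, _ => False

/-- The type of pointers on a 64-bit target. -/
def Typ.ptr : Typ := .long

structure Signature where
  args : List Typ
  res : Option Typ
  deriving DecidableEq

/-- The type of the result; functions returning nothing are given the type `int`. -/
def Signature.resType (sg : Signature) : Typ := sg.res.getD .int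

def Val.ofBool (b : Bool) : Val := .int (if b then 1 else 0)

/-- 32-bit addition. -/
def Val.add : Val → Val → Val
  | .int a, .int b => .int (a + b)
  | _, _ => .undef

/-- 64-bit addition, including pointer arithmetic. -/
def Val.addl : Val → Val → Val
  | .long a, .long b => .long (a + b)
  | .ptr b o, .long n => .ptr b (o + n)
  | .long n, .ptr b o => .ptr b (o + n)
  | _, _ => .undef

def Val.sub : Val → Val → Val
  | .int a, .int b => .int (a - b)
  | _, _ => .undef

def Val.and : Val → Val → Val
  | .int a, .int b => .int (a &&& b)
  | _, _ => .undef

/-- 32-bit equality test; undefined on pointers, which are 64 bits wide. -/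
def Val.cmpEq : Val → Val → Val
  | .int a, .int b => .ofBool (decide (a = b))
  | _, _ => .undef

/-- 32-bit unsigned comparison. -/
def Val.cmpLtu : Val → Val → Val
  | .int a, .int b => .ofBool (a.ult b)
  | _, _ => .undef

/-- Sign bit of a 32-bit integer. -/
def Val.negative : Val → Val
  | .int a => .ofBool a.msb
  | _ => .undef

def Val.subOverflow : Val → Val → Val
  | .int a, .int b => .ofBool (BitVec.ssubOverflow a b)
  | _, _ => .undef

/-- `v + n` where `v` is a pointer. -/
def Val.offsetPtr : Val → Ptrofs → Val
  | .ptr b o, n => .ptr b (o + n)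
  | _, _ => .undef

/-! ## Memory -/

/-- Number of bytes of the representation of which a value fragment is a part. -/
inductive Quantity where
  | q32 | q64
  deriving DecidableEq

def Quantity.size : Quantity → ℕ
  | .q32 => 4
  | .q64 => 8

/-- Contents of one memory cell: undefined, a byte of an integer, or the `n`-th byte of an
opaquely represented value. -/
inductive MemVal where
  | undef
  | byte (b : Byte)
  | fragment (v : Val) (q : Quantity) (n : ℕ)
  deriving DecidableEq

/-- Kinds of memory accesses. -/
inductive Chunk where
  | int8s | int8u | int16s | int16u | int32 | int64 | float32 | float64 | any32 | any64
  deriving DecidableEq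

def Chunk.size : Chunk → ℕ
  | .int8s | .int8u => 1
  | .int16s | .int16u => 2
  | .int32 | .float32 | .any32 => 4
  | .int64 | .float64 | .any64 => 8

def Chunk.align : Chunk → ℤ
  | .int8s | .int8u => 1
  | .int16s | .int16u => 2
  | .int64 => 8
  | .int32 | .float32 | .float64 | .any32 | .any64 => 4

def Typ.chunk : Typ → Chunk
  | .int => .int32
  | .float => .float64
  | .long => .int64
  | .single => .float32
  | .any32 => .any32
  | .any64 => .any64

/-- Little-endian bytes of a machine word. -/
def encodeBits {w : ℕ} (x : BitVec w) : List Byte :=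
  (List.range (w / 8)).map fun k => x.extractLsb' (8 * k) 8

def decodeBits (w : ℕ) (l : List Byte) : BitVec w :=
  BitVec.ofNat w (l.foldr (fun b acc => b.toNat + 256 * acc) 0)

def injBytes (l : List Byte) : List MemVal := l.map .byte

/-- The bytes in the given cells, if all of them hold bytes. -/
def projBytes (l : List MemVal) : Option (List Byte) :=
  l.mapM fun mv => match mv with
    | .byte b => some b
    | _ => none

/-- All the fragments of `v`, from the last one to the first one. -/
def injValue (q : Quantity) (v : Val) : List MemVal :=
  (List.range q.size).reverse.map fun n => .fragment v q n

/-- The value whose fragments are the given cells, if there is one. -/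
def projValue (q : Quantity) (l : List MemVal) : Val :=
  match l with
  | .fragment v _ _ :: _ => if l = injValue q v then v else .undef
  | _ => .undef

/-- The cells that hold a stored value. -/
def encodeVal (c : Chunk) (v : Val) : List MemVal :=
  match v, c with
  | .int n, .int8s => injBytes (encodeBits (n.setWidth 8))
  | .int n, .int8u => injBytes (encodeBits (n.setWidth 8))
  | .int n, .int16s => injBytes (encodeBits (n.setWidth 16))
  | .int n, .int16u => injBytes (encodeBits (n.setWidth 16))
  | .int n, .int32 => injBytes (encodeBits n)
  | .long n, .int64 => injBytes (encodeBits n)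
  | .ptr b o, .int64 => injValue .q64 (.ptr b o)
  | .single n, .float32 => injBytes (encodeBits n)
  | .float n, .float64 => injBytes (encodeBits n)
  | v, .any32 => injValue .q32 v
  | v, .any64 => injValue .q64 v
  | _, c => List.replicate c.size .undef

/-- The value read from the given cells. -/
def decodeVal (c : Chunk) (l : List MemVal) : Val :=
  match projBytes l with
  | some bl =>
    match c with
    | .int8s => .int ((decodeBits 8 bl).signExtend 32)
    | .int8u => .int ((decodeBits 8 bl).setWidth 32)
    | .int16s => .int ((decodeBits 16 bl).signExtend 32)
    | .int16u => .int ((decodeBits 16 bl).setWidth 32)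
    | .int32 => .int (decodeBits 32 bl)
    | .int64 => .long (decodeBits 64 bl)
    | .float32 => .single (decodeBits 32 bl)
    | .float64 => .float (decodeBits 64 bl)
    | .any32 | .any64 => .undef
  | none =>
    match c with
    | .int64 =>
      match projValue .q64 l with
      | .long n => .long n
      | .ptr b o => .ptr b o
      | _ => .undef
    | .any32 =>
      match projValue .q32 l with
      | .int n => .int n
      | .single n => .single n
      | _ => .undef
    | .any64 => projValue .q64 l
    | _ => .undef

inductive Permission where
  | nonempty | readable | writable | freeable
  deriving DecidableEq

def Permission.rank : Permission → ℕ
  | .nonempty => 0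
  | .readable => 1
  | .writable => 2
  | .freeable => 3

inductive PermKind where
  | max | cur
  deriving DecidableEq

/-- A cell annotated with `op` has at least permission `p`. -/
def PermLe (p : Permission) (op : Option Permission) : Prop :=
  ∃ p', op = some p' ∧ p.rank ≤ p'.rank

/-- Memory states. The allocated blocks are those below `nextblock`. -/
structure Mem where
  contents : ℕ → ℤ → MemVal
  access : ℕ → ℤ → PermKind → Option Permission
  nextblock : ℕ
  cur_le_max : ∀ b o p, PermLe p (access b o .cur) → PermLe p (access b o .max)
  noaccess : ∀ b o k, ¬ b < nextblock → access b o k = none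

namespace Mem

def Valid (m : Mem) (b : ℕ) : Prop := b < m.nextblock

def Perm (m : Mem) (b : ℕ) (o : ℤ) (k : PermKind) (p : Permission) : Prop :=
  PermLe p (m.access b o k)

def RangePerm (m : Mem) (b : ℕ) (lo hi : ℤ) (k : PermKind) (p : Permission) : Prop :=
  ∀ o, lo ≤ o → o < hi → m.Perm b o k p

def ValidAccess (m : Mem) (c : Chunk) (b : ℕ) (o : ℤ) (p : Permission) : Prop :=
  m.RangePerm b o (o + c.size) .cur p ∧ c.align ∣ o

/-- Allocate a new block with bounds `lo` and `hi`. -/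
def alloc (m : Mem) (lo hi : ℤ) : Mem × ℕ :=
  ({ contents := fun b o => if b = m.nextblock then .undef else m.contents b o
     access := fun b o k =>
       if b = m.nextblock then (if lo ≤ o ∧ o < hi then some .freeable else none)
       else m.access b o k
     nextblock := m.nextblock + 1
     cur_le_max := by
       intro b o p h
       by_cases hb : b = m.nextblock
       · simpa [hb] using h
       · simp only [hb, if_false] at h ⊢
         exact m.cur_le_max b o p h
     noaccess := by
       intro b o k h
       have h1 : b ≠ m.nextblock := by omega
       simp only [h1, if_false]
       exact m.noaccess b o k (by omega) }, m.nextblock)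

open Classical in
/-- Free the cells of block `b` from `lo` to `hi`. -/
noncomputable def free (m : Mem) (b : ℕ) (lo hi : ℤ) : Option Mem :=
  if m.RangePerm b lo hi .cur .freeable then
    some
      { contents := m.contents
        access := fun b' o k =>
          if b' = b ∧ lo ≤ o ∧ o < hi then none else m.access b' o k
        nextblock := m.nextblock
        cur_le_max := by
          intro b' o p h
          by_cases hb : b' = b ∧ lo ≤ o ∧ o < hi
          · simp only [hb, and_self, if_true] at h
            obtain ⟨_, h, _⟩ := h
            simp at h
          · simp only [hb, if_false] at h ⊢
            exact m.cur_le_max b' o p h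
        noaccess := by
          intro b' o k h
          have h1 := m.noaccess b' o k h
          simp [h1] }
  else none

/-- The `n` cells starting at `(b, o)`. -/
def getN (m : Mem) (b : ℕ) (o : ℤ) (n : ℕ) : List MemVal :=
  (List.range n).map fun k => m.contents b (o + k)

open Classical in
noncomputable def load (c : Chunk) (m : Mem) (b : ℕ) (o : ℤ) : Option Val :=
  if m.ValidAccess c b o .readable then some (decodeVal c (m.getN b o c.size)) else none

open Classical in
noncomputable def store (c : Chunk) (m : Mem) (b : ℕ) (o : ℤ) (v : Val) : Option Mem :=
  if m.ValidAccess c b o .writable then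
    some
      { contents := fun b' x =>
          if b' = b ∧ o ≤ x then ((encodeVal c v)[(x - o).toNat]?).getD (m.contents b' x)
          else m.contents b' x
        access := m.access
        nextblock := m.nextblock
        cur_le_max := m.cur_le_max
        noaccess := m.noaccess }
  else none

noncomputable def loadv (c : Chunk) (m : Mem) : Val → Option Val
  | .ptr b o => m.load c b o.toNat
  | _ => none

noncomputable def storev (c : Chunk) (m : Mem) (a v : Val) : Option Mem :=
  match a with
  | .ptr b o => m.store c b o.toNat v
  | _ => none

end Mem

/-! ## Symbol tables -/

inductive InitData where
  | int8 (n : BitVec 8)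
  | int16 (n : BitVec 16)
  | int32 (n : BitVec 32)
  | int64 (n : BitVec 64)
  | float32 (n : BitVec 32)
  | float64 (n : BitVec 64)
  | space (n : ℕ)
  | addrof (id : ℕ) (o : Ptrofs)

structure GlobVar where
  init : List InitData
  readonly : Bool
  volatile : Bool

/-- What a symbol table records of a global definition. -/
inductive GlobInfo where
  | func
  | var (v : GlobVar)

/-- Symbol tables: `symb` gives the block of a named global definition, `info` its kind. -/
structure SymTbl where
  symb : ℕ → Option ℕ
  info : ℕ → Option GlobInfo
  /-- The blocks below `next` are those of global definitions. -/
  next : ℕ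
  symb_range : ∀ id b, symb id = some b → b < next
  info_range : ∀ b g, info b = some g → b < next
  symb_inj : ∀ id₁ id₂ b, symb id₁ = some b → symb id₂ = some b → id₁ = id₂

/-- The global symbols that a module declares or defines. -/
abbrev Skel := ℕ → Option GlobInfo

/-- `se` provides all the symbols of `sk`. -/
def ValidFor (sk : Skel) (se : SymTbl) : Prop :=
  ∀ id g, sk id = some g → ∃ b, se.symb id = some b ∧ se.info b = some g

/-- The address of a global symbol plus an offset. -/
def SymTbl.address (se : SymTbl) (id : ℕ) (o : Ptrofs) : Val :=
  match se.symb id with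
  | some b => .ptr b o
  | none => .undef

def InitData.bytes (se : SymTbl) : InitData → List MemVal
  | .int8 n => injBytes (encodeBits n)
  | .int16 n => injBytes (encodeBits n)
  | .int32 n => injBytes (encodeBits n)
  | .int64 n => injBytes (encodeBits n)
  | .float32 n => injBytes (encodeBits n)
  | .float64 n => injBytes (encodeBits n)
  | .space n => List.replicate n (.byte 0)
  | .addrof id o =>
    match se.symb id with
    | some b => injValue .q64 (.ptr b o)
    | none => List.replicate 8 .undef

/-- Global constants are not writable and have their initial values in `m`. -/
def ROValid (se : SymTbl) (m : Mem) : Prop :=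
  ∀ id b v, se.symb id = some b → se.info b = some (.var v) →
    v.readonly = true → v.volatile = false →
    (∀ o, ¬ m.Perm b o .max .writable) ∧
    ∀ (k : ℕ) (mv : MemVal), (v.init.flatMap (InitData.bytes se))[k]? = some mv →
      m.Perm b k .cur .readable → m.contents b k = mv

/-! ## Memory injections and the Kripke memory relation `injp` -/

abbrev MemInj := ℕ → Option (ℕ × ℤ)

inductive Val.Inject (j : MemInj) : Val → Val → Prop where
  | undef (v : Val) : Inject j .undef v
  | int (n : Word32) : Inject j (.int n) (.int n)
  | long (n : Word64) : Inject j (.long n) (.long n)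
  | float (n : BitVec 64) : Inject j (.float n) (.float n)
  | single (n : BitVec 32) : Inject j (.single n) (.single n)
  | ptr (b b' : ℕ) (o : Ptrofs) (δ : ℤ) (h : j b = some (b', δ)) :
      Inject j (.ptr b o) (.ptr b' (o + BitVec.ofInt 64 δ))

inductive MemVal.Inject (j : MemInj) : MemVal → MemVal → Prop where
  | undef (mv : MemVal) : Inject j .undef mv
  | byte (b : Byte) : Inject j (.byte b) (.byte b)
  | fragment (v v' : Val) (q : Quantity) (n : ℕ) (h : Val.Inject j v v') :
      Inject j (.fragment v q n) (.fragment v' q n)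

structure Mem.Inject (j : MemInj) (m₁ m₂ : Mem) : Prop where
  perm : ∀ b₁ b₂ δ o k p, j b₁ = some (b₂, δ) → m₁.Perm b₁ o k p → m₂.Perm b₂ (o + δ) k p
  align : ∀ b₁ b₂ δ (c : Chunk) o p, j b₁ = some (b₂, δ) →
    m₁.RangePerm b₁ o (o + c.size) .max p → c.align ∣ δ
  memval : ∀ b₁ b₂ δ o, j b₁ = some (b₂, δ) → m₁.Perm b₁ o .cur .readable →
    MemVal.Inject j (m₁.contents b₁ o) (m₂.contents b₂ (o + δ))
  freeblocks : ∀ b₁, ¬ m₁.Valid b₁ → j b₁ = none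
  mappedblocks : ∀ b₁ b₂ δ, j b₁ = some (b₂, δ) → m₂.Valid b₂
  no_overlap : ∀ b₁ b₂ δ o b₁' b₂' δ' o', b₁ ≠ b₁' →
    j b₁ = some (b₂, δ) → j b₁' = some (b₂', δ') →
    m₁.Perm b₁ o .max .nonempty → m₁.Perm b₁' o' .max .nonempty →
    b₂ ≠ b₂' ∨ o + δ ≠ o' + δ'
  representable : ∀ b₁ b₂ δ (o : Ptrofs), j b₁ = some (b₂, δ) →
    m₁.Perm b₁ o.toNat .max .nonempty ∨ m₁.Perm b₁ (o.toNat - 1) .max .nonempty →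
    0 ≤ δ ∧ (o.toNat : ℤ) + δ < 2 ^ 64
  perm_inv : ∀ b₁ b₂ δ o k p, j b₁ = some (b₂, δ) → m₂.Perm b₂ (o + δ) k p →
    m₁.Perm b₁ o k p ∨ ¬ m₁.Perm b₁ o .max .nonempty

/-- Cells of already allocated blocks whose permissions and values are the same in `m` and
`m'` (values matter only where they can be read), together with all cells of other blocks. -/
def unchangedOn (m m' : Mem) : Set (ℕ × ℤ) :=
  {x | m.Valid x.1 →
    (∀ k p, m.Perm x.1 x.2 k p ↔ m'.Perm x.1 x.2 k p) ∧
    (m.Perm x.1 x.2 .cur .readable → m'.contents x.1 x.2 = m.contents x.1 x.2)}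

def unmapped (j : MemInj) : Set (ℕ × ℤ) := {x | j x.1 = none}

def outOfReach (j : MemInj) (m₁ : Mem) : Set (ℕ × ℤ) :=
  {x | ∀ b₁ δ, j b₁ = some (x.1, δ) → ¬ m₁.Perm b₁ (x.2 - δ) .max .nonempty}

/-- Monotonicity of memory states. -/
structure MemAcc (m m' : Mem) : Prop where
  valid : ∀ b, m.Valid b → m'.Valid b
  max_perm : ∀ b o p, m.Valid b → m'.Perm b o .max p → m.Perm b o .max p
  readonly : ∀ b o, m.Valid b → ¬ m.Perm b o .max .writable → m'.Perm b o .cur .readable →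
    m.contents b o = m'.contents b o ∧ m.Perm b o .cur .readable

/-- A mapping added to an injection relates newly allocated blocks only. -/
def InjSep (j j' : MemInj) (m₁ m₂ : Mem) : Prop :=
  ∀ b₁ b₂ δ, j b₁ = none → j' b₁ = some (b₂, δ) → ¬ m₁.Valid b₁ ∧ ¬ m₂.Valid b₂

structure InjpWorld where
  j : MemInj
  m₁ : Mem
  m₂ : Mem

/-- Accessibility of worlds. -/
structure InjpAcc (w w' : InjpWorld) : Prop where
  incr : ∀ b₁ b₂ δ, w.j b₁ = some (b₂, δ) → w'.j b₁ = some (b₂, δ)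
  unmapped : unmapped w.j ⊆ unchangedOn w.m₁ w'.m₁
  outOfReach : outOfReach w.j w.m₁ ⊆ unchangedOn w.m₂ w'.m₂
  acc₁ : MemAcc w.m₁ w'.m₁
  acc₂ : MemAcc w.m₂ w'.m₂
  sep : InjSep w.j w'.j w.m₁ w.m₂

/-- Two symbol tables are the same up to the injection `j`, which neither hides nor shifts nor
merges blocks of global definitions. -/
structure MatchStbls (j : MemInj) (se₁ se₂ : SymTbl) : Prop where
  dom : ∀ b₁, b₁ < se₁.next → ∃ b₂, j b₁ = some (b₂, 0)
  img : ∀ b₂, b₂ < se₂.next → ∃ b₁, j b₁ = some (b₂, 0)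
  symb : ∀ b₁ b₂ δ, j b₁ = some (b₂, δ) →
    ∀ id, se₁.symb id = some b₁ ↔ se₂.symb id = some b₂
  info : ∀ b₁ b₂ δ, j b₁ = some (b₂, δ) → se₁.info b₁ = se₂.info b₂
  separated : ∀ b₁ b₂ δ, j b₁ = some (b₂, δ) → (b₁ < se₁.next ↔ b₂ < se₂.next)

def InjpWorld.MatchStbls (w : InjpWorld) (se₁ se₂ : SymTbl) : Prop :=
  MutSum.MatchStbls w.j se₁ se₂ ∧ se₁.next ≤ w.m₁.nextblock ∧ se₂.next ≤ w.m₂.nextblock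

/-! ## Open transition systems, simulation conventions, open simulations -/

structure LangInterface where
  Query : Type
  Reply : Type

inductive EventVal where
  | int (n : Word32)
  | long (n : Word64)
  | float (n : BitVec 64)
  | single (n : BitVec 32)
  | ptrGlobal (id : ℕ) (o : Ptrofs)

inductive Event where
  | syscall (name : String) (args : List EventVal) (res : EventVal)
  | vload (c : Chunk) (id : ℕ) (o : Ptrofs) (v : EventVal)
  | vstore (c : Chunk) (id : ℕ) (o : Ptrofs) (v : EventVal)
  | annot (text : String) (args : List EventVal)

/-- Open labelled transition systems with outgoing interface `A` and incoming interface `B`.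
The transitions depend on the symbol table in which the module is activated. -/
structure OpenLTS (A B : LangInterface) where
  skel : Skel
  State : Type
  /-- Initial queries. -/
  D : SymTbl → B.Query → Prop
  /-- Transitions for incoming queries. -/
  I : SymTbl → B.Query → State → Prop
  /-- Internal transitions. -/
  step : SymTbl → State → List Event → State → Prop
  /-- Transitions for incoming replies. -/
  F : SymTbl → State → B.Reply → Prop
  /-- Transitions for outgoing queries. -/
  X : SymTbl → State → A.Query → Prop
  /-- Transitions for outgoing replies. -/
  Y : SymTbl → State → A.Reply → State → Prop
  init_valid : ∀ se q s, I se q s → D se q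

/-- Reflexive transitive closure of the internal transitions. -/
inductive OpenLTS.Star {A B : LangInterface} (L : OpenLTS A B) (se : SymTbl) :
    L.State → List Event → L.State → Prop where
  | refl (s : L.State) : Star L se s [] s
  | step (s : L.State) (t : List Event) (s' : L.State) (t' : List Event) (s'' : L.State)
      (h : L.step se s t s') (h' : Star L se s' t' s'') : Star L se s (t ++ t') s''

/-- Simulation conventions. The relation on replies includes the evolution of worlds. -/
structure SimConv (A₁ A₂ : LangInterface) where
  World : Type
  /-- Related symbol tables. -/
  senv : World → SymTbl → SymTbl → Prop
  query : World → A₁.Query → A₂.Query → Prop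
  reply : World → A₁.Reply → A₂.Reply → Prop

/-- Composition of simulation conventions. -/
def SimConv.comp {A₁ A₂ A₃ : LangInterface} (R : SimConv A₁ A₂) (S : SimConv A₂ A₃) :
    SimConv A₁ A₃ where
  World := R.World × S.World
  senv w se₁ se₃ := ∃ se₂, R.senv w.1 se₁ se₂ ∧ S.senv w.2 se₂ se₃
  query w q₁ q₃ := ∃ q₂, R.query w.1 q₁ q₂ ∧ S.query w.2 q₂ q₃
  reply w r₁ r₃ := ∃ r₂, R.reply w.1 r₁ r₂ ∧ S.reply w.2 r₂ r₃

/-- `R` is an invariant establishing an open forward simulation of `L₁` by `L₂`, activated in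
the symbol tables `se₁` and `se₂`. -/
structure IsOpenSim {A₁ A₂ B₁ B₂ : LangInterface} (RA : SimConv A₁ A₂) (RB : SimConv B₁ B₂)
    (L₁ : OpenLTS A₁ B₁) (L₂ : OpenLTS A₂ B₂) (se₁ se₂ : SymTbl)
    (R : RB.World → L₁.State → L₂.State → Prop) : Prop where
  valid_query : ∀ w q₁ q₂, RB.senv w se₁ se₂ → RB.query w q₁ q₂ →
    (L₁.D se₁ q₁ ↔ L₂.D se₂ q₂)
  initial : ∀ w q₁ q₂ s₁, RB.senv w se₁ se₂ → RB.query w q₁ q₂ → L₁.I se₁ q₁ s₁ →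
    ∃ s₂, R w s₁ s₂ ∧ L₂.I se₂ q₂ s₂
  internal : ∀ w s₁ s₂ t s₁', RB.senv w se₁ se₂ → R w s₁ s₂ → L₁.step se₁ s₁ t s₁' →
    ∃ s₂', R w s₁' s₂' ∧ L₂.Star se₂ s₂ t s₂'
  external : ∀ w s₁ s₂ q₁, RB.senv w se₁ se₂ → R w s₁ s₂ → L₁.X se₁ s₁ q₁ →
    ∃ wA q₂, RA.senv wA se₁ se₂ ∧ RA.query wA q₁ q₂ ∧ L₂.X se₂ s₂ q₂ ∧
      ∀ r₁ r₂ s₁', RA.reply wA r₁ r₂ → L₁.Y se₁ s₁ r₁ s₁' →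
        ∃ s₂', R w s₁' s₂' ∧ L₂.Y se₂ s₂ r₂ s₂'
  final : ∀ w s₁ s₂ r₁, RB.senv w se₁ se₂ → R w s₁ s₂ → L₁.F se₁ s₁ r₁ →
    ∃ r₂, RB.reply w r₁ r₂ ∧ L₂.F se₂ s₂ r₂

/-- Open forward simulation: `L₁ ≤_{RA ↠ RB} L₂`. -/
def OpenSim {A₁ A₂ B₁ B₂ : LangInterface} (RA : SimConv A₁ A₂) (RB : SimConv B₁ B₂)
    (L₁ : OpenLTS A₁ B₁) (L₂ : OpenLTS A₂ B₂) : Prop :=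
  L₁.skel = L₂.skel ∧
  ∀ se₁ se₂, ValidFor L₁.skel se₁ →
    ∃ R : RB.World → L₁.State → L₂.State → Prop, IsOpenSim RA RB L₁ L₂ se₁ se₂ R

/-! ## Language interfaces -/

structure CQuery where
  vf : Val
  sg : Signature
  args : List Val
  mem : Mem

structure CReply where
  res : Val
  mem : Mem

/-- The interface of C. -/
def liC : LangInterface := ⟨CQuery, CReply⟩

/-- Integer registers. -/
inductive IReg where
  | RAX | RBX | RCX | RDX | RSI | RDI | RBP | RSP
  | R8 | R9 | R10 | R11 | R12 | R13 | R14 | R15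
  deriving DecidableEq

/-- Floating-point registers. -/
inductive FReg where
  | XMM0 | XMM1 | XMM2 | XMM3 | XMM4 | XMM5 | XMM6 | XMM7
  | XMM8 | XMM9 | XMM10 | XMM11 | XMM12 | XMM13 | XMM14 | XMM15
  deriving DecidableEq

/-- Bits of the flags register. -/
inductive CRBit where
  | ZF | CF | PF | SF | OF
  deriving DecidableEq

/-- Registers: program counter, integer and floating-point registers, top of the x87 stack,
flags, and the pseudo-register for the return address. -/
inductive PReg where
  | PC
  | IR (r : IReg)
  | FR (r : FReg)
  | ST0
  | CR (c : CRBit)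
  | RA
  deriving DecidableEq

abbrev Regset := PReg → Val

abbrev PReg.SP : PReg := .IR .RSP

structure AsmConf where
  rs : Regset
  mem : Mem

/-- The interface of assembly. -/
def liAsm : LangInterface := ⟨AsmConf, AsmConf⟩

/-! ## Calling convention (x86-64, System V) -/

def intParamRegs : List IReg := [.RDI, .RSI, .RDX, .RCX, .R8, .R9]

def floatParamRegs : List FReg :=
  [.XMM0, .XMM1, .XMM2, .XMM3, .XMM4, .XMM5, .XMM6, .XMM7]

/-- Where an argument is passed: in a register, or in the slot of the outgoing-arguments area
at the given offset, counted in 4-byte words. -/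
inductive Loc where
  | reg (r : PReg)
  | slot (ofs : ℕ) (ty : Typ)

/-- Locations of arguments, given the integer and floating-point parameter registers not yet
used and the next free slot. -/
def locArgs : List Typ → List IReg → List FReg → ℕ → List Loc
  | [], _, _, _ => []
  | ty :: tys, irs, frs, ofs =>
    match ty with
    | .float | .single =>
      match frs with
      | r :: frs' => .reg (.FR r) :: locArgs tys irs frs' ofs
      | [] => .slot ofs ty :: locArgs tys irs frs (ofs + 2)
    | .int | .long | .any32 | .any64 =>
      match irs with
      | r :: irs' => .reg (.IR r) :: locArgs tys irs' frs ofs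
      | [] => .slot ofs ty :: locArgs tys irs frs (ofs + 2)

def locArguments (sg : Signature) : List Loc := locArgs sg.args intParamRegs floatParamRegs 0

/-- Size in 4-byte words of the outgoing-arguments area. -/
def sizeArguments (sg : Signature) : ℕ :=
  (locArguments sg).foldr (fun l n => match l with
    | .slot ofs _ => max (ofs + 2) n
    | .reg _ => n) 0

noncomputable def getLoc (sp : Val) (rs : Regset) (m : Mem) : Loc → Val
  | .reg r => rs r
  | .slot ofs ty => (m.loadv ty.chunk (sp.offsetPtr (BitVec.ofNat 64 (4 * ofs)))).getD .undef

noncomputable def getArgs (sg : Signature) (sp : Val) (rs : Regset) (m : Mem) : List Val :=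
  (locArguments sg).map (getLoc sp rs m)

def getResult (sg : Signature) (rs : Regset) : Val :=
  match sg.resType with
  | .float | .single => rs (.FR .XMM0)
  | .int | .long | .any32 | .any64 => rs (.IR .RAX)

/-- Addresses of the stack slots for outgoing arguments. -/
def outgoingArguments (sg : Signature) (sp : Val) : Set (ℕ × ℤ) :=
  {x | ∃ so : Ptrofs, sp = .ptr x.1 so ∧
    (so.toNat : ℤ) ≤ x.2 ∧ x.2 < (so.toNat : ℤ) + 4 * sizeArguments sg}

def calleeSave : List PReg :=
  [.IR .RBX, .IR .RBP, .IR .R12, .IR .R13, .IR .R14, .IR .R15]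

/-! ## Simulation conventions -/

/-- Constants have their initial values in queries; memory is monotone up to replies. -/
def ccRO : SimConv liC liC where
  World := SymTbl × Mem
  senv w se₁ se₂ := w.1 = se₁ ∧ w.1 = se₂
  query w q₁ q₂ := q₁ = q₂ ∧ CQuery.mem q₁ = w.2 ∧ ROValid w.1 w.2
  reply w r₁ r₂ := r₁ = r₂ ∧ MemAcc w.2 (CReply.mem r₁)

/-- Arguments and results are typed as stated in the signature. -/
def ccWT : SimConv liC liC where
  World := Signature
  senv _ se₁ se₂ := se₁ = se₂
  query sg q₁ q₂ := q₁ = q₂ ∧ CQuery.sg q₁ = sg ∧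
    List.Forall₂ Val.HasType (CQuery.args q₁) sg.args
  reply sg r₁ r₂ := r₁ = r₂ ∧ Val.HasType (CReply.res r₁) sg.resType

structure CAWorld where
  injp : InjpWorld
  sg : Signature
  rs : Regset

/-- Related queries: the function pointer, the arguments and the memory are related by `j`; the
slots for outgoing arguments are private and freeable; the function pointer is defined, the stack
pointer points to a valid block, and the return address is a defined 64-bit value. -/
structure CAQuery (w : CAWorld) (q₁ : CQuery) (q₂ : AsmConf) : Prop where
  mem₁ : q₁.mem = w.injp.m₁
  mem₂ : q₂.mem = w.injp.m₂
  sg : q₁.sg = w.sg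
  rs : q₂.rs = w.rs
  inj : Mem.Inject w.injp.j w.injp.m₁ w.injp.m₂
  vf : Val.Inject w.injp.j q₁.vf (w.rs .PC)
  args : List.Forall₂ (Val.Inject w.injp.j) q₁.args (getArgs w.sg (w.rs .SP) w.rs w.injp.m₂)
  args_private : outgoingArguments w.sg (w.rs .SP) ⊆ outOfReach w.injp.j w.injp.m₁
  args_freeable : outgoingArguments w.sg (w.rs .SP) ⊆
    {x | w.injp.m₂.Perm x.1 x.2 .cur .freeable}
  vf_def : q₁.vf ≠ .undef
  sp_valid : ∃ b o, w.rs .SP = .ptr b o ∧ w.injp.m₂.Valid b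
  ra_def : w.rs .RA ≠ .undef
  ra_type : (w.rs .RA).HasType .ptr

/-- Related replies: the world has evolved, the result is found in its register, and the stack
pointer, return address and callee-save registers are as the convention requires. -/
def CAReply (w : CAWorld) (r₁ : CReply) (r₂ : AsmConf) : Prop :=
  ∃ j' : MemInj,
    InjpAcc w.injp ⟨j', r₁.mem, r₂.mem⟩ ∧
    Mem.Inject j' r₁.mem r₂.mem ∧
    Val.Inject j' r₁.res (getResult w.sg r₂.rs) ∧
    outgoingArguments w.sg (w.rs .SP) ⊆ outOfReach w.injp.j w.injp.m₁ ∧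
    r₂.rs .SP = w.rs .SP ∧
    r₂.rs .PC = w.rs .RA ∧
    ∀ r ∈ calleeSave, r₂.rs r = w.rs r

/-- The calling convention between C and assembly, with memory protection. -/
def ccCAinjp : SimConv liC liAsm where
  World := CAWorld
  senv w := w.injp.MatchStbls
  query := CAQuery
  reply := CAReply

/-- Assembly queries and replies are related by memory injections, with memory protection. -/
def ccAsmInjp : SimConv liAsm liAsm where
  World := InjpWorld
  senv := InjpWorld.MatchStbls
  query w q₁ q₂ := AsmConf.mem q₁ = w.m₁ ∧ AsmConf.mem q₂ = w.m₂ ∧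
    Mem.Inject w.j w.m₁ w.m₂ ∧
    (∀ r, Val.Inject w.j (AsmConf.rs q₁ r) (AsmConf.rs q₂ r)) ∧
    AsmConf.rs q₁ .PC ≠ .undef
  reply w r₁ r₂ := ∃ j' : MemInj,
    InjpAcc w ⟨j', AsmConf.mem r₁, AsmConf.mem r₂⟩ ∧
    Mem.Inject j' (AsmConf.mem r₁) (AsmConf.mem r₂) ∧
    ∀ r, Val.Inject j' (AsmConf.rs r₁ r) (AsmConf.rs r₂ r)

/-- The direct convention `ro · wt · CAinjp · asm_injp` between C and assembly modules. -/
def ccC : SimConv liC liAsm := ccRO.comp (ccWT.comp (ccCAinjp.comp ccAsmInjp))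

/-! ## Assembly -/

/-- `base + index + constant`, where the constant may be the address of a symbol. -/
structure AddrMode where
  base : Option IReg
  index : Option IReg
  const : ℤ ⊕ (ℕ × Ptrofs)

inductive TestCond where
  | e | ne

/-- The x86-64 instructions and pseudo-instructions used below; destinations come first. -/
inductive Instr where
  /-- Allocate a stack frame: size, offset of the return address, offset of the saved stack
  pointer. The two registers are saved and the stack pointer is set to the frame. -/
  | allocframe (sz : ℕ) (ofsRA ofsLink : Ptrofs)
  /-- Free the stack frame at the stack pointer, restoring the stack pointer and the return
  address saved in it. -/
  | freeframe (sz : ℕ) (ofsRA ofsLink : Ptrofs)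
  | mov_rr (rd r : IReg)
  /-- 32-bit load. -/
  | movl_rm (rd : IReg) (a : AddrMode)
  /-- 32-bit store. -/
  | movl_mr (a : AddrMode) (r : IReg)
  /-- Restore a register of any type. -/
  | mov_rm_a (rd : IReg) (a : AddrMode)
  /-- Save a register of any type. -/
  | mov_mr_a (a : AddrMode) (r : IReg)
  | testl_rr (r₁ r₂ : IReg)
  | cmpl_rr (r₁ r₂ : IReg)
  /-- Set a register to zero. -/
  | xorl_r (rd : IReg)
  /-- 32-bit load of an effective address. -/
  | leal (rd : IReg) (a : AddrMode)
  | jmp_l (l : ℕ)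
  | jcc (c : TestCond) (l : ℕ)
  | call_s (id : ℕ)
  | ret
  | label (l : ℕ)

structure AsmFun where
  sg : Signature
  code : List Instr

inductive AsmDef where
  | internal (f : AsmFun)
  | external (sg : Signature)
  | var (v : GlobVar)

/-- Assembly modules. -/
abbrev AsmProg := ℕ → Option AsmDef

def AsmDef.info : AsmDef → GlobInfo
  | .internal _ => .func
  | .external _ => .func
  | .var v => .var v

def AsmProg.skel (p : AsmProg) : Skel := fun id => (p id).map AsmDef.info

/-- The definition of `p` located at block `b`. -/
def AsmProg.DefAt (p : AsmProg) (se : SymTbl) (b : ℕ) (d : AsmDef) : Prop :=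
  ∃ id, se.symb id = some b ∧ p id = some d

section Exec

def evalAddr32 (se : SymTbl) (a : AddrMode) (rs : Regset) : Val :=
  Val.add (match a.base with | none => .int 0 | some r => rs (.IR r))
    (Val.add (match a.index with | none => .int 0 | some r => rs (.IR r))
      (match a.const with | .inl n => .int (BitVec.ofInt 32 n) | .inr (id, o) => se.address id o))

def evalAddr64 (se : SymTbl) (a : AddrMode) (rs : Regset) : Val :=
  Val.addl (match a.base with | none => .long 0 | some r => rs (.IR r))
    (Val.addl (match a.index with | none => .long 0 | some r => rs (.IR r))
      (match a.const with | .inl n => .long (BitVec.ofInt 64 n) | .inr (id, o) => se.address id o))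

def Regset.set (rs : Regset) (r : PReg) (v : Val) : Regset := Function.update rs r v

def Regset.next (rs : Regset) : Regset := rs.set .PC ((rs .PC).offsetPtr 1)

/-- Proceed to the next instruction, leaving the flags undefined. -/
def Regset.nextNF (rs : Regset) : Regset :=
  Regset.next fun r => match r with
    | .CR _ => .undef
    | r => rs r

def compareInts (x y : Val) (rs : Regset) : Regset :=
  ((((rs.set (.CR .ZF) (x.cmpEq y)).set (.CR .CF) (x.cmpLtu y)).set (.CR .SF)
    (x.sub y).negative).set (.CR .OF) (x.subOverflow y)).set (.CR .PF) .undef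

def TestCond.eval (c : TestCond) (rs : Regset) : Option Bool :=
  match rs (.CR .ZF), c with
  | .int n, .e => some (decide (n = 1))
  | .int n, .ne => some (decide (n = 0))
  | _, _ => none

/-- The position following a label. -/
def labelPos (l : ℕ) : List Instr → ℕ → Option ℕ
  | [], _ => none
  | i :: c, pos =>
    match i with
    | .label l' => if l' = l then some (pos + 1) else labelPos l c (pos + 1)
    | _ => labelPos l c (pos + 1)

def gotoLabel (f : AsmFun) (l : ℕ) (rs : Regset) : Option Regset :=
  match labelPos l f.code 0, rs .PC with
  | some pos, .ptr b _ => some (rs.set .PC (.ptr b (BitVec.ofNat 64 pos)))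
  | _, _ => none

/-- Whether the stack pointer belongs to the current activation of the module, that is, points
to a block allocated since the incoming query, at which the first free block was `nb`. -/
def innerSP (nb : ℕ) : Val → Option Bool
  | .ptr b _ => some (decide (nb ≤ b))
  | _ => none

/-- Execute one instruction. The result tells whether the activation is still running. -/
noncomputable def execInstr (se : SymTbl) (nb : ℕ) (f : AsmFun) (i : Instr) (rs : Regset)
    (m : Mem) : Option (Regset × Mem × Bool) :=
  match i with
  | .allocframe sz ofsRA ofsLink =>
    let (m₁, b) := m.alloc 0 sz
    let sp := Val.ptr b 0
    (m₁.storev .int64 (sp.offsetPtr ofsLink) (rs .SP)).bind fun m₂ =>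
      (m₂.storev .int64 (sp.offsetPtr ofsRA) (rs .RA)).map fun m₃ =>
        (Regset.next ((rs.set (.IR .RAX) (rs .SP)).set .SP sp), m₃, true)
  | .freeframe sz ofsRA ofsLink =>
    (m.loadv .int64 ((rs .SP).offsetPtr ofsRA)).bind fun ra =>
      (m.loadv .int64 ((rs .SP).offsetPtr ofsLink)).bind fun sp =>
        match rs .SP with
        | .ptr b o => (m.free b o.toNat (o.toNat + sz)).map fun m' =>
            (Regset.next ((rs.set .SP sp).set .RA ra), m', true)
        | _ => none
  | .mov_rr rd r => some (Regset.next (rs.set (.IR rd) (rs (.IR r))), m, true)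
  | .movl_rm rd a => (m.loadv .int32 (evalAddr64 se a rs)).map fun v =>
      (Regset.nextNF (rs.set (.IR rd) v), m, true)
  | .movl_mr a r => (m.storev .int32 (evalAddr64 se a rs) (rs (.IR r))).map fun m' =>
      (rs.nextNF, m', true)
  | .mov_rm_a rd a => (m.loadv .any64 (evalAddr64 se a rs)).map fun v =>
      (Regset.nextNF (rs.set (.IR rd) v), m, true)
  | .mov_mr_a a r => (m.storev .any64 (evalAddr64 se a rs) (rs (.IR r))).map fun m' =>
      (rs.nextNF, m', true)
  | .testl_rr r₁ r₂ =>
    some (Regset.next (compareInts ((rs (.IR r₁)).and (rs (.IR r₂))) (.int 0) rs), m, true)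
  | .cmpl_rr r₁ r₂ => some (Regset.next (compareInts (rs (.IR r₁)) (rs (.IR r₂)) rs), m, true)
  | .xorl_r rd => some (Regset.nextNF (rs.set (.IR rd) (.int 0)), m, true)
  | .leal rd a => some (Regset.next (rs.set (.IR rd) (evalAddr32 se a rs)), m, true)
  | .jmp_l l => (gotoLabel f l rs).map fun rs' => (rs', m, true)
  | .jcc c l =>
    match c.eval rs with
    | some true => (gotoLabel f l rs).map fun rs' => (rs', m, true)
    | some false => some (rs.next, m, true)
    | none => none
  | .call_s id =>
    some ((rs.set .RA ((rs .PC).offsetPtr 1)).set .PC (se.address id 0), m, true)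
  | .ret => (innerSP nb (rs .SP)).map fun live => (rs.set .PC (rs .RA), m, live)
  | .label _ => some (rs.next, m, true)

end Exec

/-- States of an assembly module: registers and memory, with the first block that was free at
the incoming query, and a flag telling whether the activation is still running. -/
structure AsmState where
  nb : ℕ
  rs : Regset
  mem : Mem
  live : Bool

inductive AsmStep (p : AsmProg) (se : SymTbl) : AsmState → List Event → AsmState → Prop where
  | exec (nb : ℕ) (rs : Regset) (m : Mem) (b : ℕ) (o : Ptrofs) (f : AsmFun) (i : Instr)
      (rs' : Regset) (m' : Mem) (live : Bool)
      (hpc : rs .PC = .ptr b o) (hf : p.DefAt se b (.internal f))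
      (hi : f.code[o.toNat]? = some i)
      (he : execInstr se nb f i rs m = some (rs', m', live)) :
      AsmStep p se ⟨nb, rs, m, true⟩ [] ⟨nb, rs', m', live⟩

/-- The open semantics of an assembly module. -/
def asmSem (p : AsmProg) : OpenLTS liAsm liAsm where
  skel := p.skel
  State := AsmState
  D se q := ∃ b f, AsmConf.rs q .PC = .ptr b 0 ∧ p.DefAt se b (.internal f)
  I se q s := (∃ b f, AsmConf.rs q .PC = .ptr b 0 ∧ p.DefAt se b (.internal f)) ∧
    AsmConf.rs q .SP ≠ .undef ∧ AsmConf.rs q .RA ≠ .undef ∧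
    s = ⟨(AsmConf.mem q).nextblock, AsmConf.rs q, AsmConf.mem q, true⟩
  step := AsmStep p
  F _ s r := s.live = false ∧ r = AsmConf.mk s.rs s.mem
  X se s q := s.live = true ∧ q = AsmConf.mk s.rs s.mem ∧
    ∃ b sg, s.rs .PC = .ptr b 0 ∧ p.DefAt se b (.external sg)
  Y se s r s' := s.live = true ∧
    (∃ b sg, s.rs .PC = .ptr b 0 ∧ p.DefAt se b (.external sg)) ∧
    s.mem.nextblock ≤ (AsmConf.mem r).nextblock ∧
    ∃ live, innerSP s.nb (AsmConf.rs r .SP) = some live ∧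
      s' = ⟨s.nb, AsmConf.rs r, AsmConf.mem r, live⟩
  init_valid := fun _ _ _ h => h.1

/-! ## The assembly module `M_A` and its specification `L_A` -/

/-- The signature of `f` and `g`: from `int` to `int`. -/
def sgIntInt : Signature := ⟨[.int], some .int⟩

def idF : ℕ := 1
def idG : ℕ := 2
def idS : ℕ := 3

def l0 : ℕ := 0
def l1 : ℕ := 1
def l2 : ℕ := 2

/-- `n(r)` -/
def atReg (n : ℤ) (r : IReg) : AddrMode := ⟨some r, none, .inl n⟩
/-- `s[k]`, where `s` is an array of 4-byte integers. -/
def atS (k : ℕ) : AddrMode := ⟨none, none, .inr (idS, BitVec.ofNat 64 (4 * k))⟩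

/-- The hand-written code of `g`. -/
def codeG : List Instr :=
  [ .allocframe 24 16 0,
    .mov_mr_a (atReg 8 .RSP) .RBX,
    .mov_rr .RBX .RDI,
    .testl_rr .RBX .RBX,
    .jcc .ne l0,
    .xorl_r .RAX,
    .jmp_l l1,
    .label l0,
    .movl_rm .RAX (atS 0),
    .cmpl_rr .RAX .RBX,
    .jcc .e l2,
    .leal .RDI (atReg (-1) .RBX),
    .call_s idF,
    .leal .RAX ⟨some .RAX, some .RBX, .inl 0⟩,
    .movl_mr (atS 0) .RBX,
    .movl_mr (atS 1) .RAX,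
    .jmp_l l1,
    .label l2,
    .movl_rm .RAX (atS 1),
    .label l1,
    .mov_rm_a .RBX (atReg 8 .RSP),
    .freeframe 24 16 0,
    .ret ]

/-- `M_A` declares `f`, defines `g`, and has a global array `s` of two integers. -/
def progA : AsmProg := fun id =>
  if id = idF then some (.external sgIntInt)
  else if id = idG then some (.internal ⟨sgIntInt, codeG⟩)
  else if id = idS then some (.var ⟨[.int32 0, .int32 0], false, false⟩)
  else none

/-- Internal states of `L_A`. -/
inductive StateA where
  | callg (i : Word32) (m : Mem)
  | callf (vf : Val) (i : Word32) (m : Mem)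
  | returnf (i r : Word32) (m : Mem)
  | returng (r : Word32) (m : Mem)

inductive InitA (se : SymTbl) : CQuery → StateA → Prop where
  | intro (bg : ℕ) (i : Word32) (m : Mem) (hg : se.symb idG = some bg) :
      InitA se ⟨.ptr bg 0, sgIntInt, [.int i], m⟩ (.callg i m)

inductive StepA (se : SymTbl) : StateA → List Event → StateA → Prop where
  | zero (i : Word32) (m : Mem) (hi : i = 0) : StepA se (.callg i m) [] (.returng 0 m)
  | cached (i r : Word32) (m : Mem) (b : ℕ) (hi : i ≠ 0) (hs : se.symb idS = some b)
      (h0 : m.load .int32 b 0 = some (.int i)) (h1 : m.load .int32 b 4 = some (.int r)) :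
      StepA se (.callg i m) [] (.returng r m)
  | call (i i' : Word32) (m : Mem) (b bf : ℕ) (hi : i ≠ 0) (hs : se.symb idS = some b)
      (h0 : m.load .int32 b 0 = some (.int i')) (hne : i ≠ i')
      (hf : se.symb idF = some bf) :
      StepA se (.callg i m) [] (.callf (.ptr bf 0) i m)
  | sum (i r : Word32) (m m' m'' : Mem) (b : ℕ) (hs : se.symb idS = some b)
      (h0 : m.store .int32 b 0 (.int i) = some m')
      (h1 : m'.store .int32 b 4 (.int (i + r)) = some m'') :
      StepA se (.returnf i r m) [] (.returng (i + r) m'')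

inductive ExtA : StateA → CQuery → Prop where
  | intro (vf : Val) (i : Word32) (m : Mem) :
      ExtA (.callf vf i m) ⟨vf, sgIntInt, [.int (i - 1)], m⟩

inductive AfterA : StateA → CReply → StateA → Prop where
  | intro (vf : Val) (i r : Word32) (m m' : Mem) :
      AfterA (.callf vf i m) ⟨.int r, m'⟩ (.returnf i r m')

inductive FinalA : StateA → CReply → Prop where
  | intro (r : Word32) (m : Mem) : FinalA (.returng r m) ⟨.int r, m⟩

/-- The C-level specification of `M_A`. Its initial queries are the calls to `g`. -/
def specA : OpenLTS liC liC where
  skel := progA.skel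
  State := StateA
  D se q := ∃ bg, se.symb idG = some bg ∧ CQuery.vf q = .ptr bg 0
  I := InitA
  step := StepA
  F _ := FinalA
  X _ := ExtA
  Y _ := AfterA
  init_valid := by
    intro se q s h
    cases h with
    | intro bg i m hg => exact ⟨bg, hg, rfl⟩

/-! ## Protection of the stack frame -/

/-- `bs` is the stack frame of the activation of `M_A` that started in the world `w`: a block
allocated since then, holding the saved stack pointer, `RBX` and return address, and out of
reach of the source memory `m₁'` under the current injection `j'`. -/
structure FramePrivate (w : CAWorld) (bs : ℕ) (j' : MemInj) (m₁' : Mem) (rs' : Regset)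
    (m₂' : Mem) : Prop where
  fresh : ¬ w.injp.m₂.Valid bs
  sp : rs' .SP = .ptr bs 0
  acc : InjpAcc w.injp ⟨j', m₁', m₂'⟩
  inj : Mem.Inject j' m₁' m₂'
  no_preimage : ∀ b δ, j' b ≠ some (bs, δ)
  out_of_reach : ∀ o, (bs, o) ∈ outOfReach j' m₁'
  saved_sp : m₂'.load .int64 bs 0 = some (w.rs .SP)
  saved_rbx : m₂'.load .any64 bs 8 = some (w.rs (.IR .RBX))
  saved_ra : m₂'.load .int64 bs 16 = some (w.rs .RA)

/-- Whenever `R` relates a source state about to call `f` to a target state, the target is about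
to make the corresponding call, its stack frame is private, no call that respects the convention
changes any cell of the frame, and the frame is still private after the call. -/
def FrameProtected (se₁ se₂ : SymTbl) (R : CAWorld → StateA → AsmState → Prop) : Prop :=
  ∀ w vf i m₁' s₂, w.injp.MatchStbls se₁ se₂ → R w (.callf vf i m₁') s₂ →
    ∃ (bs : ℕ) (j' : MemInj),
      FramePrivate w bs j' m₁' s₂.rs s₂.mem ∧
      (asmSem progA).X se₂ s₂ (AsmConf.mk s₂.rs s₂.mem) ∧
      ccCAinjp.senv ⟨⟨j', m₁', s₂.mem⟩, sgIntInt, s₂.rs⟩ se₁ se₂ ∧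
      CAQuery ⟨⟨j', m₁', s₂.mem⟩, sgIntInt, s₂.rs⟩
        ⟨vf, sgIntInt, [.int (i - 1)], m₁'⟩ ⟨s₂.rs, s₂.mem⟩ ∧
      ∀ (r : Word32) (m₁'' : Mem) (rs'' : Regset) (m₂'' : Mem),
        CAReply ⟨⟨j', m₁', s₂.mem⟩, sgIntInt, s₂.rs⟩ ⟨.int r, m₁''⟩ ⟨rs'', m₂''⟩ →
        (∀ o : ℤ, 0 ≤ o → o < 24 → (bs, o) ∈ unchangedOn s₂.mem m₂'') ∧
        ∃ (j'' : MemInj) (s₂' : AsmState),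
          FramePrivate w bs j'' m₁'' s₂'.rs s₂'.mem ∧
          (asmSem progA).Y se₂ s₂ (AsmConf.mk rs'' m₂'') s₂' ∧
          R w (.returnf i r m₁'') s₂'

end MutSum

/-!
# The hand-written assembly module `M_A` implements its specification `L_A`

The core of the proof is the simulation of `L_A` by the code of `g` under the calling convention
`CAinjp`. The stack frame of `g` is a block allocated by the target alone, to which no source block
is mapped. Up to the call of `f` the source memory and the injection are those of the incoming
query, so that the target memory differs from the incoming one in the frame only (`EqOff`), and
such a difference affects neither the injection nor the evolution of the world. At the call, all
cells of the frame are out of reach of the source memory. Hence `injp` forces the callee to leave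
them alone, and it forbids new mappings into the frame, because new mappings relate new blocks
only (`Active.evolve`). So after the call the frame still holds the registers of the caller, while
the world has evolved transitively (`InjpAcc.trans`) from that of the incoming query. The two
stores to `s` then run in parallel on both sides (`Mem.Inject.store`), and the epilogue restores
the saved registers (`Active.finish`). The same facts (`simRel_call`) are the protection of the
frame.

The direct convention `ro · wt · CAinjp · asm_injp` is obtained by composing simulations
(`OpenSim.comp`). `L_A` simulates itself under `ro` and `wt`, and any assembly module simulates
itself under `asm_injp` (`asmSem_self_sim`): every instruction maps configurations related by an
injection to related ones (`execInstr_inject`), since memory operations do so and since the test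
whether the stack pointer belongs to the current activation has the same outcome on both sides
(`innerSP_inject`).
-/

namespace MutSum

/-! ### Permissions and memory operations -/

theorem PermLe.mono {p q : Permission} {op : Option Permission} (h : PermLe p op)
    (hq : q.rank ≤ p.rank) : PermLe q op := by
  obtain ⟨p', h1, h2⟩ := h
  exact ⟨p', h1, hq.trans h2⟩

theorem Chunk.size_pos (c : Chunk) : 0 < c.size := by cases c <;> decide

namespace Mem

variable {m m' m'' : Mem} {b b' : ℕ} {o x lo hi : ℤ} {k : PermKind} {p q : Permission}
  {c : Chunk} {v : Val}

theorem Perm.mono (h : m.Perm b o k p) (hq : q.rank ≤ p.rank) : m.Perm b o k q :=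
  PermLe.mono h hq

theorem Perm.max (h : m.Perm b o k p) : m.Perm b o .max p := by
  cases k with
  | max => exact h
  | cur => exact m.cur_le_max b o p h

theorem Perm.nonempty (h : m.Perm b o k p) : m.Perm b o .max .nonempty :=
  h.max.mono (Nat.zero_le _)

theorem Perm.valid (h : m.Perm b o k p) : m.Valid b := by
  by_contra hv
  obtain ⟨p', h1, _⟩ := h
  rw [m.noaccess b o k hv] at h1
  cases h1

theorem ValidAccess.nonempty (h : m.ValidAccess c b o p) : m.Perm b o .max .nonempty :=
  (h.1 o le_rfl (by have := c.size_pos; omega)).nonempty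

theorem ValidAccess.valid (h : m.ValidAccess c b o p) : m.Valid b := h.nonempty.valid

/-- The list of offsets in `getN` is a list of integers, coerced elementwise. -/
theorem getN_eq_map (m : Mem) (b : ℕ) (o : ℤ) (n : ℕ) :
    m.getN b o n = (List.range n).map fun k : ℕ => m.contents b (o + k) := by
  simp [getN, List.map_eq_flatMap, List.flatMap_assoc]

theorem length_getN (m : Mem) (b : ℕ) (o : ℤ) (n : ℕ) : (m.getN b o n).length = n := by
  simp [getN_eq_map]

theorem load_eq_some {v : Val} :
    m.load c b o = some v ↔
      m.ValidAccess c b o .readable ∧ decodeVal c (m.getN b o c.size) = v := by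
  unfold load
  split_ifs with h <;> simp [h]

theorem exists_store (h : m.ValidAccess c b o .writable) (v : Val) :
    ∃ m', m.store c b o v = some m' := by
  unfold store
  rw [if_pos h]
  exact ⟨_, rfl⟩

theorem length_injBytes_encodeBits {w : ℕ} (y : BitVec w) :
    (injBytes (encodeBits y)).length = w / 8 := by
  simp [injBytes, encodeBits]

theorem length_injValue (q : Quantity) (v : Val) : (injValue q v).length = q.size := by
  simp [injValue]

theorem length_encodeVal (c : Chunk) (v : Val) : (encodeVal c v).length = c.size := by
  cases c <;> cases v <;>
    simp [encodeVal, length_injBytes_encodeBits, length_injValue, Chunk.size, Quantity.size]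

theorem store_access (h : m.store c b o v = some m') : m'.access = m.access := by
  unfold store at h
  split_ifs at h
  simp only [Option.some.injEq] at h
  rw [← h]

theorem store_nextblock (h : m.store c b o v = some m') : m'.nextblock = m.nextblock := by
  unfold store at h
  split_ifs at h
  simp only [Option.some.injEq] at h
  rw [← h]

theorem store_validAccess (h : m.store c b o v = some m') : m.ValidAccess c b o .writable := by
  unfold store at h
  split_ifs at h with h1
  exact h1

theorem store_contents_same (h : m.store c b o v = some m') {n : ℕ}
    (hn : n < (encodeVal c v).length) : m'.contents b (o + n) = (encodeVal c v)[n] := by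
  unfold store at h
  split_ifs at h
  simp only [Option.some.injEq] at h
  rw [← h]
  simp [hn]

theorem store_contents_other (h : m.store c b o v = some m')
    (hx : ¬ (b' = b ∧ o ≤ x ∧ x < o + c.size)) : m'.contents b' x = m.contents b' x := by
  unfold store at h
  split_ifs at h
  simp only [Option.some.injEq] at h
  rw [← h]
  by_cases h1 : b' = b ∧ o ≤ x
  · have : (encodeVal c v).length ≤ (x - o).toNat := by
      rw [length_encodeVal]; have := h1.2; have := hx ∘ fun h => ⟨h1.1, h1.2, h⟩; omega
    simp [h1, List.getElem?_eq_none this]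
  · simp [h1]

theorem store_perm (h : m.store c b o v = some m') :
    m'.Perm b' x k p ↔ m.Perm b' x k p := by
  unfold Perm; rw [store_access h]

theorem store_valid (h : m.store c b o v = some m') : m'.Valid b' ↔ m.Valid b' := by
  unfold Valid; rw [store_nextblock h]

theorem store_getN (h : m.store c b o v = some m') : m'.getN b o c.size = encodeVal c v := by
  apply List.ext_getElem
  · rw [length_getN, length_encodeVal]
  · intro n h1 h2
    simp only [getN_eq_map, List.getElem_map, List.getElem_range]
    exact store_contents_same h h2

theorem load_store_same (h : m.store c b o v = some m') (hv : decodeVal c (encodeVal c v) = v) :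
    m'.load c b o = some v := by
  rw [load_eq_some, store_getN h]
  refine ⟨⟨fun x h1 h2 => ?_, (store_validAccess h).2⟩, hv⟩
  rw [store_perm h]
  exact ((store_validAccess h).1 x h1 h2).mono (by decide)

theorem store_unchanged (h : m.store c b o v = some m')
    (hx : ¬ (b' = b ∧ o ≤ x ∧ x < o + c.size)) : (b', x) ∈ unchangedOn m m' :=
  fun _ => ⟨fun _ _ => (store_perm h).symm, fun _ => store_contents_other h hx⟩

theorem alloc_perm_other (h : b ≠ m.nextblock) :
    (m.alloc lo hi).1.Perm b x k p ↔ m.Perm b x k p := by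
  simp [Perm, alloc, h]

theorem alloc_perm_new :
    (m.alloc lo hi).1.Perm m.nextblock x k p ↔ lo ≤ x ∧ x < hi := by
  by_cases h : lo ≤ x ∧ x < hi
  · simp only [Perm, alloc, h, if_true, and_self, iff_true]
    exact ⟨_, rfl, by cases p <;> decide⟩
  · simp [Perm, alloc, h, PermLe]

theorem alloc_valid : (m.alloc lo hi).1.Valid b ↔ m.Valid b ∨ b = m.nextblock := by
  simp only [Valid, alloc]; omega

theorem alloc_contents_other (h : b ≠ m.nextblock) :
    (m.alloc lo hi).1.contents b x = m.contents b x := by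
  simp [alloc, h]

theorem alloc_contents_new : (m.alloc lo hi).1.contents m.nextblock x = .undef := by
  simp [alloc]

theorem alloc_unchanged : (b, x) ∈ unchangedOn m (m.alloc lo hi).1 := by
  intro hv
  have hb : b ≠ m.nextblock := ne_of_lt hv
  exact ⟨fun _ _ => (alloc_perm_other hb).symm, fun _ => alloc_contents_other hb⟩

theorem exists_free (h : m.RangePerm b lo hi .cur .freeable) : ∃ m', m.free b lo hi = some m' := by
  unfold free
  rw [if_pos h]
  exact ⟨_, rfl⟩

theorem free_rangePerm (h : m.free b lo hi = some m') : m.RangePerm b lo hi .cur .freeable := by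
  unfold free at h
  split_ifs at h with h1
  exact h1

theorem free_contents (h : m.free b lo hi = some m') : m'.contents = m.contents := by
  unfold free at h
  split_ifs at h
  simp only [Option.some.injEq] at h
  rw [← h]

theorem free_nextblock (h : m.free b lo hi = some m') : m'.nextblock = m.nextblock := by
  unfold free at h
  split_ifs at h
  simp only [Option.some.injEq] at h
  rw [← h]

theorem free_valid (h : m.free b lo hi = some m') : m'.Valid b' ↔ m.Valid b' := by
  unfold Valid; rw [free_nextblock h]

theorem free_perm (h : m.free b lo hi = some m') :
    m'.Perm b' x k p ↔ m.Perm b' x k p ∧ ¬ (b' = b ∧ lo ≤ x ∧ x < hi) := by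
  unfold free at h
  split_ifs at h
  simp only [Option.some.injEq] at h
  rw [← h]
  by_cases h1 : b' = b ∧ lo ≤ x ∧ x < hi
  · simp [Perm, h1, PermLe]
  · simp [Perm, h1]

theorem free_unchanged (h : m.free b lo hi = some m') (hx : ¬ (b' = b ∧ lo ≤ x ∧ x < hi)) :
    (b', x) ∈ unchangedOn m m' :=
  fun _ => ⟨fun _ _ => by rw [free_perm h]; tauto, fun _ => by rw [free_contents h]⟩

theorem free_empty (m : Mem) (b : ℕ) (lo : ℤ) : m.free b lo lo = some m := by
  have hr : m.RangePerm b lo lo .cur .freeable := fun o h1 h2 => absurd h2 (not_lt.mpr h1)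
  unfold free
  rw [if_pos hr]
  have : ∀ (b' : ℕ) (o : ℤ), ¬ (b' = b ∧ lo ≤ o ∧ o < lo) := by intros; omega
  simp [this]

theorem unchangedOn_trans {y : ℕ × ℤ} (h : y ∈ unchangedOn m m') (h' : y ∈ unchangedOn m' m'')
    (hv : m.Valid y.1 → m'.Valid y.1) : y ∈ unchangedOn m m'' := by
  intro hm
  obtain ⟨h1, h2⟩ := h hm
  obtain ⟨h3, h4⟩ := h' (hv hm)
  exact ⟨fun k p => (h1 k p).trans (h3 k p),
    fun hr => (h4 ((h1 _ _).1 hr)).trans (h2 hr)⟩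

theorem load_unchanged (h : m.load c b o = some v)
    (hu : ∀ x, o ≤ x → x < o + c.size → (b, x) ∈ unchangedOn m m') :
    m'.load c b o = some v := by
  rw [load_eq_some] at h ⊢
  obtain ⟨⟨h1, h2⟩, h3⟩ := h
  have hv : m.Valid b := ValidAccess.valid ⟨h1, h2⟩
  refine ⟨⟨fun x hx hx' => ((hu x hx hx' hv).1 _ _).1 (h1 x hx hx'), h2⟩, ?_⟩
  rw [← h3]
  congr 1
  rw [getN_eq_map, getN_eq_map]
  apply List.map_congr_left
  intro n hn
  rw [List.mem_range] at hn
  exact (hu (o + n) (by omega) (by omega) hv).2 (h1 _ (by omega) (by omega))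

end Mem

/-! ### Representations of values in memory -/

theorem projBytes_injBytes (l : List Byte) : projBytes (injBytes l) = some l := by
  induction l with
  | nil => rfl
  | cons b l ih =>
    simp only [projBytes, injBytes] at ih
    simp [projBytes, injBytes, ih]

theorem decodeBits_encodeBits_64 (n : Word64) : decodeBits 64 (encodeBits n) = n := by
  apply BitVec.eq_of_toNat_eq
  have h := n.isLt
  simp only [decodeBits, encodeBits, List.range, List.range.loop, List.map, List.foldr,
    BitVec.extractLsb'_toNat, BitVec.toNat_ofNat, Nat.shiftRight_eq_div_pow]
  norm_num
  omega

theorem injValue_eq_cons (q : Quantity) (v : Val) :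
    ∃ n l, injValue q v = .fragment v q n :: l := by
  cases q
  · exact ⟨3, (injValue .q32 v).tail, rfl⟩
  · exact ⟨7, (injValue .q64 v).tail, rfl⟩

theorem projValue_injValue (q : Quantity) (v : Val) : projValue q (injValue q v) = v := by
  obtain ⟨n, l, h⟩ := injValue_eq_cons q v
  rw [h]
  simp [projValue, h]

theorem projBytes_injValue_q64 (v : Val) : projBytes (injValue .q64 v) = none := rfl

theorem decode_encode_any64 (v : Val) : decodeVal .any64 (encodeVal .any64 v) = v := by
  have : encodeVal .any64 v = injValue .q64 v := by cases v <;> rfl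
  simp only [decodeVal, this, projBytes_injValue_q64, projValue_injValue]

theorem decode_encode_int64 {v : Val} (h : v.HasType .ptr) (hu : v ≠ .undef) :
    decodeVal .int64 (encodeVal .int64 v) = v := by
  cases v with
  | undef => exact absurd rfl hu
  | long n => simp only [decodeVal, encodeVal, projBytes_injBytes, decodeBits_encodeBits_64]
  | ptr b o =>
    simp only [decodeVal, encodeVal, projBytes_injValue_q64, projValue_injValue]
  | _ => exact absurd h (by simp [Val.HasType, Typ.ptr])

/-! ### Injection of values and of memory cells -/

theorem Val.Inject.mono {j j' : MemInj} {v v' : Val} (h : Val.Inject j v v')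
    (hj : ∀ b₁ b₂ δ, j b₁ = some (b₂, δ) → j' b₁ = some (b₂, δ)) : Val.Inject j' v v' := by
  cases h with
  | undef => exact .undef _
  | int => exact .int _
  | long => exact .long _
  | float => exact .float _
  | single => exact .single _
  | ptr b b' o δ h => exact .ptr _ _ _ _ (hj _ _ _ h)

theorem MemVal.Inject.mono {j j' : MemInj} {v v' : MemVal} (h : MemVal.Inject j v v')
    (hj : ∀ b₁ b₂ δ, j b₁ = some (b₂, δ) → j' b₁ = some (b₂, δ)) : MemVal.Inject j' v v' := by
  cases h with
  | undef => exact .undef _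
  | byte => exact .byte _
  | fragment v v' q n h => exact .fragment _ _ _ _ (h.mono hj)

theorem Val.Inject.unique {j : MemInj} {v v₁ v₂ : Val} (h₁ : Val.Inject j v v₁)
    (h₂ : Val.Inject j v v₂) (hv : v ≠ .undef) : v₁ = v₂ := by
  cases h₁ with
  | undef => exact absurd rfl hv
  | ptr b b' o δ h =>
    cases h₂ with
    | ptr b b'' o δ' h' =>
      rw [h] at h'
      cases h'
      rfl
  | _ => cases h₂; rfl

theorem Val.Inject.ne_undef {j : MemInj} {v v' : Val} (h : Val.Inject j v v')
    (hv : v ≠ .undef) : v' ≠ .undef := by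
  cases h <;> simp_all

theorem Val.Inject.ptr_zero {j : MemInj} {b b' : ℕ} (o : Ptrofs) (h : j b = some (b', 0)) :
    Val.Inject j (.ptr b o) (.ptr b' o) := by
  simpa using Val.Inject.ptr b b' o 0 h

/-- A defined value that injects into a pointer is a pointer. -/
theorem Val.Inject.ptr_right {j : MemInj} {v : Val} {b' : ℕ} {o' : Ptrofs}
    (h : Val.Inject j v (.ptr b' o')) (hv : v ≠ .undef) :
    ∃ b o δ, v = .ptr b o ∧ j b = some (b', δ) ∧ o' = o + BitVec.ofInt 64 δ := by
  cases h with
  | undef => exact absurd rfl hv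
  | ptr b _ o δ h => exact ⟨b, o, δ, rfl, h, rfl⟩

theorem Val.Inject.add {j : MemInj} {a a' b b' : Val} (ha : Val.Inject j a a')
    (hb : Val.Inject j b b') : Val.Inject j (a.add b) (a'.add b') := by
  cases ha <;> cases hb <;> simp only [Val.add] <;> constructor

theorem Val.Inject.sub {j : MemInj} {a a' b b' : Val} (ha : Val.Inject j a a')
    (hb : Val.Inject j b b') : Val.Inject j (a.sub b) (a'.sub b') := by
  cases ha <;> cases hb <;> simp only [Val.sub] <;> constructor

theorem Val.Inject.and {j : MemInj} {a a' b b' : Val} (ha : Val.Inject j a a')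
    (hb : Val.Inject j b b') : Val.Inject j (a.and b) (a'.and b') := by
  cases ha <;> cases hb <;> simp only [Val.and] <;> constructor

theorem Val.Inject.ofBool {j : MemInj} (b : Bool) :
    Val.Inject j (Val.ofBool b) (Val.ofBool b) := by
  unfold Val.ofBool; constructor

theorem Val.Inject.cmpEq {j : MemInj} {a a' b b' : Val} (ha : Val.Inject j a a')
    (hb : Val.Inject j b b') : Val.Inject j (a.cmpEq b) (a'.cmpEq b') := by
  cases ha <;> cases hb <;> simp only [Val.cmpEq] <;>
    first | exact .undef _ | exact .ofBool _

theorem Val.Inject.cmpLtu {j : MemInj} {a a' b b' : Val} (ha : Val.Inject j a a')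
    (hb : Val.Inject j b b') : Val.Inject j (a.cmpLtu b) (a'.cmpLtu b') := by
  cases ha <;> cases hb <;> simp only [Val.cmpLtu] <;>
    first | exact .undef _ | exact .ofBool _

theorem Val.Inject.subOverflow {j : MemInj} {a a' b b' : Val} (ha : Val.Inject j a a')
    (hb : Val.Inject j b b') : Val.Inject j (a.subOverflow b) (a'.subOverflow b') := by
  cases ha <;> cases hb <;> simp only [Val.subOverflow] <;>
    first | exact .undef _ | exact .ofBool _

theorem Val.Inject.negative {j : MemInj} {a a' : Val} (ha : Val.Inject j a a') :
    Val.Inject j a.negative a'.negative := by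
  cases ha <;> simp only [Val.negative] <;> first | exact .undef _ | exact .ofBool _

theorem Val.Inject.offsetPtr {j : MemInj} {a a' : Val} (ha : Val.Inject j a a') (n : Ptrofs) :
    Val.Inject j (a.offsetPtr n) (a'.offsetPtr n) := by
  cases ha with
  | ptr b b' o δ h =>
    simp only [Val.offsetPtr]
    rw [add_right_comm]
    exact .ptr _ _ _ _ h
  | _ => exact .undef _

theorem Val.Inject.addl {j : MemInj} {a a' b b' : Val} (ha : Val.Inject j a a')
    (hb : Val.Inject j b b') : Val.Inject j (a.addl b) (a'.addl b') := by
  cases ha <;> cases hb <;> simp only [Val.addl] <;> try constructor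
  all_goals
    rw [add_right_comm]
    exact .ptr _ _ _ _ (by assumption)

theorem forall₂_injBytes (j : MemInj) (l : List Byte) :
    List.Forall₂ (MemVal.Inject j) (injBytes l) (injBytes l) := by
  induction l with
  | nil => exact .nil
  | cons b l ih => exact .cons (.byte b) ih

theorem forall₂_replicate_undef (j : MemInj) {n : ℕ} {l : List MemVal} (h : l.length = n) :
    List.Forall₂ (MemVal.Inject j) (List.replicate n .undef) l := by
  subst h
  induction l with
  | nil => exact .nil
  | cons b l ih => exact .cons (.undef b) ih

theorem forall₂_injValue {j : MemInj} {v v' : Val} (h : Val.Inject j v v') (q : Quantity) :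
    List.Forall₂ (MemVal.Inject j) (injValue q v) (injValue q v') := by
  unfold injValue
  rw [List.forall₂_map_left_iff, List.forall₂_map_right_iff, List.forall₂_same]
  exact fun n _ => .fragment _ _ _ _ h

theorem forall₂_encodeVal {j : MemInj} {v v' : Val} (h : Val.Inject j v v') (c : Chunk) :
    List.Forall₂ (MemVal.Inject j) (encodeVal c v) (encodeVal c v') := by
  by_cases h32 : c = .any32
  · subst h32
    have : ∀ v, encodeVal .any32 v = injValue .q32 v := by intro v; cases v <;> rfl
    rw [this, this]
    exact forall₂_injValue h _
  by_cases h64 : c = .any64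
  · subst h64
    have : ∀ v, encodeVal .any64 v = injValue .q64 v := by intro v; cases v <;> rfl
    rw [this, this]
    exact forall₂_injValue h _
  cases h with
  | undef =>
    have : encodeVal c .undef = List.replicate c.size .undef := by
      cases c <;> simp_all [encodeVal]
    rw [this]
    exact forall₂_replicate_undef j (Mem.length_encodeVal _ _)
  | ptr b b' o δ hj =>
    by_cases hc : c = .int64
    · subst hc
      exact forall₂_injValue (.ptr _ _ _ _ hj) _
    · have : encodeVal c (.ptr b o) = List.replicate c.size .undef := by
        cases c <;> simp_all [encodeVal]
      rw [this]
      exact forall₂_replicate_undef j (Mem.length_encodeVal _ _)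
  | _ =>
    cases c <;> simp only [encodeVal] <;>
      first
      | exact forall₂_injBytes _ _
      | exact forall₂_replicate_undef j (List.length_replicate ..)
      | exact absurd rfl h32
      | exact absurd rfl h64

theorem projBytes_cons_byte (b : Byte) (l : List MemVal) :
    projBytes (.byte b :: l) = (projBytes l).map (b :: ·) := by
  simp only [projBytes, List.mapM_cons]
  cases List.mapM (m := Option) _ l <;> rfl

theorem projBytes_inject {j : MemInj} {l l' : List MemVal} {bl : List Byte}
    (h : List.Forall₂ (MemVal.Inject j) l l') (hl : projBytes l = some bl) :
    projBytes l' = some bl := by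
  induction h generalizing bl with
  | nil => exact hl
  | cons ha _ ih =>
    cases ha with
    | undef => simp [projBytes] at hl
    | fragment => simp [projBytes] at hl
    | byte b =>
      rw [projBytes_cons_byte, Option.map_eq_some_iff] at hl ⊢
      obtain ⟨bl', h1, h2⟩ := hl
      exact ⟨bl', ih h1, h2⟩

theorem projBytes_fragment (v : Val) (q : Quantity) (n : ℕ) (l : List MemVal) :
    projBytes (.fragment v q n :: l) = none := rfl

/-- A defined value is only read from the complete sequence of its fragments. -/
theorem projValue_eq {q : Quantity} {l : List MemVal} {v : Val} (h : projValue q l = v)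
    (hv : v ≠ .undef) : l = injValue q v := by
  unfold projValue at h
  split at h
  · split_ifs at h with h1
    · rwa [← h]
    · exact absurd h.symm hv
  · exact absurd h.symm hv

/-- Since injections are functional on defined values, cells related to all the fragments of one
value are all the fragments of one value. -/
theorem injValue_inject {j : MemInj} {q : Quantity} {v : Val} {l' : List MemVal}
    (h : List.Forall₂ (MemVal.Inject j) (injValue q v) l') (hv : v ≠ .undef) :
    ∃ v', Val.Inject j v v' ∧ l' = injValue q v' := by
  have key : ∀ (ns : List ℕ) (l' : List MemVal) (v' : Val), Val.Inject j v v' →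
      List.Forall₂ (MemVal.Inject j) (ns.map fun n => .fragment v q n) l' →
      l' = ns.map fun n => .fragment v' q n := by
    intro ns
    induction ns with
    | nil => intro l' v' _ hl; cases hl; rfl
    | cons n ns ih =>
      intro l' v' hi hl
      cases hl with
      | cons ha hl =>
        cases ha with
        | fragment _ v'' _ _ hi' =>
          rw [ih _ v' hi hl, hi'.unique hi hv]
          rfl
  obtain ⟨n, l, hl⟩ := injValue_eq_cons q v
  have h0 := h
  rw [hl] at h0
  cases h0 with
  | cons ha _ =>
    cases ha with
    | fragment _ v' _ _ hi => exact ⟨v', hi, key _ _ v' hi h⟩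

/-- The target cells hold fragments only, hence are not read as bytes. -/
theorem projValue_inject {j : MemInj} {q : Quantity} {l l' : List MemVal}
    (h : List.Forall₂ (MemVal.Inject j) l l') (hv : projValue q l ≠ .undef) :
    projBytes l' = none ∧ Val.Inject j (projValue q l) (projValue q l') := by
  have hl := projValue_eq rfl hv
  rw [hl] at h
  obtain ⟨v', hi, rfl⟩ := injValue_inject h hv
  obtain ⟨n, t, ht⟩ := injValue_eq_cons q v'
  refine ⟨by rw [ht]; exact projBytes_fragment _ _ _ _, ?_⟩
  rw [projValue_injValue]
  exact hi

/-- Reading commutes with injections: a defined value can only be read from bytes, which are the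
same on both sides, or from a complete sequence of fragments. -/
theorem decodeVal_inject {j : MemInj} {l l' : List MemVal} (c : Chunk)
    (h : List.Forall₂ (MemVal.Inject j) l l') :
    Val.Inject j (decodeVal c l) (decodeVal c l') := by
  cases hb : projBytes l with
  | some bl =>
    unfold decodeVal
    rw [hb, projBytes_inject h hb]
    cases c <;> constructor
  | none =>
    cases c with
    | int64 =>
      by_cases hv : projValue .q64 l = .undef
      · simp only [decodeVal, hb, hv]; exact .undef _
      · obtain ⟨h1, h2⟩ := projValue_inject h hv
        simp only [decodeVal, hb, h1]
        generalize projValue .q64 l = u at *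
        generalize projValue .q64 l' = u' at *
        cases h2 <;> constructor
        assumption
    | any32 =>
      by_cases hv : projValue .q32 l = .undef
      · simp only [decodeVal, hb, hv]; exact .undef _
      · obtain ⟨h1, h2⟩ := projValue_inject h hv
        simp only [decodeVal, hb, h1]
        generalize projValue .q32 l = u at *
        generalize projValue .q32 l' = u' at *
        cases h2 <;> constructor
    | any64 =>
      by_cases hv : projValue .q64 l = .undef
      · simp only [decodeVal, hb, hv]; exact .undef _
      · obtain ⟨h1, h2⟩ := projValue_inject h hv
        simp only [decodeVal, hb, h1]
        exact h2
    | _ => simp only [decodeVal, hb]; exact .undef _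

/-! ### Evolution of memories and worlds -/

namespace MemAcc

variable {m m' m'' : Mem}

theorem nextblock_le (h : MemAcc m m') : m.nextblock ≤ m'.nextblock := by
  by_contra hlt
  exact lt_irrefl m'.nextblock (h.valid m'.nextblock (not_le.mp hlt))

theorem refl (m : Mem) : MemAcc m m := ⟨fun _ h => h, fun _ _ _ _ h => h, fun _ _ _ _ h => ⟨rfl, h⟩⟩

theorem trans (h : MemAcc m m') (h' : MemAcc m' m'') : MemAcc m m'' where
  valid _ hb := h'.valid _ (h.valid _ hb)
  max_perm _ _ _ hb hp := h.max_perm _ _ _ hb (h'.max_perm _ _ _ (h.valid _ hb) hp)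
  readonly _ _ hb hw hr := by
    obtain ⟨h1, h2⟩ :=
      h'.readonly _ _ (h.valid _ hb) (fun hw' => hw (h.max_perm _ _ _ hb hw')) hr
    obtain ⟨h3, h4⟩ := h.readonly _ _ hb hw h2
    exact ⟨h3.trans h1, h4⟩

theorem store {c : Chunk} {b : ℕ} {o : ℤ} {v : Val} (h : m.store c b o v = some m') :
    MemAcc m m' where
  valid _ hb := (Mem.store_valid h).2 hb
  max_perm _ _ _ _ hp := (Mem.store_perm h).1 hp
  readonly _ _ _ hw hr := by
    refine ⟨(Mem.store_contents_other h ?_).symm, (Mem.store_perm h).1 hr⟩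
    rintro ⟨rfl, h1, h2⟩
    exact hw ((Mem.store_validAccess h).1 _ h1 h2).max

theorem free {b : ℕ} {lo hi : ℤ} (h : m.free b lo hi = some m') : MemAcc m m' where
  valid _ hb := (Mem.free_valid h).2 hb
  max_perm _ _ _ _ hp := ((Mem.free_perm h).1 hp).1
  readonly _ _ _ _ hr := by
    rw [Mem.free_contents h]
    exact ⟨rfl, ((Mem.free_perm h).1 hr).1⟩

theorem alloc (m : Mem) (lo hi : ℤ) : MemAcc m (m.alloc lo hi).1 where
  valid _ hb := Mem.alloc_valid.2 (.inl hb)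
  max_perm _ _ _ hb hp := (Mem.alloc_perm_other (ne_of_lt hb)).1 hp
  readonly _ _ hb _ hr :=
    ⟨(Mem.alloc_contents_other (ne_of_lt hb)).symm, (Mem.alloc_perm_other (ne_of_lt hb)).1 hr⟩

end MemAcc

theorem unchangedOn_refl (m : Mem) (y : ℕ × ℤ) : y ∈ unchangedOn m m :=
  fun _ => ⟨fun _ _ => Iff.rfl, fun _ => rfl⟩

namespace InjpAcc

variable {w w' w'' : InjpWorld}

theorem refl (w : InjpWorld) : InjpAcc w w where
  incr _ _ _ h := h
  unmapped y _ := unchangedOn_refl _ y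
  outOfReach y _ := unchangedOn_refl _ y
  acc₁ := .refl _
  acc₂ := .refl _
  sep b₁ b₂ δ h h' := by rw [h] at h'; cases h'

/-- A mapping of the later world into a block allocated in the earlier one was there before. -/
theorem eq_of_valid₂ (h : InjpAcc w w') {b₁ b₂ : ℕ} {δ : ℤ} (hj : w'.j b₁ = some (b₂, δ))
    (hb : w.m₂.Valid b₂) : w.j b₁ = some (b₂, δ) := by
  cases h0 : w.j b₁ with
  | none => exact absurd hb (h.sep _ _ _ h0 hj).2
  | some x =>
    obtain ⟨b, d⟩ := x
    rw [h.incr _ _ _ h0] at hj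
    rw [hj]

/-- A mapping of the later world from a block allocated in the earlier one was there before. -/
theorem eq_of_valid₁ (h : InjpAcc w w') {b₁ b₂ : ℕ} {δ : ℤ} (hj : w'.j b₁ = some (b₂, δ))
    (hb : w.m₁.Valid b₁) : w.j b₁ = some (b₂, δ) := by
  cases h0 : w.j b₁ with
  | none => exact absurd hb (h.sep _ _ _ h0 hj).1
  | some x =>
    obtain ⟨b, d⟩ := x
    rw [h.incr _ _ _ h0] at hj
    rw [hj]

/-- Accessibility is transitive from worlds whose memories are related: a target cell out of reach
in `w` stays out of reach in `w'`, because permissions of old source blocks do not grow and new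
source blocks are not mapped into old target blocks. -/
theorem trans (hi : Mem.Inject w.j w.m₁ w.m₂) (h : InjpAcc w w') (h' : InjpAcc w' w'') :
    InjpAcc w w'' where
  incr b₁ b₂ δ hj := h'.incr _ _ _ (h.incr _ _ _ hj)
  unmapped y hy hv := by
    refine Mem.unchangedOn_trans (h.unmapped hy) ?_ (h.acc₁.valid _) hv
    apply h'.unmapped
    cases h0 : w'.j y.1 with
    | none => exact h0
    | some x => exact absurd hv (h.sep _ x.1 x.2 hy h0).1
  outOfReach y hy hv := by
    refine Mem.unchangedOn_trans (h.outOfReach hy) ?_ (h.acc₂.valid _) hv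
    apply h'.outOfReach
    intro b₁ δ hj hp
    have hj0 := h.eq_of_valid₂ hj hv
    have hv1 : w.m₁.Valid b₁ := by
      by_contra hn
      rw [hi.freeblocks _ hn] at hj0
      cases hj0
    exact hy b₁ δ hj0 (h.acc₁.max_perm _ _ _ hv1 hp)
  acc₁ := h.acc₁.trans h'.acc₁
  acc₂ := h.acc₂.trans h'.acc₂
  sep b₁ b₂ δ hn hj := by
    cases h0 : w'.j b₁ with
    | none =>
      obtain ⟨h1, h2⟩ := h'.sep _ _ _ h0 hj
      exact ⟨fun hv => h1 (h.acc₁.valid _ hv), fun hv => h2 (h.acc₂.valid _ hv)⟩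
    | some x =>
      have := h'.incr _ x.1 x.2 h0
      rw [hj] at this
      obtain ⟨rfl, rfl⟩ : b₂ = x.1 ∧ δ = x.2 := by
        cases this; exact ⟨rfl, rfl⟩
      exact h.sep _ _ _ hn h0

end InjpAcc

/-- Symbol tables stay related in later worlds, because new mappings relate new blocks only and
the blocks of the global definitions are all allocated. -/
theorem InjpWorld.MatchStbls.acc {w w' : InjpWorld} {se₁ se₂ : SymTbl}
    (h : w.MatchStbls se₁ se₂) (ha : InjpAcc w w') : w'.MatchStbls se₁ se₂ := by
  obtain ⟨hm, h1, h2⟩ := h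
  -- A mapping of the later world is an old one, or is outside the global blocks on both sides.
  have key : ∀ b₁ b₂ δ, w'.j b₁ = some (b₂, δ) → w.j b₁ = some (b₂, δ) ∨
      (se₁.next ≤ b₁ ∧ se₂.next ≤ b₂) := by
    intro b₁ b₂ δ hj
    cases h0 : w.j b₁ with
    | none =>
      obtain ⟨h3, h4⟩ := ha.sep _ _ _ h0 hj
      exact .inr ⟨h1.trans (not_lt.mp h3), h2.trans (not_lt.mp h4)⟩
    | some x =>
      rw [ha.incr _ x.1 x.2 h0] at hj
      exact .inl hj
  refine ⟨⟨?_, ?_, ?_, ?_, ?_⟩, h1.trans ha.acc₁.nextblock_le, h2.trans ha.acc₂.nextblock_le⟩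
  · intro b₁ hb
    obtain ⟨b₂, hj⟩ := hm.dom b₁ hb
    exact ⟨b₂, ha.incr _ _ _ hj⟩
  · intro b₂ hb
    obtain ⟨b₁, hj⟩ := hm.img b₂ hb
    exact ⟨b₁, ha.incr _ _ _ hj⟩
  · intro b₁ b₂ δ hj id
    rcases key _ _ _ hj with h | ⟨h3, h4⟩
    · exact hm.symb _ _ _ h id
    · exact ⟨fun h => absurd (se₁.symb_range _ _ h) (not_lt.mpr h3),
        fun h => absurd (se₂.symb_range _ _ h) (not_lt.mpr h4)⟩
  · intro b₁ b₂ δ hj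
    rcases key _ _ _ hj with h | ⟨h3, h4⟩
    · exact hm.info _ _ _ h
    · have e1 : se₁.info b₁ = none := by
        by_contra hne
        obtain ⟨g, hg⟩ := Option.ne_none_iff_exists'.mp hne
        exact absurd (se₁.info_range _ _ hg) (not_lt.mpr h3)
      have e2 : se₂.info b₂ = none := by
        by_contra hne
        obtain ⟨g, hg⟩ := Option.ne_none_iff_exists'.mp hne
        exact absurd (se₂.info_range _ _ hg) (not_lt.mpr h4)
      rw [e1, e2]
  · intro b₁ b₂ δ hj
    rcases key _ _ _ hj with h | ⟨h3, h4⟩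
    · exact hm.separated _ _ _ h
    · exact ⟨fun h => absurd h (not_lt.mpr h3), fun h => absurd h (not_lt.mpr h4)⟩

/-- The block of a symbol is mapped to the block of the same symbol, without a shift. -/
theorem MatchStbls.symb_mapped {j : MemInj} {se₁ se₂ : SymTbl} (h : MatchStbls j se₁ se₂)
    {id b₁ : ℕ} (hs : se₁.symb id = some b₁) :
    ∃ b₂, j b₁ = some (b₂, 0) ∧ se₂.symb id = some b₂ := by
  obtain ⟨b₂, hj⟩ := h.dom b₁ (se₁.symb_range _ _ hs)
  exact ⟨b₂, hj, (h.symb _ _ _ hj id).1 hs⟩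

/-- Only the block of a symbol is mapped to the block of the same symbol. -/
theorem MatchStbls.symb_preimage {j : MemInj} {se₁ se₂ : SymTbl} (h : MatchStbls j se₁ se₂)
    {id b₁ b₂ : ℕ} {δ : ℤ} (hj : j b₁ = some (b₂, δ)) (hs : se₂.symb id = some b₂) :
    se₁.symb id = some b₁ ∧ δ = 0 := by
  refine ⟨(h.symb _ _ _ hj id).2 hs, ?_⟩
  obtain ⟨b, hb⟩ := h.dom b₁ ((h.separated _ _ _ hj).2 (se₂.symb_range _ _ hs))
  rw [hj] at hb
  cases hb
  rfl

theorem MatchStbls.address_inject {j : MemInj} {se₁ se₂ : SymTbl} (h : MatchStbls j se₁ se₂)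
    (id : ℕ) (o : Ptrofs) : Val.Inject j (se₁.address id o) (se₂.address id o) := by
  unfold SymTbl.address
  cases hs : se₁.symb id with
  | none => exact .undef _
  | some b =>
    obtain ⟨b₂, hj, hs₂⟩ := h.symb_mapped hs
    rw [hs₂]
    exact .ptr_zero o hj

theorem ValidFor.of_matchStbls {sk : Skel} {j : MemInj} {se₁ se₂ : SymTbl}
    (hv : ValidFor sk se₁) (h : MatchStbls j se₁ se₂) : ValidFor sk se₂ := by
  intro id g hg
  obtain ⟨b, hs, hi⟩ := hv id g hg
  obtain ⟨b₂, hj, hs₂⟩ := h.symb_mapped hs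
  exact ⟨b₂, hs₂, by rw [← h.info _ _ _ hj, hi]⟩

/-! ### Memory operations and injections -/

theorem toNat_add_ofInt {o : Ptrofs} {δ : ℤ} (h0 : 0 ≤ δ) (h1 : (o.toNat : ℤ) + δ < 2 ^ 64) :
    ((o + BitVec.ofInt 64 δ).toNat : ℤ) = o.toNat + δ := by
  rw [BitVec.toNat_add, BitVec.toNat_ofInt]
  omega

namespace Mem.Inject

variable {j : MemInj} {m₁ m₂ m₁' : Mem} {b₁ b₂ : ℕ} {δ : ℤ} {c : Chunk} {o : ℤ} {v v' : Val}

theorem validAccess (h : Mem.Inject j m₁ m₂) (hj : j b₁ = some (b₂, δ)) {p : Permission}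
    (ha : m₁.ValidAccess c b₁ o p) : m₂.ValidAccess c b₂ (o + δ) p := by
  refine ⟨fun x h1 h2 => ?_, ?_⟩
  · have := h.perm b₁ b₂ δ (x - δ) _ _ hj (ha.1 (x - δ) (by omega) (by omega))
    rwa [sub_add_cancel] at this
  · exact dvd_add ha.2 (h.align b₁ b₂ δ c o p hj fun x h1 h2 => (ha.1 x h1 h2).max)

theorem load (h : Mem.Inject j m₁ m₂) (hj : j b₁ = some (b₂, δ))
    (hl : m₁.load c b₁ o = some v) :
    ∃ v', m₂.load c b₂ (o + δ) = some v' ∧ Val.Inject j v v' := by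
  rw [load_eq_some] at hl
  obtain ⟨ha, hd⟩ := hl
  refine ⟨_, load_eq_some.2 ⟨h.validAccess hj ha, rfl⟩, ?_⟩
  rw [← hd]
  apply decodeVal_inject
  rw [getN_eq_map, getN_eq_map, List.forall₂_map_left_iff, List.forall₂_map_right_iff,
    List.forall₂_same]
  intro n hn
  rw [List.mem_range] at hn
  have := h.memval b₁ b₂ δ (o + n) hj (ha.1 _ (by omega) (by omega))
  rwa [add_right_comm] at this

/-- Where the source may be accessed, the shift of a pointer does not wrap around. -/
theorem ptr_toNat (h : Mem.Inject j m₁ m₂) (hj : j b₁ = some (b₂, δ)) {u : Ptrofs}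
    (hp : m₁.Perm b₁ u.toNat .max .nonempty) :
    ((u + BitVec.ofInt 64 δ).toNat : ℤ) = u.toNat + δ := by
  obtain ⟨h0, h1⟩ := h.representable b₁ b₂ δ u hj (.inl hp)
  exact toNat_add_ofInt h0 h1

theorem loadv (h : Mem.Inject j m₁ m₂) {a a' : Val} (ha : Val.Inject j a a')
    (hl : m₁.loadv c a = some v) : ∃ v', m₂.loadv c a' = some v' ∧ Val.Inject j v v' := by
  cases ha with
  | ptr b b' u δ hj =>
    simp only [Mem.loadv] at hl ⊢
    rw [h.ptr_toNat hj (load_eq_some.1 hl).1.nonempty]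
    exact h.load hj hl
  | _ => cases hl

/-- Storing related values at corresponding addresses preserves the injection. -/
theorem store (h : Mem.Inject j m₁ m₂) (hj : j b₁ = some (b₂, δ)) (hv : Val.Inject j v v')
    (hs : m₁.store c b₁ o v = some m₁') :
    ∃ m₂', m₂.store c b₂ (o + δ) v' = some m₂' ∧ Mem.Inject j m₁' m₂' ∧
      InjpAcc ⟨j, m₁, m₂⟩ ⟨j, m₁', m₂'⟩ := by
  have ha := store_validAccess hs
  obtain ⟨m₂', hs'⟩ := exists_store (h.validAccess hj ha) v'
  refine ⟨m₂', hs', ⟨?_, ?_, ?_, ?_, ?_, ?_, ?_, ?_⟩, ⟨?_, ?_, ?_, .store hs, .store hs', ?_⟩⟩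
  · intro b b' d x k p hb hp
    rw [store_perm hs']
    exact h.perm _ _ _ _ _ _ hb ((store_perm hs).1 hp)
  · intro b b' d c' x p hb hp
    exact h.align b b' d c' x p hb fun y h1 h2 => (store_perm hs).1 (hp y h1 h2)
  · intro b b' d x hb hp
    have hp0 := (store_perm hs).1 hp
    by_cases hx : b = b₁ ∧ o ≤ x ∧ x < o + c.size
    · obtain ⟨rfl, h1, h2⟩ := hx
      rw [hj] at hb
      cases hb
      obtain ⟨n, rfl⟩ : ∃ n : ℕ, x = o + n := ⟨(x - o).toNat, by omega⟩
      have hn : n < c.size := by omega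
      rw [add_right_comm, store_contents_same hs (by rwa [length_encodeVal]),
        store_contents_same hs' (by rwa [length_encodeVal])]
      exact (forall₂_encodeVal hv c).get _ _
    · rw [store_contents_other hs hx, store_contents_other hs']
      · exact h.memval _ _ _ _ hb hp0
      -- No other source cell is mapped to a stored target cell.
      · rintro ⟨rfl, h1, h2⟩
        by_cases hbb : b = b₁
        · subst hbb
          rw [hj] at hb
          cases hb
          exact hx ⟨rfl, by omega, by omega⟩
        · rcases h.no_overlap _ _ _ x _ _ _ (x + d - δ) hbb hb hj hp0.nonempty
            (ha.1 _ (by omega) (by omega)).nonempty with h3 | h3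
          · exact h3 rfl
          · exact h3 (by omega)
  · intro b hb
    exact h.freeblocks _ fun hn => hb ((store_valid hs).2 hn)
  · intro b b' d hb
    exact (store_valid hs').2 (h.mappedblocks _ _ _ hb)
  · intro b b' d x c1 c2 d' x' hne h1 h2 hp1 hp2
    exact h.no_overlap _ _ _ _ _ _ _ _ hne h1 h2 ((store_perm hs).1 hp1)
      ((store_perm hs).1 hp2)
  · intro b b' d u hb hp
    exact h.representable b b' d u hb (hp.imp (store_perm hs).1 (store_perm hs).1)
  · intro b b' d x k p hb hp
    rw [store_perm hs, store_perm hs]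
    exact h.perm_inv _ _ _ _ _ _ hb ((store_perm hs').1 hp)
  · exact fun _ _ _ h => h
  · rintro ⟨b, x⟩ hy
    apply store_unchanged hs
    rintro ⟨rfl, _⟩
    have hy : j b = none := hy
    rw [hj] at hy
    cases hy
  · rintro ⟨b, x⟩ hy
    apply store_unchanged hs'
    rintro ⟨rfl, h1, h2⟩
    exact hy b₁ δ hj (ha.1 _ (by simp only; omega) (by simp only; omega)).nonempty
  · intro b b' d h1 h2
    simp only at h1 h2
    rw [h1] at h2
    cases h2

theorem storev (h : Mem.Inject j m₁ m₂) {a a' : Val} (ha : Val.Inject j a a')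
    (hv : Val.Inject j v v') (hs : m₁.storev c a v = some m₁') :
    ∃ m₂', m₂.storev c a' v' = some m₂' ∧ Mem.Inject j m₁' m₂' ∧
      InjpAcc ⟨j, m₁, m₂⟩ ⟨j, m₁', m₂'⟩ := by
  cases ha with
  | ptr b b' u δ hj =>
    simp only [Mem.storev] at hs ⊢
    rw [h.ptr_toNat hj (store_validAccess hs).nonempty]
    exact h.store hj hv hs
  | _ => cases hs

/-- Freeing corresponding cells preserves the injection. -/
theorem free (h : Mem.Inject j m₁ m₂) (hj : j b₁ = some (b₂, δ)) {lo hi : ℤ}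
    (hs : m₁.free b₁ lo hi = some m₁') :
    ∃ m₂', m₂.free b₂ (lo + δ) (hi + δ) = some m₂' ∧ Mem.Inject j m₁' m₂' ∧
      InjpAcc ⟨j, m₁, m₂⟩ ⟨j, m₁', m₂'⟩ := by
  have ha := free_rangePerm hs
  obtain ⟨m₂', hs'⟩ : ∃ m₂', m₂.free b₂ (lo + δ) (hi + δ) = some m₂' := by
    apply exists_free
    intro x h1 h2
    have := h.perm b₁ b₂ δ (x - δ) _ _ hj (ha (x - δ) (by omega) (by omega))
    rwa [sub_add_cancel] at this
  have hsub : ∀ {b x k p}, m₁'.Perm b x k p → m₁.Perm b x k p :=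
    fun hp => ((free_perm hs).1 hp).1
  refine ⟨m₂', hs', ⟨?_, ?_, ?_, ?_, ?_, ?_, ?_, ?_⟩, ⟨?_, ?_, ?_, .free hs, .free hs', ?_⟩⟩
  · intro b b' d x k p hb hp
    rw [free_perm hs']
    rw [free_perm hs] at hp
    refine ⟨h.perm _ _ _ _ _ _ hb hp.1, ?_⟩
    rintro ⟨rfl, h1, h2⟩
    by_cases hbb : b = b₁
    · subst hbb
      rw [hj] at hb
      cases hb
      exact hp.2 ⟨rfl, by omega, by omega⟩
    · rcases h.no_overlap _ _ _ x _ _ _ (x + d - δ) hbb hb hj hp.1.nonempty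
        (ha _ (by omega) (by omega)).nonempty with h3 | h3
      · exact h3 rfl
      · exact h3 (by omega)
  · intro b b' d c' x p hb hp
    exact h.align b b' d c' x p hb fun y h1 h2 => hsub (hp y h1 h2)
  · intro b b' d x hb hp
    rw [free_contents hs, free_contents hs']
    exact h.memval _ _ _ _ hb (hsub hp)
  · intro b hb
    exact h.freeblocks _ fun hn => hb ((free_valid hs).2 hn)
  · intro b b' d hb
    exact (free_valid hs').2 (h.mappedblocks _ _ _ hb)
  · intro b b' d x c1 c2 d' x' hne h1 h2 hp1 hp2
    exact h.no_overlap _ _ _ _ _ _ _ _ hne h1 h2 (hsub hp1) (hsub hp2)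
  · intro b b' d u hb hp
    exact h.representable b b' d u hb (hp.imp hsub hsub)
  · intro b b' d x k p hb hp
    rw [free_perm hs'] at hp
    rcases h.perm_inv _ _ _ _ _ _ hb hp.1 with h1 | h1
    · left
      rw [free_perm hs]
      refine ⟨h1, ?_⟩
      rintro ⟨rfl, h2, h3⟩
      rw [hj] at hb
      cases hb
      exact hp.2 ⟨rfl, by omega, by omega⟩
    · exact .inr fun h2 => h1 (hsub h2)
  · exact fun _ _ _ h => h
  · rintro ⟨b, x⟩ hy
    apply free_unchanged hs
    rintro ⟨rfl, _⟩
    have hy : j b = none := hy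
    rw [hj] at hy
    cases hy
  · rintro ⟨b, x⟩ hy
    apply free_unchanged hs'
    rintro ⟨rfl, h1, h2⟩
    exact hy b₁ δ hj (ha _ (by simp only; omega) (by simp only; omega)).nonempty
  · intro b b' d h1 h2
    simp only at h1 h2
    rw [h1] at h2
    cases h2

/-- Allocating blocks of the same size on both sides extends the injection by the new blocks. -/
theorem alloc (h : Mem.Inject j m₁ m₂) (lo hi : ℤ) :
    ∃ j', j' m₁.nextblock = some (m₂.nextblock, 0) ∧
      Mem.Inject j' (m₁.alloc lo hi).1 (m₂.alloc lo hi).1 ∧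
      InjpAcc ⟨j, m₁, m₂⟩ ⟨j', (m₁.alloc lo hi).1, (m₂.alloc lo hi).1⟩ := by
  -- The new source block is mapped to the new target block.
  set j' : MemInj := Function.update j m₁.nextblock (some (m₂.nextblock, 0)) with hj'
  have hnew : j' m₁.nextblock = some (m₂.nextblock, 0) := by simp [hj']
  have hold : ∀ b, b ≠ m₁.nextblock → j' b = j b := fun b hb => by simp [hj', hb]
  have hnone : j m₁.nextblock = none := h.freeblocks _ (lt_irrefl _)
  have hne₁ : ∀ b b' d, j b = some (b', d) → b ≠ m₁.nextblock := by
    rintro b b' d hb rfl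
    rw [hnone] at hb
    cases hb
  have hne₂ : ∀ b b' d, j b = some (b', d) → b' ≠ m₂.nextblock :=
    fun b b' d hb => ne_of_lt (h.mappedblocks _ _ _ hb)
  have hincr : ∀ b b' d, j b = some (b', d) → j' b = some (b', d) :=
    fun b b' d hb => by rw [hold _ (hne₁ _ _ _ hb), hb]
  have hcases : ∀ b b' d, j' b = some (b', d) →
      (b = m₁.nextblock ∧ b' = m₂.nextblock ∧ d = 0) ∨
      (j b = some (b', d) ∧ b ≠ m₁.nextblock ∧ b' ≠ m₂.nextblock) := by
    intro b b' d hb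
    by_cases hbb : b = m₁.nextblock
    · subst hbb
      rw [hnew] at hb
      cases hb
      exact .inl ⟨rfl, rfl, rfl⟩
    · rw [hold _ hbb] at hb
      exact .inr ⟨hb, hbb, hne₂ _ _ _ hb⟩
  refine ⟨j', hnew, ⟨?_, ?_, ?_, ?_, ?_, ?_, ?_, ?_⟩,
    ⟨hincr, fun _ _ => alloc_unchanged, fun _ _ => alloc_unchanged, .alloc .., .alloc .., ?_⟩⟩
  · intro b b' d x k p hb hp
    rcases hcases _ _ _ hb with ⟨rfl, rfl, rfl⟩ | ⟨hb, h1, h2⟩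
    · rw [alloc_perm_new] at hp ⊢
      omega
    · rw [alloc_perm_other h1] at hp
      rw [alloc_perm_other h2]
      exact h.perm _ _ _ _ _ _ hb hp
  · intro b b' d c' x p hb hp
    rcases hcases _ _ _ hb with ⟨rfl, rfl, rfl⟩ | ⟨hb, h1, h2⟩
    · exact dvd_zero _
    · exact h.align b b' d c' x p hb fun y h3 h4 => (alloc_perm_other h1).1 (hp y h3 h4)
  · intro b b' d x hb hp
    rcases hcases _ _ _ hb with ⟨rfl, rfl, rfl⟩ | ⟨hb, h1, h2⟩
    · rw [alloc_contents_new]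
      exact .undef _
    · rw [alloc_contents_other h1, alloc_contents_other h2]
      exact (h.memval _ _ _ _ hb ((alloc_perm_other h1).1 hp)).mono hincr
  · intro b hb
    rw [alloc_valid, not_or] at hb
    rw [hold _ hb.2]
    exact h.freeblocks _ hb.1
  · intro b b' d hb
    rw [alloc_valid]
    rcases hcases _ _ _ hb with ⟨rfl, rfl, rfl⟩ | ⟨hb, h1, h2⟩
    · exact .inr rfl
    · exact .inl (h.mappedblocks _ _ _ hb)
  · intro b b' d x c1 c2 d' x' hne hb1 hb2 hp1 hp2
    rcases hcases _ _ _ hb1 with ⟨rfl, rfl, rfl⟩ | ⟨hb1, h1, h2⟩ <;>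
      rcases hcases _ _ _ hb2 with ⟨rfl, rfl, rfl⟩ | ⟨hb2, h3, h4⟩
    · exact absurd rfl hne
    · exact .inl (Ne.symm h4)
    · exact .inl h2
    · exact h.no_overlap _ _ _ _ _ _ _ _ hne hb1 hb2 ((alloc_perm_other h1).1 hp1)
        ((alloc_perm_other h3).1 hp2)
  · intro b b' d u hb hp
    rcases hcases _ _ _ hb with ⟨rfl, rfl, rfl⟩ | ⟨hb, h1, h2⟩
    · have := u.isLt
      omega
    · exact h.representable b b' d u hb (hp.imp (alloc_perm_other h1).1 (alloc_perm_other h1).1)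
  · intro b b' d x k p hb hp
    rcases hcases _ _ _ hb with ⟨rfl, rfl, rfl⟩ | ⟨hb, h1, h2⟩
    · rw [alloc_perm_new] at hp
      left
      rw [alloc_perm_new]
      omega
    · rw [alloc_perm_other h2] at hp
      rw [alloc_perm_other h1, alloc_perm_other h1]
      exact h.perm_inv _ _ _ _ _ _ hb hp
  · intro b b' d hb hb'
    rcases hcases _ _ _ hb' with ⟨rfl, rfl, rfl⟩ | ⟨hb', _, _⟩
    · exact ⟨lt_irrefl _, lt_irrefl _⟩
    · simp only at hb
      rw [hb] at hb'
      cases hb'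

end Mem.Inject

/-! ### Assembly code is invariant under memory injections -/

/-- Registers whose contents are related pointwise by `j`. -/
def RegsInject (j : MemInj) (rs₁ rs₂ : Regset) : Prop := ∀ r, Val.Inject j (rs₁ r) (rs₂ r)

namespace RegsInject

variable {j j' : MemInj} {rs₁ rs₂ : Regset} {v₁ v₂ : Val}

theorem mono (h : RegsInject j rs₁ rs₂)
    (hj : ∀ b₁ b₂ δ, j b₁ = some (b₂, δ) → j' b₁ = some (b₂, δ)) : RegsInject j' rs₁ rs₂ :=
  fun r => (h r).mono hj

theorem set (h : RegsInject j rs₁ rs₂) (r : PReg) (hv : Val.Inject j v₁ v₂) :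
    RegsInject j (rs₁.set r v₁) (rs₂.set r v₂) := by
  intro r'
  by_cases hr : r' = r
  · subst hr
    simpa [Regset.set] using hv
  · simpa [Regset.set, hr] using h r'

theorem next (h : RegsInject j rs₁ rs₂) : RegsInject j rs₁.next rs₂.next :=
  h.set _ ((h _).offsetPtr _)

theorem nextNF (h : RegsInject j rs₁ rs₂) : RegsInject j rs₁.nextNF rs₂.nextNF := by
  apply RegsInject.next
  intro r
  cases r with
  | CR => exact .undef _
  | _ => exact h _

theorem compareInts (h : RegsInject j rs₁ rs₂) {x x' y y' : Val} (hx : Val.Inject j x x')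
    (hy : Val.Inject j y y') : RegsInject j (compareInts x y rs₁) (compareInts x' y' rs₂) :=
  ((((h.set _ (hx.cmpEq hy)).set _ (hx.cmpLtu hy)).set _ (hx.sub hy).negative).set _
    (hx.subOverflow hy)).set _ (.undef _)

theorem gotoLabel (h : RegsInject j rs₁ rs₂) {f : AsmFun} {l : ℕ} {rs₁' : Regset}
    (hg : gotoLabel f l rs₁ = some rs₁') (hpc : ∀ b o, rs₁ .PC = .ptr b o → ∃ b', j b = some (b', 0)) :
    ∃ rs₂', MutSum.gotoLabel f l rs₂ = some rs₂' ∧ RegsInject j rs₁' rs₂' := by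
  unfold MutSum.gotoLabel at hg ⊢
  cases hl : labelPos l f.code 0 with
  | none => simp [hl] at hg
  | some pos =>
    have hp := h .PC
    cases h1 : rs₁ .PC with
    | ptr b o =>
      obtain ⟨b', hb⟩ := hpc b o h1
      rw [h1] at hp
      generalize hx : rs₂ .PC = x at hp ⊢
      cases hp with
      | ptr _ b'' _ δ hj =>
        rw [hb] at hj
        cases hj
        simp only [hl, h1, Option.some.injEq] at hg ⊢
        exact ⟨_, rfl, hg ▸ h.set _ (.ptr_zero _ hb)⟩
    | _ => simp [hl, h1] at hg

theorem evalAddr32 {se₁ se₂ : SymTbl} (h : RegsInject j rs₁ rs₂) (hs : MatchStbls j se₁ se₂)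
    (a : AddrMode) : Val.Inject j (evalAddr32 se₁ a rs₁) (evalAddr32 se₂ a rs₂) := by
  obtain ⟨base, index, const⟩ := a
  refine .add ?_ (.add ?_ ?_)
  · cases base with
    | none => exact .int _
    | some r => exact h _
  · cases index with
    | none => exact .int _
    | some r => exact h _
  · cases const with
    | inl n => exact .int _
    | inr x => exact hs.address_inject _ _

theorem evalAddr64 {se₁ se₂ : SymTbl} (h : RegsInject j rs₁ rs₂) (hs : MatchStbls j se₁ se₂)
    (a : AddrMode) : Val.Inject j (evalAddr64 se₁ a rs₁) (evalAddr64 se₂ a rs₂) := by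
  obtain ⟨base, index, const⟩ := a
  refine .addl ?_ (.addl ?_ ?_)
  · cases base with
    | none => exact .long _
    | some r => exact h _
  · cases index with
    | none => exact .long _
    | some r => exact h _
  · cases const with
    | inl n => exact .long _
    | inr x => exact hs.address_inject _ _

end RegsInject

/-- Whether a stack pointer belongs to the current activation is preserved by injections that
evolve from the injection of the incoming query, because these relate old blocks to old blocks and
new blocks to new blocks. -/
theorem innerSP_inject {w : InjpWorld} {j : MemInj} {m₁ m₂ : Mem} {v v' : Val} {live : Bool}
    (hw : Mem.Inject w.j w.m₁ w.m₂) (ha : InjpAcc w ⟨j, m₁, m₂⟩) (hv : Val.Inject j v v')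
    (h : innerSP w.m₁.nextblock v = some live) : innerSP w.m₂.nextblock v' = some live := by
  cases hv with
  | ptr b b' o δ hj =>
    rw [← h]
    simp only [innerSP, Option.some.injEq, decide_eq_decide]
    by_cases hb : w.m₁.Valid b
    · have := hw.mappedblocks _ _ _ (ha.eq_of_valid₁ hj hb)
      exact iff_of_false (not_le.mpr this) (not_le.mpr hb)
    · have := (ha.sep _ _ _ (hw.freeblocks _ hb) hj).2
      exact iff_of_true (not_lt.mp this) (not_lt.mp hb)
  | _ => simp [innerSP] at h

/-- One instruction, executed in related configurations, leads to related configurations. Jumps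
keep the offset of the code block, so this block must be mapped without a shift. -/
theorem execInstr_inject {w : InjpWorld} {se₁ se₂ : SymTbl} {j : MemInj} {m₁ m₂ m₁' : Mem}
    {rs₁ rs₂ rs₁' : Regset} {f : AsmFun} {i : Instr} {live : Bool}
    (hw : Mem.Inject w.j w.m₁ w.m₂) (ha : InjpAcc w ⟨j, m₁, m₂⟩) (hs : MatchStbls j se₁ se₂)
    (hm : Mem.Inject j m₁ m₂) (hr : RegsInject j rs₁ rs₂)
    (hpc : ∀ b o, rs₁ .PC = .ptr b o → ∃ b', j b = some (b', 0))
    (he : execInstr se₁ w.m₁.nextblock f i rs₁ m₁ = some (rs₁', m₁', live)) :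
    ∃ j' rs₂' m₂', execInstr se₂ w.m₂.nextblock f i rs₂ m₂ = some (rs₂', m₂', live) ∧
      InjpAcc ⟨j, m₁, m₂⟩ ⟨j', m₁', m₂'⟩ ∧ Mem.Inject j' m₁' m₂' ∧ RegsInject j' rs₁' rs₂' := by
  cases i with
  | allocframe sz ofsRA ofsLink =>
    obtain ⟨j', hj', hm', ha'⟩ := hm.alloc 0 sz
    have hr' := hr.mono ha'.incr
    have hsp : Val.Inject j' (.ptr m₁.nextblock 0) (.ptr m₂.nextblock 0) := .ptr_zero 0 hj'
    simp only [execInstr, Option.bind_eq_some_iff, Option.map_eq_some_iff, Prod.mk.injEq] at he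
    obtain ⟨n₁, h1, n₁', h2, rfl, rfl, rfl⟩ := he
    obtain ⟨n₂, h3, hn, hna⟩ := hm'.storev (hsp.offsetPtr ofsLink) (hr' .SP) h1
    obtain ⟨n₂', h4, hn', hna'⟩ := hn.storev (hsp.offsetPtr ofsRA) (hr' .RA) h2
    refine ⟨j', _, n₂', ?_, ha'.trans hm (hna.trans hm' hna'), hn',
      ((hr'.set (.IR .RAX) (hr' .SP)).set .SP hsp).next⟩
    simp only [execInstr, Option.bind_eq_some_iff, Option.map_eq_some_iff, Prod.mk.injEq]
    exact ⟨n₂, h3, n₂', h4, rfl, rfl, trivial⟩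
  | freeframe sz ofsRA ofsLink =>
    simp only [execInstr, Option.bind_eq_some_iff] at he
    obtain ⟨ra, h1, sp, h2, he⟩ := he
    obtain ⟨ra', h3, hra⟩ := hm.loadv ((hr .SP).offsetPtr ofsRA) h1
    obtain ⟨sp', h4, hsp⟩ := hm.loadv ((hr .SP).offsetPtr ofsLink) h2
    simp only [execInstr, Option.bind_eq_some_iff]
    have hsp0 := hr .SP
    have hrs := ((hr.set .SP hsp).set .RA hra).next
    generalize rs₁ .SP = v at *
    generalize hv' : rs₂ .SP = v' at *
    cases hsp0 with
    | ptr b b' o δ hj =>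
      simp only [Option.map_eq_some_iff, Prod.mk.injEq] at he
      obtain ⟨n₁, h5, rfl, rfl, rfl⟩ := he
      suffices h : ∃ n₂, m₂.free b' ↑(o + BitVec.ofInt 64 δ).toNat
            (↑(o + BitVec.ofInt 64 δ).toNat + sz) = some n₂ ∧ Mem.Inject j n₁ n₂ ∧
            InjpAcc ⟨j, m₁, m₂⟩ ⟨j, n₁, n₂⟩ by
        obtain ⟨n₂, h6, hn, hna⟩ := h
        exact ⟨j, _, n₂, ⟨ra', h3, sp', h4, by simp only [h6, Option.map_some]⟩, hna, hn, hrs⟩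
      -- An empty frame has no cell that bounds the shifted offset, but freeing it has no effect.
      by_cases hsz : sz = 0
      · subst hsz
        simp only [Nat.cast_zero, add_zero, Mem.free_empty, Option.some.injEq] at h5 ⊢
        subst h5
        exact ⟨m₂, rfl, hm, .refl _⟩
      · rw [hm.ptr_toNat hj (Mem.free_rangePerm h5 _ le_rfl (by omega)).nonempty,
          add_right_comm]
        exact hm.free hj h5
    | _ => simp at he
  | mov_rr rd r =>
    simp only [execInstr, Option.some.injEq, Prod.mk.injEq] at he ⊢
    obtain ⟨rfl, rfl, rfl⟩ := he
    exact ⟨j, _, _, ⟨rfl, rfl, rfl⟩, .refl _, hm, (hr.set _ (hr _)).next⟩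
  | movl_rm rd a =>
    simp only [execInstr, Option.map_eq_some_iff, Prod.mk.injEq] at he ⊢
    obtain ⟨v, h1, rfl, rfl, rfl⟩ := he
    obtain ⟨v', h2, hv⟩ := hm.loadv (hr.evalAddr64 hs a) h1
    exact ⟨j, _, _, ⟨v', h2, rfl, rfl, rfl⟩, .refl _, hm, (hr.set _ hv).nextNF⟩
  | movl_mr a r =>
    simp only [execInstr, Option.map_eq_some_iff, Prod.mk.injEq] at he ⊢
    obtain ⟨n, h1, rfl, rfl, rfl⟩ := he
    obtain ⟨n', h2, hn, hna⟩ := hm.storev (hr.evalAddr64 hs a) (hr (.IR r)) h1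
    exact ⟨j, _, _, ⟨n', h2, rfl, rfl, rfl⟩, hna, hn, hr.nextNF⟩
  | mov_rm_a rd a =>
    simp only [execInstr, Option.map_eq_some_iff, Prod.mk.injEq] at he ⊢
    obtain ⟨v, h1, rfl, rfl, rfl⟩ := he
    obtain ⟨v', h2, hv⟩ := hm.loadv (hr.evalAddr64 hs a) h1
    exact ⟨j, _, _, ⟨v', h2, rfl, rfl, rfl⟩, .refl _, hm, (hr.set _ hv).nextNF⟩
  | mov_mr_a a r =>
    simp only [execInstr, Option.map_eq_some_iff, Prod.mk.injEq] at he ⊢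
    obtain ⟨n, h1, rfl, rfl, rfl⟩ := he
    obtain ⟨n', h2, hn, hna⟩ := hm.storev (hr.evalAddr64 hs a) (hr (.IR r)) h1
    exact ⟨j, _, _, ⟨n', h2, rfl, rfl, rfl⟩, hna, hn, hr.nextNF⟩
  | testl_rr r₁ r₂ =>
    simp only [execInstr, Option.some.injEq, Prod.mk.injEq] at he ⊢
    obtain ⟨rfl, rfl, rfl⟩ := he
    exact ⟨j, _, _, ⟨rfl, rfl, rfl⟩, .refl _, hm,
      (hr.compareInts ((hr _).and (hr _)) (.int 0)).next⟩
  | cmpl_rr r₁ r₂ =>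
    simp only [execInstr, Option.some.injEq, Prod.mk.injEq] at he ⊢
    obtain ⟨rfl, rfl, rfl⟩ := he
    exact ⟨j, _, _, ⟨rfl, rfl, rfl⟩, .refl _, hm, (hr.compareInts (hr _) (hr _)).next⟩
  | xorl_r rd =>
    simp only [execInstr, Option.some.injEq, Prod.mk.injEq] at he ⊢
    obtain ⟨rfl, rfl, rfl⟩ := he
    exact ⟨j, _, _, ⟨rfl, rfl, rfl⟩, .refl _, hm, (hr.set _ (.int 0)).nextNF⟩
  | leal rd a =>
    simp only [execInstr, Option.some.injEq, Prod.mk.injEq] at he ⊢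
    obtain ⟨rfl, rfl, rfl⟩ := he
    exact ⟨j, _, _, ⟨rfl, rfl, rfl⟩, .refl _, hm, (hr.set _ (hr.evalAddr32 hs a)).next⟩
  | jmp_l l =>
    simp only [execInstr, Option.map_eq_some_iff, Prod.mk.injEq] at he ⊢
    obtain ⟨rs, h1, rfl, rfl, rfl⟩ := he
    obtain ⟨rs', h2, hrs⟩ := hr.gotoLabel h1 hpc
    exact ⟨j, _, _, ⟨rs', h2, rfl, rfl, rfl⟩, .refl _, hm, hrs⟩
  | jcc c l =>
    have hc : ∀ t, c.eval rs₁ = some t → c.eval rs₂ = some t := by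
      intro t ht
      have hz := hr (.CR .ZF)
      unfold TestCond.eval at ht ⊢
      generalize rs₁ (.CR .ZF) = z at *
      generalize rs₂ (.CR .ZF) = z' at *
      cases hz <;> first | exact ht | (cases c <;> simp at ht)
    simp only [execInstr] at he ⊢
    cases ht : c.eval rs₁ with
    | none => simp [ht] at he
    | some t =>
      rw [hc t ht]
      rw [ht] at he
      cases t with
      | true =>
        simp only [Option.map_eq_some_iff, Prod.mk.injEq] at he ⊢
        obtain ⟨rs, h1, rfl, rfl, rfl⟩ := he
        obtain ⟨rs', h2, hrs⟩ := hr.gotoLabel h1 hpc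
        exact ⟨j, _, _, ⟨rs', h2, rfl, rfl, rfl⟩, .refl _, hm, hrs⟩
      | false =>
        simp only [Option.some.injEq, Prod.mk.injEq] at he ⊢
        obtain ⟨rfl, rfl, rfl⟩ := he
        exact ⟨j, _, _, ⟨rfl, rfl, rfl⟩, .refl _, hm, hr.next⟩
  | call_s id =>
    simp only [execInstr, Option.some.injEq, Prod.mk.injEq] at he ⊢
    obtain ⟨rfl, rfl, rfl⟩ := he
    exact ⟨j, _, _, ⟨rfl, rfl, rfl⟩, .refl _, hm,
      (hr.set _ ((hr _).offsetPtr 1)).set _ (hs.address_inject _ _)⟩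
  | ret =>
    simp only [execInstr, Option.map_eq_some_iff, Prod.mk.injEq] at he ⊢
    obtain ⟨l, h1, rfl, rfl, rfl⟩ := he
    exact ⟨j, _, _, ⟨l, innerSP_inject hw ha (hr _) h1, rfl, rfl, rfl⟩, .refl _, hm,
      hr.set _ (hr _)⟩
  | label l =>
    simp only [execInstr, Option.some.injEq, Prod.mk.injEq] at he ⊢
    obtain ⟨rfl, rfl, rfl⟩ := he
    exact ⟨j, _, _, ⟨rfl, rfl, rfl⟩, .refl _, hm, hr.next⟩

/-- Configurations of an activation that are related in some world reached from the world of the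
incoming query. -/
structure AsmInject (w : InjpWorld) (s₁ s₂ : AsmState) : Prop where
  start : Mem.Inject w.j w.m₁ w.m₂
  nb₁ : s₁.nb = w.m₁.nextblock
  nb₂ : s₂.nb = w.m₂.nextblock
  live : s₁.live = s₂.live
  world : ∃ j', InjpAcc w ⟨j', s₁.mem, s₂.mem⟩ ∧ Mem.Inject j' s₁.mem s₂.mem ∧
    RegsInject j' s₁.rs s₂.rs

/-- Related definitions of a program are at corresponding addresses. -/
theorem MatchStbls.defAt {j : MemInj} {se₁ se₂ : SymTbl} (h : MatchStbls j se₁ se₂)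
    {p : AsmProg} {b : ℕ} {d : AsmDef} (hd : p.DefAt se₁ b d) :
    ∃ b', j b = some (b', 0) ∧ p.DefAt se₂ b' d := by
  obtain ⟨id, h1, h2⟩ := hd
  obtain ⟨b', hj, hs⟩ := h.symb_mapped h1
  exact ⟨b', hj, id, hs, h2⟩

theorem Val.Inject.ptr_left {j : MemInj} {b b' : ℕ} {o : Ptrofs} {v : Val}
    (h : Val.Inject j (.ptr b o) v) (hj : j b = some (b', 0)) : v = .ptr b' o :=
  h.unique (.ptr_zero o hj) (by simp)

/-- Two related code pointers are both or neither the address of a given definition. -/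
theorem MatchStbls.defAt_pc {j : MemInj} {se₁ se₂ : SymTbl} (h : MatchStbls j se₁ se₂)
    {p : AsmProg} {v v' : Val} (hv : Val.Inject j v v') (hu : v ≠ .undef) {d : AsmDef} :
    (∃ b, v = .ptr b 0 ∧ p.DefAt se₁ b d) ↔ ∃ b, v' = .ptr b 0 ∧ p.DefAt se₂ b d := by
  constructor
  · rintro ⟨b, rfl, hd⟩
    obtain ⟨b', hj, hd'⟩ := h.defAt hd
    exact ⟨b', hv.ptr_left hj, hd'⟩
  · rintro ⟨b', rfl, id, h1, h2⟩
    obtain ⟨b, o, δ, rfl, hj, ho⟩ := hv.ptr_right hu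
    obtain ⟨h3, rfl⟩ := h.symb_preimage hj h1
    refine ⟨b, ?_, id, h3, h2⟩
    simp only [BitVec.ofInt_ofNat, BitVec.add_zero, BitVec.ofNat_eq_ofNat] at ho
    rw [← ho]
    rfl

/-- Every assembly module simulates itself under memory injections. -/
theorem asmSem_self_sim (p : AsmProg) (se₁ se₂ : SymTbl) :
    IsOpenSim ccAsmInjp ccAsmInjp (asmSem p) (asmSem p) se₁ se₂ AsmInject where
  valid_query := by
    rintro w q₁ q₂ hs ⟨_, _, _, hr, hpc⟩
    have h : ∀ f, _ ↔ _ := fun f => hs.1.defAt_pc (p := p) (hr .PC) hpc (d := .internal f)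
    simp only [asmSem]
    constructor
    · rintro ⟨b, f, hb⟩
      obtain ⟨b', hb'⟩ := (h f).1 ⟨b, hb⟩
      exact ⟨b', f, hb'⟩
    · rintro ⟨b, f, hb⟩
      obtain ⟨b', hb'⟩ := (h f).2 ⟨b, hb⟩
      exact ⟨b', f, hb'⟩
  initial := by
    rintro w q₁ q₂ s₁ hs ⟨h1, h2, hm, hr, hpc⟩ ⟨⟨b, f, hb⟩, hsp, hra, rfl⟩
    obtain ⟨b', hb'⟩ := (hs.1.defAt_pc (p := p) (hr .PC) hpc).1 ⟨b, hb⟩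
    refine ⟨⟨q₂.mem.nextblock, q₂.rs, q₂.mem, true⟩, ⟨hm, ?_, ?_, rfl, w.j, ?_, ?_, hr⟩,
      ⟨b', f, hb'⟩, (hr _).ne_undef hsp, (hr _).ne_undef hra, rfl⟩
    · rw [h1]
    · rw [h2]
    · rw [h1, h2]
      exact .refl w
    · rw [h1, h2]
      exact hm
  internal := by
    rintro w s₁ ⟨nb₂, rs₂, m₂, live₂⟩ t s₁' hs ⟨hw, hn₁, hn₂, hl, j, ha, hm, hr⟩ hstep
    cases hstep with
    | exec nb rs m b o f i rs' m' live hpc hf hi he =>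
      simp only at hn₁ hn₂ hl ha hm hr
      subst hn₁ hn₂ hl
      have hs' := (hs.acc ha).1
      obtain ⟨b', hj, hf'⟩ := hs'.defAt hf
      have hpc' : rs₂ .PC = .ptr b' o := by
        have := hr .PC
        rw [hpc] at this
        exact this.ptr_left hj
      obtain ⟨j', rs₂', m₂', he', ha', hm', hr'⟩ := execInstr_inject hw ha hs' hm hr
        (fun b₀ o₀ h₀ => by rw [hpc] at h₀; cases h₀; exact ⟨b', hj⟩) he
      exact ⟨⟨_, rs₂', m₂', live⟩, ⟨hw, rfl, rfl, rfl, j', ha.trans hw ha', hm', hr'⟩,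
        .step _ [] _ [] _ (.exec _ _ _ b' o f i _ _ _ hpc' hf' hi he') (.refl _)⟩
  external := by
    rintro w s₁ s₂ q₁ hs ⟨hw, hn₁, hn₂, hl, j, ha, hm, hr⟩ ⟨hlive, rfl, b, sg, hpc, hd⟩
    have hs' := hs.acc ha
    have hu : s₁.rs .PC ≠ .undef := by rw [hpc]; simp
    have hd' := (hs'.1.defAt_pc (hr .PC) hu).1 ⟨b, hpc, hd⟩
    obtain ⟨b', hd'⟩ := hd'
    refine ⟨⟨j, s₁.mem, s₂.mem⟩, ⟨s₂.rs, s₂.mem⟩, hs', ⟨rfl, rfl, hm, hr, hu⟩,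
      ⟨hl ▸ hlive, rfl, b', sg, hd'⟩, ?_⟩
    rintro ⟨rs₁', m₁'⟩ ⟨rs₂', m₂'⟩ s₁' ⟨j', ha', hm', hr'⟩ ⟨_, _, _, live, hin, rfl⟩
    have ha'' := ha.trans hw ha'
    refine ⟨⟨s₂.nb, rs₂', m₂', live⟩, ⟨hw, hn₁, hn₂, rfl, j', ha'', hm', hr'⟩,
      hl ▸ hlive, ⟨b', sg, hd'⟩, ha'.acc₂.nextblock_le, live, ?_, rfl⟩
    rw [hn₂]
    rw [hn₁] at hin
    exact innerSP_inject hw ha'' (hr' _) hin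
  final := by
    rintro w s₁ s₂ r₁ hs ⟨hw, hn₁, hn₂, hl, j, ha, hm, hr⟩ ⟨hlive, rfl⟩
    exact ⟨⟨s₂.rs, s₂.mem⟩, ⟨j, ha, hm, hr⟩, hl ▸ hlive, rfl⟩

/-! ### Composition of simulations -/

section Comp

variable {A₁ A₂ A₃ B₁ B₂ B₃ : LangInterface} {RA : SimConv A₁ A₂} {RB : SimConv B₁ B₂}
  {SA : SimConv A₂ A₃} {SB : SimConv B₂ B₃} {L₁ : OpenLTS A₁ B₁} {L₂ : OpenLTS A₂ B₂}
  {L₃ : OpenLTS A₃ B₃}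

theorem OpenLTS.Star.trans {A B : LangInterface} {L : OpenLTS A B} {se : SymTbl}
    {s s' s'' : L.State} {t t' : List Event} (h : L.Star se s t s') (h' : L.Star se s' t' s'') :
    L.Star se s (t ++ t') s'' := by
  induction h with
  | refl => exact h'
  | step s t₁ s₁ t₂ s₂ hs _ ih =>
    rw [List.append_assoc]
    exact .step _ _ _ _ _ hs (ih h')

theorem IsOpenSim.star {se₁ se₂ : SymTbl} {R : RB.World → L₁.State → L₂.State → Prop}
    (h : IsOpenSim RA RB L₁ L₂ se₁ se₂ R) {w : RB.World} (hw : RB.senv w se₁ se₂)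
    {s₁ s₁' : L₁.State} {s₂ : L₂.State} {t : List Event} (hr : R w s₁ s₂)
    (hs : L₁.Star se₁ s₁ t s₁') : ∃ s₂', R w s₁' s₂' ∧ L₂.Star se₂ s₂ t s₂' := by
  induction hs generalizing s₂ with
  | refl s => exact ⟨s₂, hr, .refl _⟩
  | step s t s' t' s'' hst _ ih =>
    obtain ⟨u, hu, hu'⟩ := h.internal w _ _ _ _ hw hr hst
    obtain ⟨u', hv, hv'⟩ := ih hu
    exact ⟨u', hv, hu'.trans hv'⟩

/-- Open simulations compose. As the symbol table of the module in the middle depends on the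
world, the invariants of the two simulations are part of the invariant of their composition. -/
theorem OpenSim.comp (h₁ : OpenSim RA RB L₁ L₂) (h₂ : OpenSim SA SB L₂ L₃)
    (hv : ∀ w se₁ se₂, RB.senv w se₁ se₂ → ValidFor L₁.skel se₁ → ValidFor L₁.skel se₂) :
    OpenSim (RA.comp SA) (RB.comp SB) L₁ L₃ := by
  refine ⟨h₁.1.trans h₂.1, fun se₁ se₃ hval => ?_⟩
  have hmid : ∀ (w : RB.World) se₂, RB.senv w se₁ se₂ →
      (∃ R, IsOpenSim RA RB L₁ L₂ se₁ se₂ R) ∧ ∃ R, IsOpenSim SA SB L₂ L₃ se₂ se₃ R :=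
    fun w se₂ hw => ⟨h₁.2 _ _ hval, h₂.2 _ _ (h₁.1 ▸ hv w _ _ hw hval)⟩
  refine ⟨fun w s₁ s₃ => ∃ se₂ R S s₂, RB.senv w.1 se₁ se₂ ∧ SB.senv w.2 se₂ se₃ ∧
    IsOpenSim RA RB L₁ L₂ se₁ se₂ R ∧ IsOpenSim SA SB L₂ L₃ se₂ se₃ S ∧
    R w.1 s₁ s₂ ∧ S w.2 s₂ s₃, ?_, ?_, ?_, ?_, ?_⟩
  · rintro ⟨w, w'⟩ q₁ q₃ ⟨se₂, hw, hw'⟩ ⟨q₂, hq, hq'⟩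
    obtain ⟨⟨R, hR⟩, ⟨S, hS⟩⟩ := hmid w se₂ hw
    exact (hR.valid_query w _ _ hw hq).trans (hS.valid_query w' _ _ hw' hq')
  · rintro ⟨w, w'⟩ q₁ q₃ s₁ ⟨se₂, hw, hw'⟩ ⟨q₂, hq, hq'⟩ hI
    obtain ⟨⟨R, hR⟩, ⟨S, hS⟩⟩ := hmid w se₂ hw
    obtain ⟨s₂, hr, hI₂⟩ := hR.initial w _ _ _ hw hq hI
    obtain ⟨s₃, hs, hI₃⟩ := hS.initial w' _ _ _ hw' hq' hI₂
    exact ⟨s₃, ⟨se₂, R, S, s₂, hw, hw', hR, hS, hr, hs⟩, hI₃⟩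
  · rintro ⟨w, w'⟩ s₁ s₃ t s₁' - ⟨se₂, R, S, s₂, hw, hw', hR, hS, hr, hs⟩ hstep
    obtain ⟨s₂', hr', hst⟩ := hR.internal w _ _ _ _ hw hr hstep
    obtain ⟨s₃', hs', hst'⟩ := hS.star hw' hs hst
    exact ⟨s₃', ⟨se₂, R, S, s₂', hw, hw', hR, hS, hr', hs'⟩, hst'⟩
  · rintro ⟨w, w'⟩ s₁ s₃ q₁ - ⟨se₂, R, S, s₂, hw, hw', hR, hS, hr, hs⟩ hX
    obtain ⟨wA, q₂, hwA, hq, hX₂, hY⟩ := hR.external w _ _ _ hw hr hX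
    obtain ⟨wA', q₃, hwA', hq', hX₃, hY'⟩ := hS.external w' _ _ _ hw' hs hX₂
    refine ⟨(wA, wA'), q₃, ⟨se₂, hwA, hwA'⟩, ⟨q₂, hq, hq'⟩, hX₃, ?_⟩
    rintro r₁ r₃ s₁' ⟨r₂, hr₁, hr₂⟩ hy
    obtain ⟨s₂', hr', hy₂⟩ := hY _ _ _ hr₁ hy
    obtain ⟨s₃', hs', hy₃⟩ := hY' _ _ _ hr₂ hy₂
    exact ⟨s₃', ⟨se₂, R, S, s₂', hw, hw', hR, hS, hr', hs'⟩, hy₃⟩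
  · rintro ⟨w, w'⟩ s₁ s₃ r₁ - ⟨se₂, R, S, s₂, hw, hw', hR, hS, hr, hs⟩ hF
    obtain ⟨r₂, hr₂, hF₂⟩ := hR.final w _ _ _ hw hr hF
    obtain ⟨r₃, hr₃, hF₃⟩ := hS.final w' _ _ _ hw' hs hF₂
    exact ⟨r₃, ⟨r₂, hr₂, hr₃⟩, hF₃⟩

end Comp

/-! ### The specification preserves constants, monotonicity and types -/

/-- The memory of a state of the specification. -/
def StateA.mem : StateA → Mem
  | .callg _ m | .callf _ _ m | .returnf _ _ m | .returng _ m => m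

/-- Whether the state precedes the return from `f`, so that its memory is that of the incoming
query. `returng` is excluded although it may be reached without a call. -/
def StateA.BeforeCall : StateA → Prop
  | .callg _ _ | .callf _ _ _ => True
  | _ => False

/-- Up to the call of `f` the memory is that of the incoming query, where constants have their
initial values; later it only has to be a monotone evolution of that memory. -/
theorem specA_ro_sim (se₁ se₂ : SymTbl) :
    IsOpenSim ccRO ccRO specA specA se₁ se₂ fun w s₁ s₂ =>
      s₁ = s₂ ∧ ROValid w.1 w.2 ∧ MemAcc w.2 (StateA.mem s₁) ∧
        (StateA.BeforeCall s₁ → StateA.mem s₁ = w.2) where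
  valid_query := by
    rintro ⟨se, m⟩ q _ ⟨rfl, rfl⟩ ⟨rfl, _⟩
    rfl
  initial := by
    rintro ⟨se, m⟩ q _ s ⟨rfl, rfl⟩ ⟨rfl, rfl, hro⟩ hI
    refine ⟨s, ⟨rfl, hro, ?_⟩, hI⟩
    cases hI
    exact ⟨.refl _, fun _ => rfl⟩
  internal := by
    rintro ⟨se, m⟩ s _ t s' ⟨rfl, rfl⟩ ⟨rfl, hro, hacc, heq⟩ hstep
    refine ⟨s', ⟨rfl, hro, ?_⟩, by simpa using OpenLTS.Star.step s t s' [] s' hstep (.refl _)⟩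
    cases hstep with
    | zero => exact ⟨hacc, False.elim⟩
    | cached => exact ⟨hacc, False.elim⟩
    | call => exact ⟨hacc, fun _ => heq trivial⟩
    | sum i r m m' m'' b hs h0 h1 => exact ⟨hacc.trans ((MemAcc.store h0).trans (.store h1)),
        False.elim⟩
  external := by
    rintro ⟨se, m⟩ s _ q ⟨rfl, rfl⟩ ⟨rfl, hro, hacc, heq⟩ hX
    refine ⟨(se, m), q, ⟨rfl, rfl⟩, ⟨rfl, ?_, hro⟩, hX, ?_⟩
    · cases hX
      exact heq trivial
    · rintro r _ s' ⟨rfl, hr⟩ hY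
      refine ⟨s', ⟨rfl, hro, ?_⟩, hY⟩
      cases hY
      exact ⟨hr, False.elim⟩
  final := by
    rintro ⟨se, m⟩ s _ r ⟨rfl, rfl⟩ ⟨rfl, hro, hacc, heq⟩ hF
    refine ⟨r, ⟨rfl, ?_⟩, hF⟩
    cases hF
    exact hacc

/-- The only signature involved is that of `f` and `g`. -/
theorem specA_wt_sim (se₁ se₂ : SymTbl) :
    IsOpenSim ccWT ccWT specA specA se₁ se₂ fun w s₁ s₂ => s₁ = s₂ ∧ w = sgIntInt where
  valid_query := by
    rintro w q _ rfl ⟨rfl, _⟩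
    rfl
  initial := by
    rintro w q _ s rfl ⟨rfl, rfl, _⟩ hI
    refine ⟨s, ⟨rfl, ?_⟩, hI⟩
    cases hI
    rfl
  internal := by
    rintro w s _ t s' rfl ⟨rfl, rfl⟩ hstep
    exact ⟨s', ⟨rfl, rfl⟩, by simpa using OpenLTS.Star.step s t s' [] s' hstep (.refl _)⟩
  external := by
    rintro w s _ q rfl ⟨rfl, rfl⟩ hX
    refine ⟨sgIntInt, q, rfl, ⟨rfl, ?_⟩, hX, ?_⟩
    · cases hX
      exact ⟨rfl, .cons trivial .nil⟩
    · rintro r _ s' ⟨rfl, _⟩ hY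
      exact ⟨s', ⟨rfl, rfl⟩, hY⟩
  final := by
    rintro w s _ r rfl ⟨rfl, rfl⟩ hF
    refine ⟨r, ⟨rfl, ?_⟩, hF⟩
    cases hF
    trivial

/-! ### Memories that differ in the stack frame only -/

/-- The memories `m` and `m'` have the same blocks, permissions and contents outside block `bs`. -/
structure EqOff (bs : ℕ) (m m' : Mem) : Prop where
  valid : ∀ b, b ≠ bs → (m'.Valid b ↔ m.Valid b)
  perm : ∀ b x k p, b ≠ bs → (m'.Perm b x k p ↔ m.Perm b x k p)
  contents : ∀ b x, b ≠ bs → m'.contents b x = m.contents b x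

namespace EqOff

variable {bs : ℕ} {m m' m'' : Mem}

theorem trans (h : EqOff bs m m') (h' : EqOff bs m' m'') : EqOff bs m m'' where
  valid b hb := (h'.valid b hb).trans (h.valid b hb)
  perm b x k p hb := (h'.perm b x k p hb).trans (h.perm b x k p hb)
  contents b x hb := (h'.contents b x hb).trans (h.contents b x hb)

theorem store {c : Chunk} {o : ℤ} {v : Val} (h : m.store c bs o v = some m') : EqOff bs m m' where
  valid _ _ := Mem.store_valid h
  perm _ _ _ _ _ := Mem.store_perm h
  contents _ _ hb := Mem.store_contents_other h fun hx => hb hx.1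

theorem free {lo hi : ℤ} (h : m.free bs lo hi = some m') : EqOff bs m m' where
  valid _ _ := Mem.free_valid h
  perm _ _ _ _ hb := by rw [Mem.free_perm h]; tauto
  contents _ _ _ := by rw [Mem.free_contents h]

theorem alloc (m : Mem) (lo hi : ℤ) : EqOff m.nextblock m (m.alloc lo hi).1 where
  valid _ hb := by rw [Mem.alloc_valid]; tauto
  perm _ _ _ _ hb := Mem.alloc_perm_other hb
  contents _ _ hb := Mem.alloc_contents_other hb

theorem unchanged (h : EqOff bs m m') {b : ℕ} {x : ℤ} (hb : b ≠ bs) :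
    (b, x) ∈ unchangedOn m m' :=
  fun _ => ⟨fun _ _ => (h.perm _ _ _ _ hb).symm, fun _ => h.contents _ _ hb⟩

/-- Target blocks that no source block is mapped to do not matter for a memory injection. -/
theorem inject {j : MemInj} {m₁ : Mem} (h : EqOff bs m m') (hi : Mem.Inject j m₁ m)
    (hb : ∀ b δ, j b ≠ some (bs, δ)) : Mem.Inject j m₁ m' := by
  have hne : ∀ b₁ b₂ δ, j b₁ = some (b₂, δ) → b₂ ≠ bs := by
    rintro b₁ _ δ hj rfl
    exact hb _ _ hj
  refine ⟨?_, hi.align, ?_, hi.freeblocks, ?_, hi.no_overlap, hi.representable, ?_⟩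
  · intro b₁ b₂ δ o k p hj hp
    exact (h.perm _ _ _ _ (hne _ _ _ hj)).2 (hi.perm _ _ _ _ _ _ hj hp)
  · intro b₁ b₂ δ o hj hp
    rw [h.contents _ _ (hne _ _ _ hj)]
    exact hi.memval _ _ _ _ hj hp
  · intro b₁ b₂ δ hj
    exact (h.valid _ (hne _ _ _ hj)).2 (hi.mappedblocks _ _ _ hj)
  · intro b₁ b₂ δ o k p hj hp
    exact hi.perm_inv _ _ _ _ _ _ hj ((h.perm _ _ _ _ (hne _ _ _ hj)).1 hp)

/-- Target blocks allocated since a world do not matter for the evolution of that world. -/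
theorem injpAcc {w : InjpWorld} {j : MemInj} {m₁ : Mem} (h : EqOff bs m m')
    (ha : InjpAcc w ⟨j, m₁, m⟩) (hb : ¬ w.m₂.Valid bs) : InjpAcc w ⟨j, m₁, m'⟩ := by
  have hne : ∀ b, w.m₂.Valid b → b ≠ bs := by
    rintro _ hv rfl
    exact hb hv
  refine ⟨ha.incr, ha.unmapped, ?_, ha.acc₁, ⟨?_, ?_, ?_⟩, ha.sep⟩
  · rintro ⟨b, x⟩ hx hv
    exact Mem.unchangedOn_trans (ha.outOfReach hx) (h.unchanged (hne b hv)) (ha.acc₂.valid b) hv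
  · intro b hv
    exact (h.valid b (hne b hv)).2 (ha.acc₂.valid b hv)
  · intro b o p hv hp
    exact ha.acc₂.max_perm b o p hv ((h.perm _ _ _ _ (hne b hv)).1 hp)
  · intro b o hv hw hr
    obtain ⟨h1, h2⟩ := ha.acc₂.readonly b o hv hw ((h.perm _ _ _ _ (hne b hv)).1 hr)
    exact ⟨h1.trans (h.contents b o (hne b hv)).symm, h2⟩

end EqOff

/-- Block `bs` of `m` is a stack frame of `g` with the given saved values. -/
structure HasFrame (m : Mem) (bs : ℕ) (vsp vrbx vra : Val) : Prop where
  freeable : m.RangePerm bs 0 24 .cur .freeable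
  saved_sp : m.load .int64 bs 0 = some vsp
  saved_rbx : m.load .any64 bs 8 = some vrbx
  saved_ra : m.load .int64 bs 16 = some vra

theorem HasFrame.unchanged {m m' : Mem} {bs : ℕ} {vsp vrbx vra : Val}
    (h : HasFrame m bs vsp vrbx vra)
    (hu : ∀ o : ℤ, 0 ≤ o → o < 24 → (bs, o) ∈ unchangedOn m m') :
    HasFrame m' bs vsp vrbx vra where
  freeable x h1 h2 :=
    ((hu x h1 h2 (h.freeable x h1 h2).valid).1 _ _).1 (h.freeable x h1 h2)
  saved_sp := Mem.load_unchanged h.saved_sp fun x h1 h2 => by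
    simp only [Chunk.size, Nat.cast_ofNat] at h2; exact hu x (by omega) (by omega)
  saved_rbx := Mem.load_unchanged h.saved_rbx fun x h1 h2 => by
    simp only [Chunk.size, Nat.cast_ofNat] at h2; exact hu x (by omega) (by omega)
  saved_ra := Mem.load_unchanged h.saved_ra fun x h1 h2 => by
    simp only [Chunk.size, Nat.cast_ofNat] at h2; exact hu x (by omega) (by omega)

/-- The stores of the prologue of `g` succeed and build a stack frame. -/
theorem exists_frame (m : Mem) {vsp vra : Val} (vrbx : Val) (hsp : vsp.HasType .ptr)
    (hsp' : vsp ≠ .undef) (hra : vra.HasType .ptr) (hra' : vra ≠ .undef) :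
    ∃ n₁ n₂ n₃, (m.alloc 0 24).1.store .int64 m.nextblock 0 vsp = some n₁ ∧
      n₁.store .int64 m.nextblock 16 vra = some n₂ ∧
      n₂.store .any64 m.nextblock 8 vrbx = some n₃ ∧
      EqOff m.nextblock m n₃ ∧ HasFrame n₃ m.nextblock vsp vrbx vra := by
  have hp : (m.alloc 0 24).1.RangePerm m.nextblock 0 24 .cur .freeable :=
    fun x h1 h2 => Mem.alloc_perm_new.2 ⟨h1, h2⟩
  obtain ⟨n₁, h1⟩ := Mem.exists_store (m := (m.alloc 0 24).1) (c := .int64) (b := m.nextblock)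
    (o := 0) ⟨fun x h1 h2 => (hp x (by omega) (by simp only [Chunk.size] at h2; omega)).mono
      (by decide), by decide⟩ vsp
  have hp₁ : n₁.RangePerm m.nextblock 0 24 .cur .freeable :=
    fun x h2 h3 => (Mem.store_perm h1).2 (hp x h2 h3)
  obtain ⟨n₂, h2⟩ := Mem.exists_store (m := n₁) (c := .int64) (b := m.nextblock)
    (o := 16) ⟨fun x h1 h2 => (hp₁ x (by omega) (by simp only [Chunk.size] at h2; omega)).mono
      (by decide), by decide⟩ vra
  have hp₂ : n₂.RangePerm m.nextblock 0 24 .cur .freeable :=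
    fun x h3 h4 => (Mem.store_perm h2).2 (hp₁ x h3 h4)
  obtain ⟨n₃, h3⟩ := Mem.exists_store (m := n₂) (c := .any64) (b := m.nextblock)
    (o := 8) ⟨fun x h1 h2 => (hp₂ x (by omega) (by simp only [Chunk.size] at h2; omega)).mono
      (by decide), by decide⟩ vrbx
  refine ⟨n₁, n₂, n₃, h1, h2, h3, (((EqOff.alloc m 0 24).trans (.store h1)).trans
    (.store h2)).trans (.store h3), ?_, ?_, ?_, ?_⟩
  · exact fun x h4 h5 => (Mem.store_perm h3).2 (hp₂ x h4 h5)
  · refine Mem.load_unchanged (m := n₂) (Mem.load_unchanged (m := n₁) (Mem.load_store_same h1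
      (decode_encode_int64 hsp hsp')) ?_) ?_
    · intro x _ hx
      refine Mem.store_unchanged h2 ?_
      simp only [Chunk.size] at hx ⊢
      omega
    · intro x _ hx
      refine Mem.store_unchanged h3 ?_
      simp only [Chunk.size] at hx ⊢
      omega
  · exact Mem.load_store_same h3 (decode_encode_any64 _)
  · refine Mem.load_unchanged (m := n₂) (Mem.load_store_same h2 (decode_encode_int64 hra hra')) ?_
    intro x hx _
    refine Mem.store_unchanged h3 ?_
    simp only [Chunk.size]
    omega

/-! ### Execution of the code of `g` -/

namespace Regset

variable (rs : Regset) (r r' : PReg) (v : Val)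

@[simp] theorem set_same : rs.set r v r = v := by simp [Regset.set]

@[simp] theorem set_other (h : r' ≠ r) : rs.set r v r' = rs r' := by simp [Regset.set, h]

@[simp] theorem next_pc : rs.next .PC = (rs .PC).offsetPtr 1 := by simp [Regset.next]

@[simp] theorem next_other (h : r ≠ .PC) : rs.next r = rs r := by simp [Regset.next, h]

@[simp] theorem nextNF_pc : rs.nextNF .PC = (rs .PC).offsetPtr 1 := by simp [Regset.nextNF]

@[simp] theorem nextNF_ir (r : IReg) : rs.nextNF (.IR r) = rs (.IR r) := by simp [Regset.nextNF]

end Regset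

@[simp] theorem compareInts_zf (x y : Val) (rs : Regset) :
    compareInts x y rs (.CR .ZF) = x.cmpEq y := by
  simp [compareInts]

@[simp] theorem compareInts_pc (x y : Val) (rs : Regset) : compareInts x y rs .PC = rs .PC := by
  simp [compareInts]

@[simp] theorem compareInts_ir (x y : Val) (rs : Regset) (r : IReg) :
    compareInts x y rs (.IR r) = rs (.IR r) := by
  simp [compareInts]

/-- The function `g`. -/
def funG : AsmFun := ⟨sgIntInt, codeG⟩

/-- The stack pointer and the callee-save registers other than `RBX` are the same. -/
def KeepsRegs (rs rs' : Regset) : Prop :=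
  rs' .SP = rs .SP ∧ ∀ r ∈ calleeSave, r ≠ .IR .RBX → rs' r = rs r

section Code

variable {se : SymTbl} {nb bg bs : ℕ} {rs rs' : Regset} {m m' : Mem} {live : Bool}

/-- Execution of the `k`-th instruction of `g`. -/
theorem codeG_step {k : ℕ} {i : Instr} {s : AsmState} {t : List Event}
    (hg : se.symb idG = some bg) (hpc : rs .PC = .ptr bg (BitVec.ofNat 64 k))
    (hi : codeG[(BitVec.ofNat 64 k).toNat]? = some i)
    (he : execInstr se nb funG i rs m = some (rs', m', live))
    (h : (asmSem progA).Star se ⟨nb, rs', m', live⟩ t s) :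
    (asmSem progA).Star se ⟨nb, rs, m, true⟩ t s :=
  .step _ [] _ _ _ (.exec _ _ _ bg _ funG i _ _ _ hpc ⟨idG, hg, rfl⟩ hi he) h


/-- The two stores are those of the stack pointer and of the return address. -/
theorem exec_allocframe {f : AsmFun} {sz : ℕ} {u u' : Ptrofs} {n₁ n₂ : Mem}
    (h1 : (m.alloc 0 sz).1.store .int64 m.nextblock u'.toNat (rs .SP) = some n₁)
    (h2 : n₁.store .int64 m.nextblock u.toNat (rs .RA) = some n₂) :
    execInstr se nb f (.allocframe sz u u') rs m =
      some (((rs.set (.IR .RAX) (rs .SP)).set .SP (.ptr m.nextblock 0)).next, n₂, true) := by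
  have hb : (m.alloc 0 sz).2 = m.nextblock := rfl
  simp only [execInstr, hb, Val.offsetPtr, Mem.storev, BitVec.ofNat_eq_ofNat, BitVec.zero_add,
    h1, h2, Option.bind_some, Option.map_some]

theorem exec_freeframe {f : AsmFun} {sz : ℕ} {u u' : Ptrofs} {ra sp : Val}
    (hsp : rs .SP = .ptr bs 0)
    (h1 : m.load .int64 bs u.toNat = some ra) (h2 : m.load .int64 bs u'.toNat = some sp)
    (h3 : m.free bs 0 sz = some m') :
    execInstr se nb f (.freeframe sz u u') rs m =
      some (((rs.set .SP sp).set .RA ra).next, m', true) := by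
  simp only [execInstr, hsp, Val.offsetPtr, Mem.loadv, BitVec.ofNat_eq_ofNat, BitVec.zero_add,
    h1, h2, Option.bind_some]
  simp [h3]

theorem exec_movl_rm {f : AsmFun} {rd : IReg} {a : AddrMode} {v : Val}
    (h : m.loadv .int32 (evalAddr64 se a rs) = some v) :
    execInstr se nb f (.movl_rm rd a) rs m = some ((rs.set (.IR rd) v).nextNF, m, true) := by
  simp only [execInstr, h, Option.map_some]

theorem exec_movl_mr {f : AsmFun} {r : IReg} {a : AddrMode}
    (h : m.storev .int32 (evalAddr64 se a rs) (rs (.IR r)) = some m') :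
    execInstr se nb f (.movl_mr a r) rs m = some (rs.nextNF, m', true) := by
  simp only [execInstr, h, Option.map_some]

theorem exec_mov_rm_a {f : AsmFun} {rd : IReg} {a : AddrMode} {v : Val}
    (h : m.loadv .any64 (evalAddr64 se a rs) = some v) :
    execInstr se nb f (.mov_rm_a rd a) rs m = some ((rs.set (.IR rd) v).nextNF, m, true) := by
  simp only [execInstr, h, Option.map_some]

theorem exec_mov_mr_a {f : AsmFun} {r : IReg} {a : AddrMode}
    (h : m.storev .any64 (evalAddr64 se a rs) (rs (.IR r)) = some m') :
    execInstr se nb f (.mov_mr_a a r) rs m = some (rs.nextNF, m', true) := by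
  simp only [execInstr, h, Option.map_some]

/-- The position after a label is found by computation on the code of `g`. -/
theorem gotoLabel_funG {l k : ℕ} {o : Ptrofs} (hl : labelPos l codeG 0 = some k)
    (hpc : rs .PC = .ptr bg o) :
    gotoLabel funG l rs = some (rs.set .PC (.ptr bg (BitVec.ofNat 64 k))) := by
  have : labelPos l funG.code 0 = some k := hl
  simp only [gotoLabel, this, hpc]

theorem exec_jmp {l k : ℕ} {o : Ptrofs} (hl : labelPos l codeG 0 = some k)
    (hpc : rs .PC = .ptr bg o) :
    execInstr se nb funG (.jmp_l l) rs m =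
      some (rs.set .PC (.ptr bg (BitVec.ofNat 64 k)), m, true) := by
  simp only [execInstr, gotoLabel_funG hl hpc, Option.map_some]

theorem exec_jcc_taken {c : TestCond} {l k : ℕ} {o : Ptrofs} (hc : c.eval rs = some true)
    (hl : labelPos l codeG 0 = some k) (hpc : rs .PC = .ptr bg o) :
    execInstr se nb funG (.jcc c l) rs m =
      some (rs.set .PC (.ptr bg (BitVec.ofNat 64 k)), m, true) := by
  simp only [execInstr, hc, gotoLabel_funG hl hpc, Option.map_some]

theorem exec_jcc_not_taken {c : TestCond} {l : ℕ} (hc : c.eval rs = some false) :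
    execInstr se nb funG (.jcc c l) rs m = some (rs.next, m, true) := by
  simp only [execInstr, hc]

theorem exec_ret {f : AsmFun} (h : innerSP nb (rs .SP) = some live) :
    execInstr se nb f .ret rs m = some (rs.set .PC (rs .RA), m, live) := by
  simp only [execInstr, h, Option.map_some]

theorem evalAddr64_atReg_eight (hsp : rs .SP = .ptr bs 0) :
    evalAddr64 se (atReg 8 .RSP) rs = .ptr bs 8 := by
  simp [evalAddr64, atReg, hsp, Val.addl]

theorem evalAddr64_atS {b k : ℕ} (hb : se.symb idS = some b) :
    evalAddr64 se (atS k) rs = .ptr b (BitVec.ofNat 64 (4 * k)) := by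
  simp [evalAddr64, atS, SymTbl.address, hb, Val.addl]

/-- The prologue, up to the first conditional jump. In this and the following statements the offset
of `PC` is the position of an instruction in `codeG`. -/
theorem exec_prologue {i : Word32} {bsp : ℕ} {osp : Ptrofs} (hg : se.symb idG = some bg)
    (hpc : rs .PC = .ptr bg 0) (hsp : rs .SP = .ptr bsp osp) (hra : (rs .RA).HasType .ptr)
    (hra' : rs .RA ≠ .undef) (hdi : rs (.IR .RDI) = .int i) :
    ∃ rs' m', (asmSem progA).Star se ⟨nb, rs, m, true⟩ [] ⟨nb, rs', m', true⟩ ∧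
      EqOff m.nextblock m m' ∧
      HasFrame m' m.nextblock (rs .SP) (rs (.IR .RBX)) (rs .RA) ∧
      rs' .PC = .ptr bg 4 ∧ rs' .SP = .ptr m.nextblock 0 ∧
      (∀ r ∈ calleeSave, r ≠ .IR .RBX → rs' r = rs r) ∧ rs' (.IR .RBX) = .int i ∧
      rs' (.CR .ZF) = .ofBool (decide (i = 0)) := by
  obtain ⟨n₁, n₂, n₃, h1, h2, h3, he, hf⟩ := exists_frame m (vsp := rs .SP) (vra := rs .RA)
    (rs (.IR .RBX)) (by rw [hsp]; trivial) (by rw [hsp]; simp) hra hra'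
  -- The final registers are found by executing the instructions.
  refine ⟨?_, n₃, ?_, he, hf, ?_⟩
  rotate_left
  · refine codeG_step (k := 0) hg hpc rfl (exec_allocframe h1 h2) ?_
    refine codeG_step (k := 1) hg (by simp [hpc, Val.offsetPtr]) rfl
      (exec_mov_mr_a (m' := n₃) ?_) ?_
    · rw [evalAddr64_atReg_eight (bs := m.nextblock) (by simp)]
      simpa [Mem.storev] using h3
    refine codeG_step (k := 2) hg (by simp [hpc, Val.offsetPtr]) rfl rfl ?_
    refine codeG_step (k := 3) hg (by simp [hpc, Val.offsetPtr]) rfl rfl ?_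
    exact .refl _
  · simp [hpc, Val.offsetPtr, hdi, Val.and, Val.cmpEq, calleeSave]

/-- From the first conditional jump to the epilogue if the argument is zero. -/
theorem exec_zero (hg : se.symb idG = some bg) (hpc : rs .PC = .ptr bg 4)
    (hzf : rs (.CR .ZF) = .int 1) :
    ∃ rs', (asmSem progA).Star se ⟨nb, rs, m, true⟩ [] ⟨nb, rs', m, true⟩ ∧ KeepsRegs rs rs' ∧
      rs' .PC = .ptr bg 20 ∧ rs' (.IR .RAX) = .int 0 := by
  refine ⟨?_, ?_, ?_⟩
  rotate_left
  · refine codeG_step (k := 4) hg hpc rfl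
      (exec_jcc_not_taken (by simp [TestCond.eval, hzf])) ?_
    refine codeG_step (k := 5) hg (by simp [hpc, Val.offsetPtr]) rfl rfl ?_
    refine codeG_step (k := 6) hg (by simp [hpc, Val.offsetPtr]) rfl
      (exec_jmp (bg := bg) (k := 20) (o := 6) rfl (by simp [hpc, Val.offsetPtr])) ?_
    exact .refl _
  · simp [KeepsRegs, calleeSave]

/-- From the first conditional jump to the second one if the argument is not zero. -/
theorem exec_test {b : ℕ} {i i' : Word32} (hg : se.symb idG = some bg)
    (hs : se.symb idS = some b) (hpc : rs .PC = .ptr bg 4) (hzf : rs (.CR .ZF) = .int 0)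
    (hbx : rs (.IR .RBX) = .int i) (hl : m.load .int32 b 0 = some (.int i')) :
    ∃ rs', (asmSem progA).Star se ⟨nb, rs, m, true⟩ [] ⟨nb, rs', m, true⟩ ∧ KeepsRegs rs rs' ∧
      rs' .PC = .ptr bg 10 ∧ rs' (.IR .RBX) = .int i ∧
      rs' (.CR .ZF) = .ofBool (decide (i' = i)) := by
  refine ⟨?_, ?_, ?_⟩
  rotate_left
  · refine codeG_step (k := 4) hg hpc rfl
      (exec_jcc_taken (k := 8) (by simp [TestCond.eval, hzf]) rfl hpc) ?_
    refine codeG_step (k := 8) hg (by simp) rfl (exec_movl_rm (v := .int i') ?_) ?_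
    · rw [evalAddr64_atS hs]
      exact hl
    refine codeG_step (k := 9) hg (by simp [Val.offsetPtr]) rfl rfl ?_
    exact .refl _
  · simp [hbx, Val.offsetPtr, Val.cmpEq, KeepsRegs, calleeSave]

/-- From the second conditional jump to the epilogue if the cached result is used. -/
theorem exec_cached {b : ℕ} {r : Word32} (hg : se.symb idG = some bg)
    (hs : se.symb idS = some b) (hpc : rs .PC = .ptr bg 10) (hzf : rs (.CR .ZF) = .int 1)
    (hl : m.load .int32 b 4 = some (.int r)) :
    ∃ rs', (asmSem progA).Star se ⟨nb, rs, m, true⟩ [] ⟨nb, rs', m, true⟩ ∧ KeepsRegs rs rs' ∧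
      rs' .PC = .ptr bg 20 ∧ rs' (.IR .RAX) = .int r := by
  refine ⟨?_, ?_, ?_⟩
  rotate_left
  · refine codeG_step (k := 10) hg hpc rfl
      (exec_jcc_taken (k := 18) (by simp [TestCond.eval, hzf]) rfl hpc) ?_
    refine codeG_step (k := 18) hg (by simp) rfl (exec_movl_rm (v := .int r) ?_) ?_
    · rw [evalAddr64_atS hs]
      exact hl
    refine codeG_step (k := 19) hg (by simp [Val.offsetPtr]) rfl rfl ?_
    exact .refl _
  · simp [Val.offsetPtr, KeepsRegs, calleeSave]

/-- From the second conditional jump to the call of `f`. -/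
theorem exec_call {i : Word32} (hg : se.symb idG = some bg) (hpc : rs .PC = .ptr bg 10)
    (hzf : rs (.CR .ZF) = .int 0) (hbx : rs (.IR .RBX) = .int i) :
    ∃ rs', (asmSem progA).Star se ⟨nb, rs, m, true⟩ [] ⟨nb, rs', m, true⟩ ∧ KeepsRegs rs rs' ∧
      rs' .PC = se.address idF 0 ∧ rs' .RA = .ptr bg 13 ∧ rs' (.IR .RBX) = .int i ∧
      rs' (.IR .RDI) = .int (i - 1) := by
  refine ⟨?_, ?_, ?_⟩
  rotate_left
  · refine codeG_step (k := 10) hg hpc rfl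
      (exec_jcc_not_taken (by simp [TestCond.eval, hzf])) ?_
    refine codeG_step (k := 11) hg (by simp [hpc, Val.offsetPtr]) rfl rfl ?_
    refine codeG_step (k := 12) hg (by simp [hpc, Val.offsetPtr]) rfl rfl ?_
    exact .refl _
  · simp [hpc, hbx, Val.offsetPtr, KeepsRegs, calleeSave, evalAddr32, atReg, Val.add,
      sub_eq_add_neg]

/-- From the return of `f` to the epilogue. -/
theorem exec_sum {b : ℕ} {i r : Word32} {m'' : Mem} (hg : se.symb idG = some bg)
    (hs : se.symb idS = some b) (hpc : rs .PC = .ptr bg 13) (hbx : rs (.IR .RBX) = .int i)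
    (hax : rs (.IR .RAX) = .int r) (h0 : m.store .int32 b 0 (.int i) = some m')
    (h1 : m'.store .int32 b 4 (.int (i + r)) = some m'') :
    ∃ rs', (asmSem progA).Star se ⟨nb, rs, m, true⟩ [] ⟨nb, rs', m'', true⟩ ∧ KeepsRegs rs rs' ∧
      rs' .PC = .ptr bg 20 ∧ rs' (.IR .RAX) = .int (i + r) := by
  have hsum : evalAddr32 se ⟨some .RAX, some .RBX, .inl 0⟩ rs = .int (i + r) := by
    simp [evalAddr32, hax, hbx, Val.add, add_comm]
  refine ⟨?_, ?_, ?_⟩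
  rotate_left
  · refine codeG_step (k := 13) hg hpc rfl rfl ?_
    refine codeG_step (k := 14) hg (by simp [hpc, Val.offsetPtr]) rfl
      (exec_movl_mr (m' := m') ?_) ?_
    · rw [evalAddr64_atS hs]
      simpa [hbx, Mem.storev] using h0
    refine codeG_step (k := 15) hg (by simp [hpc, Val.offsetPtr]) rfl
      (exec_movl_mr (m' := m'') ?_) ?_
    · rw [evalAddr64_atS hs]
      simpa [hsum, Mem.storev] using h1
    refine codeG_step (k := 16) hg (by simp [hpc, Val.offsetPtr]) rfl
      (exec_jmp (bg := bg) (k := 20) (o := 16) rfl (by simp [hpc, Val.offsetPtr])) ?_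
    exact .refl _
  · simp [hsum, KeepsRegs, calleeSave]

/-- The epilogue. -/
theorem exec_epilogue {bsp : ℕ} {osp : Ptrofs} {vrbx vra : Val} (hg : se.symb idG = some bg)
    (hpc : rs .PC = .ptr bg 20) (hsp : rs .SP = .ptr bs 0)
    (hf : HasFrame m bs (.ptr bsp osp) vrbx vra) (hb : bsp < nb) :
    ∃ rs' m', (asmSem progA).Star se ⟨nb, rs, m, true⟩ [] ⟨nb, rs', m', false⟩ ∧
      EqOff bs m m' ∧ rs' .SP = .ptr bsp osp ∧ rs' .PC = vra ∧ rs' (.IR .RBX) = vrbx ∧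
      (∀ r ∈ calleeSave, r ≠ .IR .RBX → rs' r = rs r) ∧ rs' (.IR .RAX) = rs (.IR .RAX) := by
  obtain ⟨m', hm'⟩ := Mem.exists_free hf.freeable
  refine ⟨?_, m', ?_, .free hm', ?_⟩
  rotate_left
  · refine codeG_step (k := 20) hg hpc rfl (exec_mov_rm_a (v := vrbx) ?_) ?_
    · rw [evalAddr64_atReg_eight hsp]
      exact hf.saved_rbx
    refine codeG_step (k := 21) hg (by simp [hpc, Val.offsetPtr]) rfl
      (exec_freeframe (bs := bs) (by simp [hsp]) hf.saved_ra hf.saved_sp hm') ?_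
    refine codeG_step (k := 22) hg (by simp [hpc, Val.offsetPtr]) rfl
      (exec_ret (live := false) ?_) ?_
    · simp [innerSP, hb]
    exact .refl _
  · simp [calleeSave]

end Code

/-! ### The simulation of the specification by the code -/

/-- The activation of `g` that started in the world `w` is running in the target state `s` with
stack frame `bs`, and its memory is related by `j'` to the source memory `m₁'`. -/
structure Active (w : CAWorld) (bs : ℕ) (j' : MemInj) (m₁' : Mem) (s : AsmState) : Prop where
  start : Mem.Inject w.injp.j w.injp.m₁ w.injp.m₂
  sg : w.sg = sgIntInt
  sp_valid : ∃ b o, w.rs .SP = .ptr b o ∧ w.injp.m₂.Valid b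
  nb : s.nb = w.injp.m₂.nextblock
  live : s.live = true
  frame : FramePrivate w bs j' m₁' s.rs s.mem
  freeable : s.mem.RangePerm bs 0 24 .cur .freeable
  saved : ∀ r ∈ calleeSave, r ≠ .IR .RBX → s.rs r = w.rs r

/-- The simulation invariant. Up to the call of `f` the source memory and the injection are those
of the incoming query; at the call of `f` and after it the stack frame is private. -/
def SimRel (se₁ se₂ : SymTbl) (w : CAWorld) : StateA → AsmState → Prop
  | .callg i m, s => ∃ bg, se₁.symb idG = some bg ∧
      CAQuery w ⟨.ptr bg 0, sgIntInt, [.int i], m⟩ ⟨s.rs, s.mem⟩ ∧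
      s.nb = w.injp.m₂.nextblock ∧ s.live = true
  | .callf vf i m, s => ∃ bf bg bs, vf = .ptr bf 0 ∧ se₁.symb idF = some bf ∧
      se₂.symb idG = some bg ∧ Active w bs w.injp.j m s ∧
      s.rs .PC = se₂.address idF 0 ∧ s.rs .RA = .ptr bg 13 ∧
      s.rs (.IR .RBX) = .int i ∧ s.rs (.IR .RDI) = .int (i - 1)
  | .returnf i r m, s => ∃ bg bs j', se₂.symb idG = some bg ∧ Active w bs j' m s ∧
      s.rs .PC = .ptr bg 13 ∧ s.rs (.IR .RBX) = .int i ∧ s.rs (.IR .RAX) = .int r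
  | .returng r m, s => s.live = false ∧ CAReply w ⟨.int r, m⟩ ⟨s.rs, s.mem⟩

/-- An `int` argument is passed in a register. -/
theorem outgoingArguments_sgIntInt (sp : Val) : outgoingArguments sgIntInt sp = ∅ := by
  apply Set.eq_empty_of_forall_notMem
  rintro x ⟨so, _, h1, h2⟩
  have : sizeArguments sgIntInt = 0 := rfl
  rw [this] at h2
  omega

section Activation

variable {w : CAWorld} {bs : ℕ} {j' : MemInj} {m₁ m₂ : Mem} {nb : ℕ} {rs rs' : Regset}

theorem Active.regs (h : Active w bs j' m₁ ⟨nb, rs, m₂, true⟩) (hk : KeepsRegs rs rs') :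
    Active w bs j' m₁ ⟨nb, rs', m₂, true⟩ where
  start := h.start
  sg := h.sg
  sp_valid := h.sp_valid
  nb := h.nb
  live := rfl
  frame := { h.frame with sp := hk.1.trans h.frame.sp }
  freeable := h.freeable
  saved r hr hr' := (hk.2 r hr hr').trans (h.saved r hr hr')

theorem Active.hasFrame {s : AsmState} (h : Active w bs j' m₁ s) :
    HasFrame s.mem bs (w.rs .SP) (w.rs (.IR .RBX)) (w.rs .RA) :=
  ⟨h.freeable, h.frame.saved_sp, h.frame.saved_rbx, h.frame.saved_ra⟩

/-- The memories of a running activation may evolve, as long as this leaves its frame alone: a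
new mapping relates new blocks, hence does not reach the frame. -/
theorem Active.evolve {s : AsmState} {j'' : MemInj} {m₁' m₂' : Mem}
    (h : Active w bs j' m₁ s) (ha : InjpAcc ⟨j', m₁, s.mem⟩ ⟨j'', m₁', m₂'⟩)
    (hi : Mem.Inject j'' m₁' m₂')
    (hsp : rs' .SP = s.rs .SP) (hsaved : ∀ r ∈ calleeSave, r ≠ .IR .RBX → rs' r = s.rs r) :
    Active w bs j'' m₁' ⟨s.nb, rs', m₂', true⟩ := by
  have hu : ∀ o : ℤ, (bs, o) ∈ unchangedOn s.mem m₂' :=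
    fun o => ha.outOfReach (h.frame.out_of_reach o)
  have hf := h.hasFrame.unchanged fun o _ _ => hu o
  have hno : ∀ b δ, j'' b ≠ some (bs, δ) := fun b δ hb =>
    h.frame.no_preimage b δ (ha.eq_of_valid₂ hb (h.freeable 0 le_rfl (by decide)).valid)
  exact
    { start := h.start
      sg := h.sg
      sp_valid := h.sp_valid
      nb := h.nb
      live := rfl
      frame :=
        { fresh := h.frame.fresh
          sp := hsp.trans h.frame.sp
          acc := h.frame.acc.trans h.start ha
          inj := hi
          no_preimage := hno
          out_of_reach := fun o b δ hb => absurd hb (hno b δ)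
          saved_sp := hf.saved_sp
          saved_rbx := hf.saved_rbx
          saved_ra := hf.saved_ra }
      freeable := hf.freeable
      saved := fun r hr hr' => (hsaved r hr hr').trans (h.saved r hr hr') }

variable {se₁ se₂ : SymTbl} {bg : ℕ}

/-- The epilogue leads from a running activation to a reply. -/
theorem Active.finish {r : Word32} (hg : se₂.symb idG = some bg)
    (h : Active w bs j' m₁ ⟨nb, rs, m₂, true⟩) (hpc : rs .PC = .ptr bg 20)
    (hax : rs (.IR .RAX) = .int r) :
    ∃ s', SimRel se₁ se₂ w (.returng r m₁) s' ∧
      (asmSem progA).Star se₂ ⟨nb, rs, m₂, true⟩ [] s' := by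
  obtain ⟨bsp, osp, hsp, hv⟩ := h.sp_valid
  have hf := h.hasFrame
  rw [hsp] at hf
  obtain ⟨rs', m', hstar, he, h1, h2, h3, h4, h5⟩ :=
    exec_epilogue (nb := nb) hg hpc h.frame.sp hf (hv.trans_eq h.nb.symm)
  refine ⟨_, ⟨rfl, j', he.injpAcc h.frame.acc h.frame.fresh, he.inject h.frame.inj
    h.frame.no_preimage, ?_, ?_, h1.trans hsp.symm, h2, ?_⟩, hstar⟩
  · rw [h.sg]
    have : rs' (.IR .RAX) = .int r := h5.trans hax
    simp only [getResult, Signature.resType, sgIntInt, Option.getD_some, this]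
    exact .int r
  · rw [h.sg, outgoingArguments_sgIntInt]
    exact Set.empty_subset _
  · intro r hr
    by_cases hb : r = .IR .RBX
    · subst hb
      exact h3
    · exact (h4 r hr hb).trans (h.saved r hr hb)

/-- The prologue leads from an incoming query to a running activation. -/
theorem Active.exists_of_query {i : Word32} {b : ℕ} {m : Mem} {s : AsmState}
    (hs : w.injp.MatchStbls se₁ se₂) (hg₁ : se₁.symb idG = some b)
    (hg : se₂.symb idG = some bg)
    (hq : CAQuery w ⟨.ptr b 0, sgIntInt, [.int i], m⟩ ⟨s.rs, s.mem⟩)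
    (hnb : s.nb = w.injp.m₂.nextblock) (hlive : s.live = true) :
    ∃ rs' m₂', (asmSem progA).Star se₂ s [] ⟨s.nb, rs', m₂', true⟩ ∧
      Active w w.injp.m₂.nextblock w.injp.j m ⟨s.nb, rs', m₂', true⟩ ∧
      rs' .PC = .ptr bg 4 ∧ rs' (.IR .RBX) = .int i ∧
      rs' (.CR .ZF) = .ofBool (decide (i = 0)) := by
  obtain ⟨nb, rs, m₂, live⟩ := s
  obtain ⟨h1, h2, h3, h4, hinj, hvf, hargs, -, -, -, hsp, hra, hra'⟩ := hq
  simp only at h1 h2 h3 h4 hnb hlive hvf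
  subst h1 h2 h4 hnb hlive
  obtain ⟨b', hj, hg'⟩ := hs.1.symb_mapped hg₁
  rw [hg] at hg'
  cases hg'
  have hpc := hvf.ptr_left hj
  have hdi : w.rs (.IR .RDI) = .int i := by
    rw [← h3] at hargs
    obtain _ | ⟨ha, -⟩ := hargs
    exact (ha.unique (.int i) (by simp)).symm ▸ rfl
  obtain ⟨bsp, osp, hsp', hv⟩ := id hsp
  obtain ⟨rs', m₂', hstar, he, hf, h5, h6, h7, h8, h9⟩ :=
    exec_prologue (nb := w.injp.m₂.nextblock) (m := w.injp.m₂) hg hpc hsp' hra' hra hdi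
  have hno : ∀ b δ, w.injp.j b ≠ some (w.injp.m₂.nextblock, δ) :=
    fun b δ hb => lt_irrefl _ (hinj.mappedblocks _ _ _ hb)
  exact ⟨rs', m₂', hstar,
    { start := hinj
      sg := h3.symm
      sp_valid := hsp
      nb := rfl
      live := rfl
      frame :=
        { fresh := lt_irrefl _
          sp := h6
          acc := he.injpAcc (.refl w.injp) (lt_irrefl _)
          inj := he.inject hinj hno
          no_preimage := hno
          out_of_reach := fun o b δ hb => absurd hb (hno b δ)
          saved_sp := hf.saved_sp
          saved_rbx := hf.saved_rbx
          saved_ra := hf.saved_ra }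
      freeable := hf.freeable
      saved := h7 }, h5, h8, h9⟩

end Activation

section Simulation

variable {se₁ se₂ : SymTbl} {w : CAWorld}

/-- The value of a global variable is the same in the source and in the target. -/
theorem load_symbol {j : MemInj} {m₁ m₂ : Mem} (hs : MatchStbls j se₁ se₂)
    (hi : Mem.Inject j m₁ m₂) {id b : ℕ} (hb : se₁.symb id = some b) {c : Chunk} {o : ℤ}
    {n : Word32} (hl : m₁.load c b o = some (.int n)) :
    ∃ b', se₂.symb id = some b' ∧ m₂.load c b' o = some (.int n) := by
  obtain ⟨b', hj, hb'⟩ := hs.symb_mapped hb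
  obtain ⟨v, hv, hvi⟩ := hi.load hj hl
  rw [add_zero] at hv
  refine ⟨b', hb', ?_⟩
  rw [hv, ← hvi.unique (.int n) (by simp)]

/-- Each internal step of the specification is matched by the execution of `g` up to its next call
or its return. -/
theorem simRel_internal (hs : w.injp.MatchStbls se₁ se₂)
    {s₁ s₁' : StateA} {s₂ : AsmState} {t : List Event} (hr : SimRel se₁ se₂ w s₁ s₂)
    (hstep : StepA se₁ s₁ t s₁') :
    ∃ s₂', SimRel se₁ se₂ w s₁' s₂' ∧ (asmSem progA).Star se₂ s₂ t s₂' := by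
  cases hstep with
  | zero i m hi =>
    obtain ⟨b, hg₁, hq, hnb, hlive⟩ := hr
    obtain ⟨bg, -, hg⟩ := hs.1.symb_mapped hg₁
    obtain ⟨rs, m₂, hst, hA, hpc, -, hzf⟩ := Active.exists_of_query hs hg₁ hg hq hnb hlive
    obtain ⟨rs', hst', hk, hpc', hax⟩ :=
      exec_zero (nb := s₂.nb) (m := m₂) hg hpc (by rw [hzf, decide_eq_true hi]; rfl)
    obtain ⟨s', hs', hst''⟩ := (hA.regs hk).finish (se₁ := se₁) hg hpc' hax
    exact ⟨s', hs', hst.trans (hst'.trans hst'')⟩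
  | cached i r m bs hi hsym h0 h1 =>
    obtain ⟨b, hg₁, hq, hnb, hlive⟩ := hr
    obtain ⟨bg, -, hg⟩ := hs.1.symb_mapped hg₁
    obtain ⟨rs, m₂, hst, hA, hpc, hbx, hzf⟩ := Active.exists_of_query hs hg₁ hg hq hnb hlive
    obtain ⟨bs', hsym', h0'⟩ := load_symbol hs.1 hA.frame.inj hsym h0
    obtain ⟨bs'', hsym'', h1'⟩ := load_symbol hs.1 hA.frame.inj hsym h1
    rw [hsym'] at hsym''
    cases hsym''
    obtain ⟨rs', hst', hk, hpc', hbx', hzf'⟩ := exec_test (nb := s₂.nb) (m := m₂) hg hsym' hpc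
      (by rw [hzf, decide_eq_false hi]; rfl) hbx h0'
    obtain ⟨rs'', hst'', hk', hpc'', hax⟩ := exec_cached (nb := s₂.nb) (m := m₂) hg hsym' hpc'
      (by rw [hzf', decide_eq_true rfl]; rfl) h1'
    obtain ⟨s', hs', hst'''⟩ := ((hA.regs hk).regs hk').finish (se₁ := se₁) hg hpc'' hax
    exact ⟨s', hs', hst.trans (hst'.trans (hst''.trans hst'''))⟩
  | call i i' m bs bf hi hsym h0 hne hf =>
    obtain ⟨b, hg₁, hq, hnb, hlive⟩ := hr
    obtain ⟨bg, -, hg⟩ := hs.1.symb_mapped hg₁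
    obtain ⟨rs, m₂, hst, hA, hpc, hbx, hzf⟩ := Active.exists_of_query hs hg₁ hg hq hnb hlive
    obtain ⟨bs', hsym', h0'⟩ := load_symbol hs.1 hA.frame.inj hsym h0
    obtain ⟨rs', hst', hk, hpc', hbx', hzf'⟩ := exec_test (nb := s₂.nb) (m := m₂) hg hsym' hpc
      (by rw [hzf, decide_eq_false hi]; rfl) hbx h0'
    obtain ⟨rs'', hst'', hk', hpc'', hra, hbx'', hdi⟩ := exec_call (nb := s₂.nb) (m := m₂) hg
      hpc' (by rw [hzf', decide_eq_false (Ne.symm hne)]; rfl) hbx'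
    exact ⟨_, ⟨bf, bg, _, rfl, hf, hg, (hA.regs hk).regs hk', hpc'', hra, hbx'', hdi⟩,
      hst.trans (hst'.trans hst'')⟩
  | sum i r m m' m'' b hsym h0 h1 =>
    obtain ⟨nb, rs, m₂, live⟩ := s₂
    obtain ⟨bg, bs, j', hg, hA, hpc, hbx, hax⟩ := hr
    obtain rfl : live = true := hA.live
    have hs' := hs.acc hA.frame.acc
    obtain ⟨b', hj, hsym'⟩ := hs'.1.symb_mapped hsym
    obtain ⟨n, h0', hi, ha⟩ := hA.frame.inj.store hj (.int i) h0
    obtain ⟨n', h1', hi', ha'⟩ := hi.store hj (.int (i + r)) h1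
    rw [add_zero] at h0' h1'
    have hA' := hA.evolve (ha.trans hA.frame.inj ha') hi' rfl fun _ _ _ => rfl
    obtain ⟨rs', hst, hk, hpc', hax'⟩ := exec_sum (nb := nb) hg hsym' hpc hbx hax h0' h1'
    obtain ⟨s', hs', hst'⟩ := (hA'.regs hk).finish (se₁ := se₁) hg hpc' hax'
    exact ⟨s', hs', hst.trans hst'⟩

/-- The call of `f`: the outgoing queries are related in the world of the current injection and
memories, and after related replies the stack frame is unchanged and private as before. -/
theorem simRel_call (hs : w.injp.MatchStbls se₁ se₂) {vf : Val} {i : Word32} {m : Mem}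
    {s₂ : AsmState} (hr : SimRel se₁ se₂ w (.callf vf i m) s₂) :
    ∃ bs, FramePrivate w bs w.injp.j m s₂.rs s₂.mem ∧
      (asmSem progA).X se₂ s₂ (AsmConf.mk s₂.rs s₂.mem) ∧
      InjpWorld.MatchStbls ⟨w.injp.j, m, s₂.mem⟩ se₁ se₂ ∧
      CAQuery ⟨⟨w.injp.j, m, s₂.mem⟩, sgIntInt, s₂.rs⟩ ⟨vf, sgIntInt, [.int (i - 1)], m⟩
        ⟨s₂.rs, s₂.mem⟩ ∧
      ∀ (r : Word32) (m₁' : Mem) (rs' : Regset) (m₂' : Mem),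
        CAReply ⟨⟨w.injp.j, m, s₂.mem⟩, sgIntInt, s₂.rs⟩ ⟨.int r, m₁'⟩ ⟨rs', m₂'⟩ →
        (∀ o : ℤ, 0 ≤ o → o < 24 → (bs, o) ∈ unchangedOn s₂.mem m₂') ∧
        ∃ j'', FramePrivate w bs j'' m₁' rs' m₂' ∧
          (asmSem progA).Y se₂ s₂ (AsmConf.mk rs' m₂') ⟨s₂.nb, rs', m₂', true⟩ ∧
          SimRel se₁ se₂ w (.returnf i r m₁') ⟨s₂.nb, rs', m₂', true⟩ := by
  obtain ⟨bf, bg, bs, rfl, hf₁, hg, hA, hpc, hra, hbx, hdi⟩ := hr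
  obtain ⟨bf', hj, hf⟩ := hs.1.symb_mapped hf₁
  have hpc' : s₂.rs .PC = .ptr bf' 0 := by rw [hpc, SymTbl.address, hf]
  have hX : ∃ b sg, s₂.rs .PC = .ptr b 0 ∧ progA.DefAt se₂ b (.external sg) :=
    ⟨bf', sgIntInt, hpc', idF, hf, rfl⟩
  refine ⟨bs, hA.frame, ⟨hA.live, rfl, hX⟩, hs.acc hA.frame.acc, ?_, ?_⟩
  · refine ⟨rfl, rfl, rfl, rfl, hA.frame.inj, ?_, ?_, ?_, ?_, by simp, ?_, ?_, ?_⟩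
    · simp only [hpc']
      exact .ptr_zero 0 hj
    · refine .cons ?_ .nil
      simp only [getLoc, hdi]
      exact .int _
    · rw [outgoingArguments_sgIntInt]
      exact Set.empty_subset _
    · rw [outgoingArguments_sgIntInt]
      exact Set.empty_subset _
    · exact ⟨bs, 0, hA.frame.sp, (hA.freeable 0 le_rfl (by decide)).valid⟩
    · simp [hra]
    · simp only [hra]
      trivial
  · rintro r m₁' rs' m₂' ⟨j'', ha, hi, hres, -, hsp, hpcr, hcs⟩
    have hA' := hA.evolve ha hi hsp fun r hr _ => hcs r hr
    have hbx' : rs' (.IR .RBX) = .int i := (hcs _ (by simp [calleeSave])).trans hbx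
    have hax : rs' (.IR .RAX) = .int r := hres.unique (.int r) (by simp)
    refine ⟨fun o _ _ => ha.outOfReach (hA.frame.out_of_reach o), j'', hA'.frame,
      ⟨hA.live, hX, ha.acc₂.nextblock_le, true, ?_, rfl⟩,
      bg, bs, j'', hg, hA', hpcr.trans hra, hbx', hax⟩
    -- The activation goes on, as the frame was allocated after the incoming query.
    have hsp' : rs' .SP = .ptr bs 0 := hA'.frame.sp
    have hle : w.injp.m₂.nextblock ≤ bs := not_lt.mp hA.frame.fresh
    simp only [hsp', innerSP, hA.nb, hle, decide_true]

theorem defAt_internal_iff {se : SymTbl} {b : ℕ} {f : AsmFun} :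
    progA.DefAt se b (.internal f) ↔ se.symb idG = some b ∧ f = funG := by
  constructor
  · rintro ⟨id, h1, h2⟩
    unfold progA at h2
    split_ifs at h2 with h3 h4
    · simp at h2
    · cases h2
      exact ⟨h4 ▸ h1, rfl⟩
    · simp at h2
  · rintro ⟨h1, rfl⟩
    exact ⟨idG, h1, rfl⟩

theorem specA_sim (se₁ se₂ : SymTbl) :
    IsOpenSim ccCAinjp ccCAinjp specA (asmSem progA) se₁ se₂ (SimRel se₁ se₂) where
  valid_query := by
    rintro w ⟨vf, sg, args, m⟩ ⟨rs, m₂⟩ hs hq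
    have hrs : rs = w.rs := hq.rs
    have hvf : Val.Inject w.injp.j vf (rs .PC) := hrs ▸ hq.vf
    have hu : vf ≠ .undef := hq.vf_def
    have hiff := hs.1.defAt_pc (p := progA) hvf hu (d := .internal funG)
    simp only [defAt_internal_iff, and_true] at hiff
    simp only [specA, asmSem, defAt_internal_iff]
    constructor
    · rintro ⟨b, h1, h2⟩
      obtain ⟨b', h3, h4⟩ := hiff.1 ⟨b, h2, h1⟩
      exact ⟨b', funG, h3, h4, rfl⟩
    · rintro ⟨b, f, h1, h2, rfl⟩
      obtain ⟨b', h3, h4⟩ := hiff.2 ⟨b, h1, h2⟩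
      exact ⟨b', h4, h3⟩
  initial := by
    rintro w q₁ ⟨rs, m₂⟩ s₁ hs hq ⟨bg, i, m, hg⟩
    have hrs : rs = w.rs := hq.rs
    have hm : m₂ = w.injp.m₂ := hq.mem₂
    obtain ⟨b, hj, hg'⟩ := hs.1.symb_mapped hg
    obtain ⟨bsp, osp, hsp, -⟩ := hq.sp_valid
    refine ⟨⟨m₂.nextblock, rs, m₂, true⟩, ⟨bg, hg, hq, by rw [hm], rfl⟩,
      ⟨b, funG, ?_, idG, hg', rfl⟩, ?_, ?_, rfl⟩
    · have := hq.vf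
      rw [← hrs] at this
      exact this.ptr_left hj
    · simp only [hrs, hsp]
      simp
    · simp only [hrs]
      exact hq.ra_def
  internal _ _ _ _ _ hs hr hstep := simRel_internal hs hr hstep
  external := by
    rintro w s₁ s₂ q₁ hs hr ⟨vf, i, m⟩
    obtain ⟨bs, -, hX, hs', hq, hY⟩ := simRel_call hs hr
    refine ⟨⟨⟨w.injp.j, m, s₂.mem⟩, sgIntInt, s₂.rs⟩, ⟨s₂.rs, s₂.mem⟩, hs', hq, hX, ?_⟩
    rintro _ ⟨rs', m₂'⟩ _ hrep ⟨_, _, r, _, m₁'⟩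
    obtain ⟨-, j'', -, hY', hr'⟩ := hY r m₁' rs' m₂' hrep
    exact ⟨_, hr', hY'⟩
  final := by
    rintro w s₁ s₂ r₁ hs hr ⟨r, m⟩
    exact ⟨⟨s₂.rs, s₂.mem⟩, hr.2, hr.1, rfl⟩

theorem simRel_frameProtected : FrameProtected se₁ se₂ (SimRel se₁ se₂) := by
  intro w vf i m₁' s₂ hs hr
  obtain ⟨bs, hF, hX, hs', hq, hY⟩ := simRel_call hs hr
  refine ⟨bs, w.injp.j, hF, hX, hs', hq, fun r m₁'' rs'' m₂'' hrep => ?_⟩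
  obtain ⟨hu, j'', hF', hY', hr'⟩ := hY r m₁'' rs'' m₂'' hrep
  exact ⟨hu, j'', _, hF', hY', hr'⟩

end Simulation

end MutSum

/-- `L_A` is simulated by the semantics of `M_A` under the direct convention; moreover the
simulation under `CAinjp` has an invariant that keeps the stack frame of `M_A` out of reach and
protected across the external call to `f`. -/
theorem mainTheorem11 :
    MutSum.OpenSim MutSum.ccC MutSum.ccC MutSum.specA (MutSum.asmSem MutSum.progA) ∧
    ∀ se₁ se₂ : MutSum.SymTbl, MutSum.ValidFor MutSum.specA.skel se₁ →
      ∃ R : MutSum.CAWorld → MutSum.StateA → MutSum.AsmState → Prop,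
        MutSum.IsOpenSim MutSum.ccCAinjp MutSum.ccCAinjp MutSum.specA
          (MutSum.asmSem MutSum.progA) se₁ se₂ R ∧
        MutSum.FrameProtected se₁ se₂ R := by
  refine ⟨?_, fun se₁ se₂ _ => ⟨MutSum.SimRel se₁ se₂, MutSum.specA_sim se₁ se₂,
    MutSum.simRel_frameProtected⟩⟩
  have hro : MutSum.OpenSim MutSum.ccRO MutSum.ccRO MutSum.specA MutSum.specA :=
    ⟨rfl, fun se₁ se₂ _ => ⟨_, MutSum.specA_ro_sim se₁ se₂⟩⟩
  have hwt : MutSum.OpenSim MutSum.ccWT MutSum.ccWT MutSum.specA MutSum.specA :=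
    ⟨rfl, fun se₁ se₂ _ => ⟨_, MutSum.specA_wt_sim se₁ se₂⟩⟩
  have hca : MutSum.OpenSim MutSum.ccCAinjp MutSum.ccCAinjp MutSum.specA
      (MutSum.asmSem MutSum.progA) :=
    ⟨rfl, fun se₁ se₂ _ => ⟨_, MutSum.specA_sim se₁ se₂⟩⟩
  have hasm : MutSum.OpenSim MutSum.ccAsmInjp MutSum.ccAsmInjp (MutSum.asmSem MutSum.progA)
      (MutSum.asmSem MutSum.progA) :=
    ⟨rfl, fun se₁ se₂ _ => ⟨_, MutSum.asmSem_self_sim _ se₁ se₂⟩⟩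
  refine hro.comp (hwt.comp (hca.comp hasm ?_) ?_) ?_
  · exact fun w se₁ se₂ h hv => hv.of_matchStbls h.1
  · rintro w se₁ _ rfl hv
    exact hv
  · rintro w _ _ ⟨rfl, rfl⟩ hv
    exact hv
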